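/- **Soundness of strong BV-categories for cut elimination.** *Logic.* Formulas over a set $\mathcal A$ of atoms are given by $A,B ::= \mathbb I \mid a \mid \bar a \mid (A ⅋ B)\mid (A\triangleleft B)\mid (A\otimes B)$ with $a\in\mathcal A$. The rules of $\mathsf{SBV}$ (premise $\to$ conclusion) are: $\equiv$, one use, in either direction, of an equation stating that $⅋$, $\otimes$, $\triangleleft$ are associative with unit $\mathbb I$ and that $⅋$ and $\otimes$ are commutative; $\mathsf{ai}{\downarrow}:\mathbb I\to a⅋\bar a$; $\mathsf{ai}{\uparrow}: a\otimes\bar a\to\mathbb I$; $\mathsf s: A\otimes(B⅋C)\to(A\otimes B)⅋C$; $\mathsf q{\downarrow}:(A⅋B)\triangleleft(C⅋D)\to(A\triangleleft C)⅋(B\triangleleft D)$; $\mathsf q{\uparrow}:(A\triangleleft B)\otimes(C\triangleleft D)\to(A\otimes C)\triangleleft(B\otimes D)$. $\mathsf{BV}$ is $\mathsf{SBV}$ without $\mathsf{ai}{\uparrow}$ and $\mathsf q{\uparrow}$. Derivations (open deduction) are: formulas $A$; $\Phi\odot\Psi$ for $\odot\in\{⅋,\triangleleft,\otimes\}$; and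 $\Phi$ on top of an instance of a rule on top of $\Psi$. A proof is a derivation with premise $\mathbb I$. Vertical composition of derivations is written $\Phi;\Psi$, and derivations denoting the same two-dimensional object are identified. *Atomic flows.* The atomic flow $\mathrm{AF}(\Phi)$ of a derivation with premise $A$ and conclusion $B$ goes from the string of literal occurrences of $A$ to that of $B$. Flows are diagrams built by vertical and horizontal composition from wires, crossings of two wires, caps $\varepsilon\to l\,\bar l$ and cups $l\,\bar l\to\varepsilon$ ($l$ a literal), modulo the strict monoidal laws (with interchange), the involutivity of the crossing, the Yang–Baxter equation, the symmetry of caps and cups, and the sliding of a wire across a cap or a cup. $\mathsf{ai}{\downarrow}$ is interpreted by a cap, $\mathsf{ai}{\uparrow}$ by a cup, $\mathsf s$ and the associativity and unit equations by identities, commutativity by a crossing of the two strings, and $\mathsf q{\downarrow}$ and $\mathsf q{\uparrow}$ by crossing the two middle strings; $\odot$ is horizontal composition. *Cut elimination.* A splitting of a $\mathsf{BV}$ proof $\Phi$ of $(A\otimes B)⅋K$ consists of formulas $K_A,K_B$ and $\mathsf{BV}$ derivations $\Phi_A:\mathbb I\to A⅋K_A$, $\Phi_B:\mathbb I\to B⅋K_B$,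 $\Phi_K:K_A⅋K_B\to K$ such that the proof of $(A\otimes B)⅋K$ obtained from $\Phi_A\otimes\Phi_B$ by switches (and $\equiv$) to $(A\otimes B)⅋(K_A⅋K_B)$ followed by $\Phi_K$ has the same flow as $\Phi$. Splittings of proofs of $(A\triangleleft B)⅋K$ are defined in the same way with $\Phi_K:K_A\triangleleft K_B\to K$ and $\mathsf q{\downarrow}$; a splitting of a proof $\Phi$ of $l⅋K$, $l$ a literal, is a $\mathsf{BV}$ derivation $\Phi_l:\bar l\to K$ such that $\mathbb I\to l⅋\bar l$ followed by $\Phi_l$ has the same flow as $\Phi$. Context reduction turns a $\mathsf{BV}$ proof of $\mathcal C[A]$ into a formula $K$, a $\mathsf{BV}$ proof of $A⅋K$ and, for every formula $X$, a $\mathsf{BV}$ derivation $\Theta_X:X⅋K\to\mathcal C[X]$, by recursion on the context $\mathcal C$: a proof of $\mathcal C[A]⅋P$ with $\mathcal C=\{\cdot\}$ is left as it is, with $K=P$ and $\Theta_X$ the identity; if $\mathcal C=\mathcal C'⅋B$ or $B⅋\mathcal C'$, then $B$ is moved into $P$; if $\mathcal C=\mathcal C'\odot B$ or $B\odot\mathcal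 C'$ with $\odot\in\{\otimes,\triangleleft\}$, the proof is split, the recursion continues with the part belonging to $\mathcal C'$, and the other two parts are appended to $\Theta_X$ by $\mathsf s$, respectively $\mathsf q{\downarrow}$. One step of cut elimination takes a topmost up-rule instance of a proof $\Phi=\Phi';\mathcal C[\rho];\Psi$, with $\Phi'$ in $\mathsf{BV}$ and $\rho$ an instance of $\mathsf q{\uparrow}$ or $\mathsf{ai}{\uparrow}$, reduces the context of $\Phi'$ at the premise of $\rho$ to a proof $\Phi_0$ and derivations $\Theta_X$, and * if $\rho$ is the above $\mathsf q{\uparrow}$, splits $\Phi_0$ (a proof of $((A\triangleleft B)\otimes(C\triangleleft D))⅋K$) by $\otimes$ into proofs of $(A\triangleleft B)⅋K_l$ and $(C\triangleleft D)⅋K_r$, splits these into proofs $\Phi_A,\Phi_B,\Phi_C,\Phi_D$ of $A⅋K_A,\dots,D⅋K_D$, combines $\Phi_A\otimes\Phi_C$ and $\Phi_B\otimes\Phi_D$ by switches and the results by $\mathsf q{\downarrow}$ into a proof of $((A\otimes C)\triangleleft(B\otimes D))⅋((K_A⅋K_C)\triangleleft(K_B⅋K_D))$, passes by $\mathsf q{\downarrow}$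 and the derivations $K_A\triangleleft K_B\to K_l$, $K_C\triangleleft K_D\to K_r$ and $K_l⅋K_r\to K$ of the splittings to $((A\otimes C)\triangleleft(B\otimes D))⅋K$, and appends $\Theta_{(A\otimes C)\triangleleft(B\otimes D)}$ and $\Psi$; * if $\rho$ is $\mathsf{ai}{\uparrow}$ on $a\otimes\bar a$, splits $\Phi_0$ by $\otimes$ and the two parts into $\Phi_a:\bar a\to K_a$ and $\Phi_{\bar a}:a\to K_{\bar a}$, and takes the proof $\mathbb I\to\bar a⅋a$, followed by $\Phi_a⅋\Phi_{\bar a}$, by $K_a⅋K_{\bar a}\to K\equiv\mathbb I⅋K$, by $\Theta_{\mathbb I}$ and by $\Psi$. $\Phi\rightsquigarrow_{\mathsf{CE}}\Phi'$ means that $\Phi$ is an $\mathsf{SBV}$ proof and that finitely many such steps (with any choice of instances and splittings) lead from $\Phi$ to the $\mathsf{BV}$ proof $\Phi'$. *Strong BV-categories.* A compact closed category $(\mathcal D,\boxtimes,J,(\cdot)^\perp,\eta,\epsilon)$ is strict if its monoidal structure is strict and the canonical isomorphisms $A^\perp\boxtimes B^\perp\cong(A\boxtimes B)^\perp$ and $A\cong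 A^{\perp\perp}$ are identities. A strong BV-category consists of an isomix $*$-autonomous category $(\mathcal C,\otimes,\mathbb I,(\cdot)^\perp)$, in which the isomix isomorphism is used to take $\mathbb I$ as the dualizing object, i.e. $A^\perp=A\multimap\mathbb I$ with evaluation $A^\perp\otimes A\to\mathbb I$, and where $A⅋B:=(A^\perp\otimes B^\perp)^\perp$; a second monoidal structure $(\triangleleft,\mathbb I)$; a natural isomorphism $\kappa_{AB}:A^\perp\triangleleft B^\perp\cong(A\triangleleft B)^\perp$; a natural transformation $q_{ABCD}:(A⅋B)\triangleleft(C⅋D)\to(A\triangleleft C)⅋(B\triangleleft D)$; and a faithful strict $*$-autonomous functor $U:\mathcal C\to\mathcal D$ (preserving the symmetric monoidal structure, the duals and the evaluations up to equality) into a strict compact closed category, which is also strict monoidal from $\triangleleft$ to $\boxtimes$, and satisfies $U(\kappa_{AB})=\mathrm{id}$ and $U(q_{ABCD})=\mathrm{id}\boxtimes\sigma\boxtimes\mathrm{id}$ with $\sigma$ the symmetry. *Interpretation.* Given a strong BV-category and objects $c_a\in\mathcal C$ for $a\in\mathcal A$, put $⟦\mathbb I⟧=\mathbb I$, $⟦a⟧=c_a$,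 $⟦\bar a⟧=c_a^\perp$, $⟦A\odot B⟧=⟦A⟧\odot⟦B⟧$. A derivation $\Phi$ from $A$ to $B$ is interpreted by a morphism $⟦\Phi⟧:⟦A⟧\to⟦B⟧$ of $\mathcal C$: horizontal composition by the functor $\odot$, vertical composition by composition, the equations by the associativity, unit and symmetry isomorphisms of $\otimes$, $⅋$ and $\triangleleft$, $\mathsf{ai}{\downarrow}$ by the canonical morphism $\mathbb I\to(c_a^\perp\otimes c_a^{\perp\perp})^\perp$ (the evaluation, curried), $\mathsf{ai}{\uparrow}$ by the symmetry followed by the evaluation, $\mathsf s$ by the canonical morphism $A\otimes(B⅋C)\to(A\otimes B)⅋C$ of the $*$-autonomous structure, $\mathsf q{\downarrow}$ by $q$, and $\mathsf q{\uparrow}$ by the dual $q'$ of $q$, i.e. $q^\perp_{A^\perp C^\perp B^\perp D^\perp}$ composed with the canonical isomorphisms and $\kappa$. **Theorem.** In every strong BV-category and for every choice of the objects $c_a$: if $\Phi$ is a proof in $\mathsf{SBV}$ and $\Phi\rightsquigarrow_{\mathsf{CE}}\Phi'$, then $⟦\Phi⟧=⟦\Phi'⟧$. -/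

import Mathlib

open CategoryTheory MonoidalCategory

universe u v₁ u₁ v₂ u₂

namespace BV

/-! ### Formulas, inference rules and derivations -/

/-- The three binary connectives: par, seq, tensor. -/
inductive Conn : Type
  | par
  | seq
  | tens

/-- Formulas over a set `𝒜` of atoms. -/
inductive Fm (𝒜 : Type u) : Type u
  | unit : Fm 𝒜
  | atom (a : 𝒜) : Fm 𝒜
  | natom (a : 𝒜) : Fm 𝒜
  | bin (o : Conn) (A B : Fm 𝒜) : Fm 𝒜

/-- par -/
local notation:65 A:66 " ⅋ " B:66 => Fm.bin Conn.par A B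
/-- seq -/
local notation:65 A:66 " ◃ " B:66 => Fm.bin Conn.seq A B
/-- tensor -/
local notation:65 A:66 " ⊠ " B:66 => Fm.bin Conn.tens A B

variable {𝒜 : Type u}

/-- The generating equations of formula equivalence, read from left to right. -/
inductive Eqn : Fm 𝒜 → Fm 𝒜 → Type u
  | tensAssoc (A B C : Fm 𝒜) : Eqn ((A ⊠ B) ⊠ C) (A ⊠ (B ⊠ C))
  | tensComm (A B : Fm 𝒜) : Eqn (A ⊠ B) (B ⊠ A)
  | tensUnit (A : Fm 𝒜) : Eqn (A ⊠ Fm.unit) A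
  | parAssoc (A B C : Fm 𝒜) : Eqn ((A ⅋ B) ⅋ C) (A ⅋ (B ⅋ C))
  | parComm (A B : Fm 𝒜) : Eqn (A ⅋ B) (B ⅋ A)
  | parUnit (A : Fm 𝒜) : Eqn (A ⅋ Fm.unit) A
  | seqAssoc (A B C : Fm 𝒜) : Eqn ((A ◃ B) ◃ C) (A ◃ (B ◃ C))
  | seqUnitRight (A : Fm 𝒜) : Eqn (A ◃ Fm.unit) A
  | seqUnitLeft (A : Fm 𝒜) : Eqn (Fm.unit ◃ A) A

/-- Instances of the inference rules of `SBV`; `Rule A B` has premise `A` and conclusion `B`.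
The equivalence rule applies one generating equation, in either direction. -/
inductive Rule : Fm 𝒜 → Fm 𝒜 → Type u
  | eqv {A B : Fm 𝒜} (e : Eqn A B) : Rule A B
  | eqvSymm {A B : Fm 𝒜} (e : Eqn A B) : Rule B A
  | aiDown (a : 𝒜) : Rule Fm.unit (Fm.atom a ⅋ Fm.natom a)
  | aiUp (a : 𝒜) : Rule (Fm.atom a ⊠ Fm.natom a) Fm.unit
  | switch (A B C : Fm 𝒜) : Rule (A ⊠ (B ⅋ C)) ((A ⊠ B) ⅋ C)
  | qDown (A B C D : Fm 𝒜) : Rule ((A ⅋ B) ◃ (C ⅋ D)) ((A ◃ C) ⅋ (B ◃ D))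
  | qUp (A B C D : Fm 𝒜) : Rule ((A ◃ B) ⊠ (C ◃ D)) ((A ⊠ C) ◃ (B ⊠ D))

/-- The rule instances of `BV`: all those of `SBV` except the two up-rules. -/
def Rule.IsBV : {A B : Fm 𝒜} → Rule A B → Prop
  | _, _, .aiUp _ => False
  | _, _, .qUp _ _ _ _ => False
  | _, _, _ => True

/-- Open-deduction derivations in `SBV`; `Der A B` has premise `A` and conclusion `B`. -/
inductive Der : Fm 𝒜 → Fm 𝒜 → Type u
  | id (A : Fm 𝒜) : Der A A
  | hor (o : Conn) {A B A' B' : Fm 𝒜} (Φ : Der A B) (Ψ : Der A' B') :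
      Der (Fm.bin o A A') (Fm.bin o B B')
  | step {A B C D : Fm 𝒜} (Φ : Der A B) (r : Rule B C) (Ψ : Der C D) : Der A D

namespace Der

/-- All rule instances belong to `BV`. -/
def IsBV : {A B : Fm 𝒜} → Der A B → Prop
  | _, _, .id _ => True
  | _, _, .hor _ Φ Ψ => Φ.IsBV ∧ Ψ.IsBV
  | _, _, .step Φ r Ψ => Φ.IsBV ∧ r.IsBV ∧ Ψ.IsBV

/-- Vertical composition: the derivation `Φ` stacked on top of `Ψ`, where the conclusion of `Φ`
is the premise of `Ψ`. -/
def comp : {A B C : Fm 𝒜} → Der A B → Der B C → Der A C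
  | _, _, _, .id _, Ψ => Ψ
  | _, _, _, .step Φ r Φ', Ψ => .step Φ r (comp Φ' Ψ)
  | _, _, _, .hor o Φ₁ Φ₂, .id _ => .hor o Φ₁ Φ₂
  | _, _, _, .hor _ Φ₁ Φ₂, .hor o Ψ₁ Ψ₂ => .hor o (comp Φ₁ Ψ₁) (comp Φ₂ Ψ₂)
  | _, _, _, .hor o Φ₁ Φ₂, .step Ψ r Ψ' => .step (comp (.hor o Φ₁ Φ₂) Ψ) r Ψ'
termination_by _ _ _ Φ Ψ => sizeOf Φ + sizeOf Ψ

/-- A single rule instance as a derivation. -/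
def rule {A B : Fm 𝒜} (r : Rule A B) : Der A B := .step (.id A) r (.id B)

/-- An equation applied from left to right. -/
def eqn {A B : Fm 𝒜} (e : Eqn A B) : Der A B := rule (.eqv e)

/-- An equation applied from right to left. -/
def eqnSymm {A B : Fm 𝒜} (e : Eqn A B) : Der B A := rule (.eqvSymm e)

/-- Identification of the terms that denote the same two-dimensional derivation: the least
congruence for which consecutive rule instances may be bracketed either way and the formula
`A ⊙ B`, as a derivation, is the formula `A` next to the formula `B`. -/
inductive Same : {A B : Fm 𝒜} → Der A B → Der A B → Prop
  | refl {A B : Fm 𝒜} (Φ : Der A B) : Same Φ Φ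
  | symm {A B : Fm 𝒜} {Φ Ψ : Der A B} : Same Φ Ψ → Same Ψ Φ
  | trans {A B : Fm 𝒜} {Φ Ψ Θ : Der A B} : Same Φ Ψ → Same Ψ Θ → Same Φ Θ
  | hor (o : Conn) {A B A' B' : Fm 𝒜} {Φ Φ' : Der A B} {Ψ Ψ' : Der A' B'} :
      Same Φ Φ' → Same Ψ Ψ' → Same (Der.hor o Φ Ψ) (Der.hor o Φ' Ψ')
  | step {A B C D : Fm 𝒜} {Φ Φ' : Der A B} (r : Rule B C) {Ψ Ψ' : Der C D} :
      Same Φ Φ' → Same Ψ Ψ' → Same (Der.step Φ r Ψ) (Der.step Φ' r Ψ')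
  | step_assoc {A B C D E F : Fm 𝒜} (Φ : Der A B) (r : Rule B C) (Ψ : Der C D) (s : Rule D E)
      (Θ : Der E F) :
      Same (Der.step (Der.step Φ r Ψ) s Θ) (Der.step Φ r (Der.step Ψ s Θ))
  | hor_id (o : Conn) (A B : Fm 𝒜) :
      Same (Der.id (Fm.bin o A B)) (Der.hor o (Der.id A) (Der.id B))

end Der

/-- Contexts: formulas with exactly one hole. -/
inductive Ctx (𝒜 : Type u) : Type u
  | hole : Ctx 𝒜
  | left (o : Conn) (C : Ctx 𝒜) (B : Fm 𝒜) : Ctx 𝒜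
  | right (o : Conn) (B : Fm 𝒜) (C : Ctx 𝒜) : Ctx 𝒜

/-- The formula `C[A]`. -/
def Ctx.fill : Ctx 𝒜 → Fm 𝒜 → Fm 𝒜
  | .hole, A => A
  | .left o C B, A => Fm.bin o (C.fill A) B
  | .right o B C, A => Fm.bin o B (C.fill A)

/-- The derivation `C[Φ]`. -/
def Ctx.plug : (C : Ctx 𝒜) → {A B : Fm 𝒜} → Der A B → Der (C.fill A) (C.fill B)
  | .hole, _, _, Φ => Φ
  | .left o C B, _, _, Φ => .hor o (C.plug Φ) (.id B)
  | .right o B C, _, _, Φ => .hor o (.id B) (C.plug Φ)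

/-! ### Atomic flows -/

/-- Literals: atoms and negated atoms. -/
inductive Lit (𝒜 : Type u) : Type u
  | pos (a : 𝒜) : Lit 𝒜
  | neg (a : 𝒜) : Lit 𝒜

/-- The dual literal. -/
def Lit.dual : Lit 𝒜 → Lit 𝒜
  | .pos a => .neg a
  | .neg a => .pos a

theorem Lit.dual_dual (l : Lit 𝒜) : l.dual.dual = l := by cases l <;> rfl

/-- A literal as a formula. -/
def Lit.fm : Lit 𝒜 → Fm 𝒜
  | .pos a => Fm.atom a
  | .neg a => Fm.natom a

/-- The string of literal occurrences of a formula. -/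
def Fm.str : Fm 𝒜 → List (Lit 𝒜)
  | .unit => []
  | .atom a => [Lit.pos a]
  | .natom a => [Lit.neg a]
  | .bin _ A B => A.str ++ B.str

/-- Diagrams representing atomic flows, built from the empty flow, identity wires, crossings,
caps and cups by vertical and horizontal composition (read from top to bottom).
The atomic flows are the diagrams modulo `FlowEq`. -/
inductive Flow : List (Lit 𝒜) → List (Lit 𝒜) → Type u
  | empty : Flow [] []
  | wire (a : Lit 𝒜) : Flow [a] [a]
  | cross (a b : Lit 𝒜) : Flow [a, b] [b, a]
  | cap (a : Lit 𝒜) : Flow [] [a, a.dual]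
  | cup (a : Lit 𝒜) : Flow [a, a.dual] []
  | vert {p q s : List (Lit 𝒜)} (φ : Flow p q) (ψ : Flow q s) : Flow p s
  | horiz {p q s t : List (Lit 𝒜)} (φ : Flow p q) (ψ : Flow s t) : Flow (p ++ s) (q ++ t)

namespace Flow

/-- Transport of a flow along equalities of its input and output strings. -/
def cast {p q p' q' : List (Lit 𝒜)} (hp : p = p') (hq : q = q') (φ : Flow p q) : Flow p' q' :=
  hp ▸ hq ▸ φ

/-- The identity flow on a string. -/
def ident : (p : List (Lit 𝒜)) → Flow p p
  | [] => .empty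
  | a :: p => .horiz (.wire a) (ident p)

/-- A wire crossing a string. -/
def crossWire (a : Lit 𝒜) : (q : List (Lit 𝒜)) → Flow (a :: q) (q ++ [a])
  | [] => .wire a
  | b :: q =>
      .vert (.horiz (p := [a, b]) (q := [b, a]) (.cross a b) (ident q))
        (.horiz (p := [b]) (q := [b]) (.wire b) (crossWire a q))

/-- A string crossing a string. -/
def crossing : (p q : List (Lit 𝒜)) → Flow (p ++ q) (q ++ p)
  | [], q => (ident q).cast rfl (List.append_nil q).symm
  | a :: p, q =>
      (Flow.vert (.horiz (p := [a]) (q := [a]) (.wire a) (crossing p q))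
        (.horiz (p := a :: q) (crossWire a q) (ident p))).cast rfl (by simp)

end Flow

/-- Equality of atomic flows: the laws that hold implicitly in two-dimensional diagrams
(associativity and units of both compositions, interchange), and the equations for crossings,
caps and cups. -/
inductive FlowEq : {p q : List (Lit 𝒜)} → Flow p q → Flow p q → Prop
  | refl {p q : List (Lit 𝒜)} (φ : Flow p q) : FlowEq φ φ
  | symm {p q : List (Lit 𝒜)} {φ ψ : Flow p q} : FlowEq φ ψ → FlowEq ψ φ
  | trans {p q : List (Lit 𝒜)} {φ ψ χ : Flow p q} : FlowEq φ ψ → FlowEq ψ χ → FlowEq φ χ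
  | vert {p q s : List (Lit 𝒜)} {φ φ' : Flow p q} {ψ ψ' : Flow q s} :
      FlowEq φ φ' → FlowEq ψ ψ' → FlowEq (φ.vert ψ) (φ'.vert ψ')
  | horiz {p q s t : List (Lit 𝒜)} {φ φ' : Flow p q} {ψ ψ' : Flow s t} :
      FlowEq φ φ' → FlowEq ψ ψ' → FlowEq (φ.horiz ψ) (φ'.horiz ψ')
  | vert_assoc {p q s t : List (Lit 𝒜)} (φ : Flow p q) (ψ : Flow q s) (χ : Flow s t) :
      FlowEq ((φ.vert ψ).vert χ) (φ.vert (ψ.vert χ))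
  | ident_vert {p q : List (Lit 𝒜)} (φ : Flow p q) : FlowEq ((Flow.ident p).vert φ) φ
  | vert_ident {p q : List (Lit 𝒜)} (φ : Flow p q) : FlowEq (φ.vert (Flow.ident q)) φ
  | horiz_assoc {p q p' q' p'' q'' : List (Lit 𝒜)} (φ : Flow p q) (ψ : Flow p' q')
      (χ : Flow p'' q'') :
      FlowEq ((φ.horiz ψ).horiz χ)
        ((φ.horiz (ψ.horiz χ)).cast (List.append_assoc p p' p'').symm
          (List.append_assoc q q' q'').symm)
  | empty_horiz {p q : List (Lit 𝒜)} (φ : Flow p q) : FlowEq (Flow.empty.horiz φ) φ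
  | horiz_empty {p q : List (Lit 𝒜)} (φ : Flow p q) :
      FlowEq (φ.horiz Flow.empty)
        (φ.cast (List.append_nil p).symm (List.append_nil q).symm)
  | interchange {p q s p' q' s' : List (Lit 𝒜)} (φ : Flow p q) (φ' : Flow q s)
      (ψ : Flow p' q') (ψ' : Flow q' s') :
      FlowEq ((φ.vert φ').horiz (ψ.vert ψ')) ((φ.horiz ψ).vert (φ'.horiz ψ'))
  | cross_cross (a b : Lit 𝒜) :
      FlowEq ((Flow.cross a b).vert (Flow.cross b a)) (Flow.ident [a, b])
  | yang_baxter (a b c : Lit 𝒜) :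
      FlowEq
        ((((Flow.cross a b).horiz (Flow.wire c)).vert
          ((Flow.wire b).horiz (Flow.cross a c))).vert
            ((Flow.cross b c).horiz (Flow.wire a)))
        ((((Flow.wire a).horiz (Flow.cross b c)).vert
          ((Flow.cross a c).horiz (Flow.wire b))).vert
            ((Flow.wire c).horiz (Flow.cross a b)))
  | cap_cross (a : Lit 𝒜) :
      FlowEq ((Flow.cap a).vert (Flow.cross a a.dual))
        ((Flow.cap a.dual).cast rfl (by rw [Lit.dual_dual]))
  | cap_slide (a b : Lit 𝒜) :
      FlowEq
        (((Flow.cap a).horiz (Flow.wire b)).vert ((Flow.wire a).horiz (Flow.cross a.dual b)))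
        (((Flow.wire b).horiz (Flow.cap a)).vert ((Flow.cross b a).horiz (Flow.wire a.dual)))
  | cross_cup (a : Lit 𝒜) :
      FlowEq ((Flow.cross a.dual a).vert (Flow.cup a))
        ((Flow.cup a.dual).cast (by rw [Lit.dual_dual]) rfl)
  | cup_slide (a b : Lit 𝒜) :
      FlowEq
        (((Flow.wire a).horiz (Flow.cross b a.dual)).vert ((Flow.cup a).horiz (Flow.wire b)))
        (((Flow.cross a b).horiz (Flow.wire a.dual)).vert ((Flow.wire b).horiz (Flow.cup a)))

/-- The atomic flow of a generating equation. -/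
def Eqn.flow : {A B : Fm 𝒜} → Eqn A B → Flow A.str B.str
  | _, _, .tensAssoc A B C =>
      (Flow.ident ((A.str ++ B.str) ++ C.str)).cast rfl (List.append_assoc _ _ _)
  | _, _, .tensComm A B => Flow.crossing A.str B.str
  | _, _, .tensUnit A => (Flow.ident A.str).cast (List.append_nil _).symm rfl
  | _, _, .parAssoc A B C =>
      (Flow.ident ((A.str ++ B.str) ++ C.str)).cast rfl (List.append_assoc _ _ _)
  | _, _, .parComm A B => Flow.crossing A.str B.str
  | _, _, .parUnit A => (Flow.ident A.str).cast (List.append_nil _).symm rfl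
  | _, _, .seqAssoc A B C =>
      (Flow.ident ((A.str ++ B.str) ++ C.str)).cast rfl (List.append_assoc _ _ _)
  | _, _, .seqUnitRight A => (Flow.ident A.str).cast (List.append_nil _).symm rfl
  | _, _, .seqUnitLeft A => Flow.ident A.str

/-- The atomic flow of a generating equation used from right to left. -/
def Eqn.flowSymm : {A B : Fm 𝒜} → Eqn A B → Flow B.str A.str
  | _, _, .tensAssoc A B C =>
      (Flow.ident ((A.str ++ B.str) ++ C.str)).cast (List.append_assoc _ _ _) rfl
  | _, _, .tensComm A B => Flow.crossing B.str A.str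
  | _, _, .tensUnit A => (Flow.ident A.str).cast rfl (List.append_nil _).symm
  | _, _, .parAssoc A B C =>
      (Flow.ident ((A.str ++ B.str) ++ C.str)).cast (List.append_assoc _ _ _) rfl
  | _, _, .parComm A B => Flow.crossing B.str A.str
  | _, _, .parUnit A => (Flow.ident A.str).cast rfl (List.append_nil _).symm
  | _, _, .seqAssoc A B C =>
      (Flow.ident ((A.str ++ B.str) ++ C.str)).cast (List.append_assoc _ _ _) rfl
  | _, _, .seqUnitRight A => (Flow.ident A.str).cast rfl (List.append_nil _).symm
  | _, _, .seqUnitLeft A => Flow.ident A.str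

/-- Four strings of wires, the middle two crossing. -/
def Flow.middle (p q s t : List (Lit 𝒜)) :
    Flow ((p ++ q) ++ (s ++ t)) ((p ++ s) ++ (q ++ t)) :=
  ((Flow.ident p).horiz ((Flow.crossing q s).horiz (Flow.ident t))).cast (by simp) (by simp)

/-- The atomic flow of a rule instance. -/
def Rule.flow : {A B : Fm 𝒜} → Rule A B → Flow A.str B.str
  | _, _, .eqv e => e.flow
  | _, _, .eqvSymm e => e.flowSymm
  | _, _, .aiDown a => Flow.cap (Lit.pos a)
  | _, _, .aiUp a => Flow.cup (Lit.pos a)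
  | _, _, .switch A B C =>
      (Flow.ident (A.str ++ (B.str ++ C.str))).cast rfl (List.append_assoc _ _ _).symm
  | _, _, .qDown A B C D => Flow.middle A.str B.str C.str D.str
  | _, _, .qUp A B C D => Flow.middle A.str B.str C.str D.str

/-- The atomic flow of a derivation. -/
def Der.flow : {A B : Fm 𝒜} → Der A B → Flow A.str B.str
  | _, _, .id A => Flow.ident A.str
  | _, _, .hor _ Φ Ψ => Φ.flow.horiz Ψ.flow
  | _, _, .step Φ r Ψ => (Φ.flow.vert r.flow).vert Ψ.flow

/-! ### Cut elimination through splitting and context reduction -/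

/-- The derivation from `(A ⅋ K) ⊗ (B ⅋ L)` to `(A ⊗ B) ⅋ (K ⅋ L)` by switches and
equations. -/
def Der.switches (A K B L : Fm 𝒜) : Der ((A ⅋ K) ⊠ (B ⅋ L)) ((A ⊠ B) ⅋ (K ⅋ L)) :=
  (Der.rule (.switch (A ⅋ K) B L)).comp <|
  (Der.hor .par
    ((Der.eqn (.tensComm (A ⅋ K) B)).comp <|
      (Der.rule (.switch B A K)).comp <|
      Der.hor .par (Der.eqn (.tensComm B A)) (Der.id K))
    (Der.id L)).comp <|
  Der.eqn (.parAssoc (A ⊠ B) K L)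

/-- From proofs of `A ⅋ K` and `B ⅋ L`, the proof of `(A ⊗ B) ⅋ (K ⅋ L)`. -/
def Der.tensProof {A K B L : Fm 𝒜} (Φ : Der Fm.unit (A ⅋ K)) (Ψ : Der Fm.unit (B ⅋ L)) :
    Der Fm.unit ((A ⊠ B) ⅋ (K ⅋ L)) :=
  (Der.eqnSymm (.tensUnit Fm.unit)).comp <| (Der.hor .tens Φ Ψ).comp <| Der.switches A K B L

/-- From proofs of `A ⅋ K` and `B ⅋ L`, the proof of `(A ◃ B) ⅋ (K ◃ L)`. -/
def Der.seqProof {A K B L : Fm 𝒜} (Φ : Der Fm.unit (A ⅋ K)) (Ψ : Der Fm.unit (B ⅋ L)) :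
    Der Fm.unit ((A ◃ B) ⅋ (K ◃ L)) :=
  (Der.eqnSymm (.seqUnitRight Fm.unit)).comp <|
    (Der.hor .seq Φ Ψ).comp <| Der.rule (.qDown A K B L)

/-- The proof of `l ⅋ l̄` for a literal `l`. -/
def Der.axiomProof : (l : Lit 𝒜) → Der Fm.unit (l.fm ⅋ l.dual.fm)
  | .pos a => Der.rule (.aiDown a)
  | .neg a => (Der.rule (.aiDown a)).comp (Der.eqn (.parComm (Fm.atom a) (Fm.natom a)))

/-- A splitting in `BV` of a proof `Φ` of `(A ⊗ B) ⅋ K`: proofs of `A ⅋ KA` and `B ⅋ KB` and a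
derivation from `KA ⅋ KB` to `K` which, put together, have the atomic flow of `Φ`. -/
structure TensSplitting {A B K : Fm 𝒜} (Φ : Der Fm.unit ((A ⊠ B) ⅋ K)) where
  KA : Fm 𝒜
  KB : Fm 𝒜
  ofK : Der (KA ⅋ KB) K
  ofA : Der Fm.unit (A ⅋ KA)
  ofB : Der Fm.unit (B ⅋ KB)
  isBV_ofK : ofK.IsBV
  isBV_ofA : ofA.IsBV
  isBV_ofB : ofB.IsBV
  flow_eq : FlowEq ((Der.tensProof ofA ofB).comp (Der.hor .par (Der.id (A ⊠ B)) ofK)).flow Φ.flow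

/-- A splitting in `BV` of a proof `Φ` of `(A ◃ B) ⅋ K`: proofs of `A ⅋ KA` and `B ⅋ KB` and a
derivation from `KA ◃ KB` to `K` which, put together, have the atomic flow of `Φ`. -/
structure SeqSplitting {A B K : Fm 𝒜} (Φ : Der Fm.unit ((A ◃ B) ⅋ K)) where
  KA : Fm 𝒜
  KB : Fm 𝒜
  ofK : Der (KA ◃ KB) K
  ofA : Der Fm.unit (A ⅋ KA)
  ofB : Der Fm.unit (B ⅋ KB)
  isBV_ofK : ofK.IsBV
  isBV_ofA : ofA.IsBV
  isBV_ofB : ofB.IsBV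
  flow_eq : FlowEq ((Der.seqProof ofA ofB).comp (Der.hor .par (Der.id (A ◃ B)) ofK)).flow Φ.flow

/-- A splitting in `BV` of a proof `Φ` of `l ⅋ K`, for a literal `l`: a derivation from the dual
literal to `K` which, put under the proof of `l ⅋ l̄`, has the atomic flow of `Φ`. -/
structure LitSplitting {l : Lit 𝒜} {K : Fm 𝒜} (Φ : Der Fm.unit (l.fm ⅋ K)) where
  ofK : Der l.dual.fm K
  isBV_ofK : ofK.IsBV
  flow_eq : FlowEq ((Der.axiomProof l).comp (Der.hor .par (Der.id l.fm) ofK)).flow Φ.flow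

/-- Context reduction by recursion on the context.  `CtxReduction C Φ K Φ₀ Θ` says that the
proof `Φ` of `C[A] ⅋ P` is reduced, by repeated splitting, to the proof `Φ₀` of `A ⅋ K` and the
derivations `Θ X` from `X ⅋ K` to `C[X] ⅋ P`, one for every formula `X`. -/
inductive CtxReduction {A : Fm 𝒜} : (C : Ctx 𝒜) → {P : Fm 𝒜} →
    Der Fm.unit (C.fill A ⅋ P) → (K : Fm 𝒜) → Der Fm.unit (A ⅋ K) →
    (∀ X : Fm 𝒜, Der (X ⅋ K) (C.fill X ⅋ P)) → Prop
  | hole {P : Fm 𝒜} (Φ : Der Fm.unit (A ⅋ P)) :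
      CtxReduction Ctx.hole Φ P Φ (fun X => Der.id (X ⅋ P))
  | parLeft {C : Ctx 𝒜} {B P : Fm 𝒜} (Φ : Der Fm.unit ((C.fill A ⅋ B) ⅋ P))
      {K : Fm 𝒜} {Φ₀ : Der Fm.unit (A ⅋ K)}
      {Θ : ∀ X : Fm 𝒜, Der (X ⅋ K) (C.fill X ⅋ (B ⅋ P))} :
      CtxReduction C (Φ.comp (Der.eqn (.parAssoc (C.fill A) B P))) K Φ₀ Θ →
      CtxReduction (Ctx.left .par C B) Φ K Φ₀
        (fun X => (Θ X).comp (Der.eqnSymm (.parAssoc (C.fill X) B P)))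
  | parRight {C : Ctx 𝒜} {B P : Fm 𝒜} (Φ : Der Fm.unit ((B ⅋ C.fill A) ⅋ P))
      {K : Fm 𝒜} {Φ₀ : Der Fm.unit (A ⅋ K)}
      {Θ : ∀ X : Fm 𝒜, Der (X ⅋ K) (C.fill X ⅋ (B ⅋ P))} :
      CtxReduction C
        (Φ.comp <| (Der.hor .par (Der.eqn (.parComm B (C.fill A))) (Der.id P)).comp <|
          Der.eqn (.parAssoc (C.fill A) B P)) K Φ₀ Θ →
      CtxReduction (Ctx.right .par B C) Φ K Φ₀
        (fun X => (Θ X).comp <| (Der.eqnSymm (.parAssoc (C.fill X) B P)).comp <|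
          Der.hor .par (Der.eqn (.parComm (C.fill X) B)) (Der.id P))
  | tensLeft {C : Ctx 𝒜} {B P : Fm 𝒜} (Φ : Der Fm.unit ((C.fill A ⊠ B) ⅋ P))
      (S : TensSplitting Φ) {K : Fm 𝒜} {Φ₀ : Der Fm.unit (A ⅋ K)}
      {Θ : ∀ X : Fm 𝒜, Der (X ⅋ K) (C.fill X ⅋ S.KA)} :
      CtxReduction C S.ofA K Φ₀ Θ →
      CtxReduction (Ctx.left .tens C B) Φ K Φ₀
        (fun X => (Θ X).comp <| (Der.eqnSymm (.tensUnit (C.fill X ⅋ S.KA))).comp <|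
          (Der.hor .tens (Der.id (C.fill X ⅋ S.KA)) S.ofB).comp <|
          (Der.switches (C.fill X) S.KA B S.KB).comp <|
          Der.hor .par (Der.id (C.fill X ⊠ B)) S.ofK)
  | tensRight {C : Ctx 𝒜} {B P : Fm 𝒜} (Φ : Der Fm.unit ((B ⊠ C.fill A) ⅋ P))
      (S : TensSplitting Φ) {K : Fm 𝒜} {Φ₀ : Der Fm.unit (A ⅋ K)}
      {Θ : ∀ X : Fm 𝒜, Der (X ⅋ K) (C.fill X ⅋ S.KB)} :
      CtxReduction C S.ofB K Φ₀ Θ →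
      CtxReduction (Ctx.right .tens B C) Φ K Φ₀
        (fun X => (Θ X).comp <| (Der.eqnSymm (.tensUnit (C.fill X ⅋ S.KB))).comp <|
          (Der.eqn (.tensComm (C.fill X ⅋ S.KB) Fm.unit)).comp <|
          (Der.hor .tens S.ofA (Der.id (C.fill X ⅋ S.KB))).comp <|
          (Der.switches B S.KA (C.fill X) S.KB).comp <|
          Der.hor .par (Der.id (B ⊠ C.fill X)) S.ofK)
  | seqLeft {C : Ctx 𝒜} {B P : Fm 𝒜} (Φ : Der Fm.unit ((C.fill A ◃ B) ⅋ P))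
      (S : SeqSplitting Φ) {K : Fm 𝒜} {Φ₀ : Der Fm.unit (A ⅋ K)}
      {Θ : ∀ X : Fm 𝒜, Der (X ⅋ K) (C.fill X ⅋ S.KA)} :
      CtxReduction C S.ofA K Φ₀ Θ →
      CtxReduction (Ctx.left .seq C B) Φ K Φ₀
        (fun X => (Θ X).comp <| (Der.eqnSymm (.seqUnitRight (C.fill X ⅋ S.KA))).comp <|
          (Der.hor .seq (Der.id (C.fill X ⅋ S.KA)) S.ofB).comp <|
          (Der.rule (.qDown (C.fill X) S.KA B S.KB)).comp <|
          Der.hor .par (Der.id (C.fill X ◃ B)) S.ofK)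
  | seqRight {C : Ctx 𝒜} {B P : Fm 𝒜} (Φ : Der Fm.unit ((B ◃ C.fill A) ⅋ P))
      (S : SeqSplitting Φ) {K : Fm 𝒜} {Φ₀ : Der Fm.unit (A ⅋ K)}
      {Θ : ∀ X : Fm 𝒜, Der (X ⅋ K) (C.fill X ⅋ S.KB)} :
      CtxReduction C S.ofB K Φ₀ Θ →
      CtxReduction (Ctx.right .seq B C) Φ K Φ₀
        (fun X => (Θ X).comp <| (Der.eqnSymm (.seqUnitLeft (C.fill X ⅋ S.KB))).comp <|
          (Der.hor .seq S.ofA (Der.id (C.fill X ⅋ S.KB))).comp <|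
          (Der.rule (.qDown B S.KA (C.fill X) S.KB)).comp <|
          Der.hor .par (Der.id (B ◃ C.fill X)) S.ofK)

/-- Context reduction for a proof of `C[A]`: it is the case `P = unit` of `CtxReduction`, up to
the equation `C[A] ⅋ unit = C[A]`. -/
inductive CtxReductionOf {A : Fm 𝒜} (C : Ctx 𝒜) (Φ : Der Fm.unit (C.fill A)) :
    (K : Fm 𝒜) → Der Fm.unit (A ⅋ K) → (∀ X : Fm 𝒜, Der (X ⅋ K) (C.fill X)) → Prop
  | mk {K : Fm 𝒜} {Φ₀ : Der Fm.unit (A ⅋ K)}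
      {Θ : ∀ X : Fm 𝒜, Der (X ⅋ K) (C.fill X ⅋ Fm.unit)} :
      CtxReduction C (Φ.comp (Der.eqnSymm (.parUnit (C.fill A)))) K Φ₀ Θ →
      CtxReductionOf C Φ K Φ₀ (fun X => (Θ X).comp (Der.eqn (.parUnit (C.fill X))))

/-- The proof that replaces a proof in `BV` followed by `q↑` with premise
`(A ◃ B) ⊗ (C ◃ D)`, assembled from the splittings. -/
def qUpReduct {A B C D K : Fm 𝒜} {Φ₀ : Der Fm.unit (((A ◃ B) ⊠ (C ◃ D)) ⅋ K)}
    (S : TensSplitting Φ₀) (L : SeqSplitting S.ofA) (R : SeqSplitting S.ofB) :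
    Der Fm.unit (((A ⊠ C) ◃ (B ⊠ D)) ⅋ K) :=
  (Der.seqProof (Der.tensProof L.ofA R.ofA) (Der.tensProof L.ofB R.ofB)).comp <|
  Der.hor .par (Der.id ((A ⊠ C) ◃ (B ⊠ D))) <|
    (Der.rule (.qDown L.KA R.KA L.KB R.KB)).comp <| (Der.hor .par L.ofK R.ofK).comp S.ofK

/-- The proof that replaces a proof in `BV` followed by `ai↑` with premise `a ⊗ ā`, assembled
from the splittings. -/
def aiUpReduct {a : 𝒜} {K : Fm 𝒜} {Φ₀ : Der Fm.unit ((Fm.atom a ⊠ Fm.natom a) ⅋ K)}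
    (S : TensSplitting Φ₀) (L : LitSplitting (l := Lit.pos a) S.ofA)
    (R : LitSplitting (l := Lit.neg a) S.ofB) : Der Fm.unit (Fm.unit ⅋ K) :=
  (Der.axiomProof (Lit.neg a)).comp <| (Der.hor .par L.ofK R.ofK).comp <| S.ofK.comp <|
  (Der.eqnSymm (.parUnit K)).comp <| Der.eqn (.parComm K Fm.unit)

/-- Elimination of one topmost up-rule instance: everything above it is in `BV`. -/
inductive CEStep {F : Fm 𝒜} : Der Fm.unit F → Der Fm.unit F → Prop
  | qUp {A B C D K : Fm 𝒜} (X : Ctx 𝒜) {Φ Φ₁ : Der Fm.unit F}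
      (Φ' : Der Fm.unit (X.fill ((A ◃ B) ⊠ (C ◃ D))))
      (Ψ : Der (X.fill ((A ⊠ C) ◃ (B ⊠ D))) F)
      {Φ₀ : Der Fm.unit (((A ◃ B) ⊠ (C ◃ D)) ⅋ K)} {Θ : ∀ Y : Fm 𝒜, Der (Y ⅋ K) (X.fill Y)}
      (S : TensSplitting Φ₀) (L : SeqSplitting S.ofA) (R : SeqSplitting S.ofB) :
      Φ'.IsBV →
      CtxReductionOf X Φ' K Φ₀ Θ →
      Der.Same Φ (Φ'.comp <| (X.plug (Der.rule (.qUp A B C D))).comp Ψ) →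
      Der.Same Φ₁ ((qUpReduct S L R).comp <| (Θ ((A ⊠ C) ◃ (B ⊠ D))).comp Ψ) →
      CEStep Φ Φ₁
  | aiUp {a : 𝒜} {K : Fm 𝒜} (X : Ctx 𝒜) {Φ Φ₁ : Der Fm.unit F}
      (Φ' : Der Fm.unit (X.fill (Fm.atom a ⊠ Fm.natom a)))
      (Ψ : Der (X.fill Fm.unit) F)
      {Φ₀ : Der Fm.unit ((Fm.atom a ⊠ Fm.natom a) ⅋ K)} {Θ : ∀ Y : Fm 𝒜, Der (Y ⅋ K) (X.fill Y)}
      (S : TensSplitting Φ₀) (L : LitSplitting (l := Lit.pos a) S.ofA)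
      (R : LitSplitting (l := Lit.neg a) S.ofB) :
      Φ'.IsBV →
      CtxReductionOf X Φ' K Φ₀ Θ →
      Der.Same Φ (Φ'.comp <| (X.plug (Der.rule (.aiUp a))).comp Ψ) →
      Der.Same Φ₁ ((aiUpReduct S L R).comp <| (Θ Fm.unit).comp Ψ) →
      CEStep Φ Φ₁

/-- `CE Φ Φ'`: the `BV` proof `Φ'` results from the `SBV` proof `Φ` by successively eliminating
all instances of the up-rules. -/
def CE {F : Fm 𝒜} (Φ Φ' : Der Fm.unit F) : Prop :=
  Relation.ReflTransGen CEStep Φ Φ' ∧ Φ'.IsBV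

/-! ### Strong BV-categories -/

/-- An isomix `*`-autonomous category, the monoidal unit serving as the dualizing object: a
symmetric monoidal category in which every object `A` has a dual `A ⊸ I` with evaluation `ev A`
and currying, such that the canonical map from `A` to its double dual is an isomorphism. -/
class StarAutonomous (C : Type u₁) [Category.{v₁} C] [MonoidalCategory C]
    [SymmetricCategory C] where
  dual : C → C
  ev (A : C) : dual A ⊗ A ⟶ 𝟙_ C
  curry {X A : C} (f : X ⊗ A ⟶ 𝟙_ C) : X ⟶ dual A
  curry_ev {X A : C} (f : X ⊗ A ⟶ 𝟙_ C) : curry f ▷ A ≫ ev A = f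
  curry_unique {X A : C} (g : X ⟶ dual A) : curry (g ▷ A ≫ ev A) = g
  isIso_doubleDual (A : C) : IsIso (curry ((β_ A (dual A)).hom ≫ ev A))

namespace StarAutonomous

section

variable {C : Type u₁} [Category.{v₁} C] [MonoidalCategory C] [SymmetricCategory C]
  [StarAutonomous C]

/-- The dual of a morphism. -/
def dualMap {A B : C} (f : A ⟶ B) : dual B ⟶ dual A := curry (dual B ◁ f ≫ ev B)

/-- The canonical isomorphism from `A` to its double dual. -/
def doubleDual (A : C) : A ⟶ dual (dual A) := curry ((β_ A (dual A)).hom ≫ ev A)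

instance (A : C) : IsIso (doubleDual A) := isIso_doubleDual A

/-- The inverse of the canonical isomorphism from `A` to its double dual. -/
noncomputable def doubleDualInv (A : C) : dual (dual A) ⟶ A := inv (doubleDual A)

/-- The par of two objects. -/
def par (A B : C) : C := dual (dual A ⊗ dual B)

/-- The par of two morphisms. -/
def parMap {A A' B B' : C} (f : A ⟶ A') (g : B ⟶ B') : par A B ⟶ par A' B' :=
  dualMap (dualMap f ⊗ₘ dualMap g)

/-- The internal hom. -/
def lolly (A B : C) : C := dual (A ⊗ dual B)

/-- Currying for the internal hom. -/
def lam {X A B : C} (f : X ⊗ A ⟶ B) : X ⟶ lolly A B :=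
  curry ((α_ X A (dual B)).inv ≫ f ▷ dual B ≫ (β_ B (dual B)).hom ≫ ev B)

/-- Evaluation for the internal hom. -/
noncomputable def app (A B : C) : lolly A B ⊗ A ⟶ B :=
  curry ((α_ (lolly A B) A (dual B)).hom ≫ ev (A ⊗ dual B)) ≫ doubleDualInv B

/-- The canonical isomorphism from the unit to its dual. -/
def unitToDual : 𝟙_ C ⟶ dual (𝟙_ C) := curry (λ_ (𝟙_ C)).hom

/-- The canonical isomorphism from the dual of the unit to the unit. -/
def dualToUnit : dual (𝟙_ C) ⟶ 𝟙_ C := (ρ_ (dual (𝟙_ C))).inv ≫ ev (𝟙_ C)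

/-- Associativity of par. -/
noncomputable def parAssoc (A B D : C) : par (par A B) D ⟶ par A (par B D) :=
  dualMap (dual A ◁ (doubleDualInv (dual B ⊗ dual D)) ≫ (α_ (dual A) (dual B) (dual D)).inv ≫
    doubleDual (dual A ⊗ dual B) ▷ dual D)

/-- Associativity of par, inverse direction. -/
noncomputable def parAssocInv (A B D : C) : par A (par B D) ⟶ par (par A B) D :=
  dualMap ((doubleDualInv (dual A ⊗ dual B)) ▷ dual D ≫ (α_ (dual A) (dual B) (dual D)).hom ≫
    dual A ◁ doubleDual (dual B ⊗ dual D))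

/-- Commutativity of par. -/
def parComm (A B : C) : par A B ⟶ par B A := dualMap (β_ (dual B) (dual A)).hom

/-- The unit is neutral for par. -/
noncomputable def parUnit (A : C) : par A (𝟙_ C) ⟶ A :=
  dualMap ((ρ_ (dual A)).inv ≫ dual A ◁ unitToDual) ≫ (doubleDualInv A)

/-- The unit is neutral for par, inverse direction. -/
def parUnitInv (A : C) : A ⟶ par A (𝟙_ C) :=
  doubleDual A ≫ dualMap (dual A ◁ dualToUnit ≫ (ρ_ (dual A)).hom)

/-- The switch morphism: the exchange
`(A ⊗ (B ⅋ D)) ⊗ (A ⊗ B)⊥ ≅ (B⊥ ⊸ D) ⊗ ((A ⊸ B⊥) ⊗ A)`, followed by two evaluations, curried. -/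
noncomputable def switch (A B D : C) : A ⊗ par B D ⟶ par (A ⊗ B) D :=
  lam (X := A ⊗ par B D) (A := dual (A ⊗ B)) (B := D)
    ((β_ A (par B D)).hom ▷ dual (A ⊗ B) ≫ (α_ (par B D) A (dual (A ⊗ B))).hom ≫
      par B D ◁ ((β_ A (dual (A ⊗ B))).hom ≫ dualMap (A ◁ (doubleDualInv B)) ▷ A) ≫
      par B D ◁ app A (dual B) ≫ app (dual B) D)

end

end StarAutonomous

/-- A second monoidal structure `◃` (not necessarily symmetric) with the same unit. -/
structure SeqMonoidal (C : Type u₁) [Category.{v₁} C] [MonoidalCategory C] where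
  seq : C → C → C
  seqMap {A A' B B' : C} (f : A ⟶ A') (g : B ⟶ B') : seq A B ⟶ seq A' B'
  seqMap_id (A B : C) : seqMap (𝟙 A) (𝟙 B) = 𝟙 (seq A B)
  seqMap_comp {A A' A'' B B' B'' : C} (f : A ⟶ A') (f' : A' ⟶ A'') (g : B ⟶ B')
    (g' : B' ⟶ B'') : seqMap (f ≫ f') (g ≫ g') = seqMap f g ≫ seqMap f' g'
  seqAssoc (A B D : C) : seq (seq A B) D ≅ seq A (seq B D)
  seqLeftUnit (A : C) : seq (𝟙_ C) A ≅ A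
  seqRightUnit (A : C) : seq A (𝟙_ C) ≅ A
  seqAssoc_natural {A A' B B' D D' : C} (f : A ⟶ A') (g : B ⟶ B') (h : D ⟶ D') :
    seqMap (seqMap f g) h ≫ (seqAssoc A' B' D').hom =
      (seqAssoc A B D).hom ≫ seqMap f (seqMap g h)
  seqLeftUnit_natural {A A' : C} (f : A ⟶ A') :
    seqMap (𝟙 (𝟙_ C)) f ≫ (seqLeftUnit A').hom = (seqLeftUnit A).hom ≫ f
  seqRightUnit_natural {A A' : C} (f : A ⟶ A') :
    seqMap f (𝟙 (𝟙_ C)) ≫ (seqRightUnit A').hom = (seqRightUnit A).hom ≫ f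
  seq_pentagon (A B D E : C) :
    seqMap (seqAssoc A B D).hom (𝟙 E) ≫ (seqAssoc A (seq B D) E).hom ≫
        seqMap (𝟙 A) (seqAssoc B D E).hom =
      (seqAssoc (seq A B) D E).hom ≫ (seqAssoc A B (seq D E)).hom
  seq_triangle (A B : C) :
    (seqAssoc A (𝟙_ C) B).hom ≫ seqMap (𝟙 A) (seqLeftUnit B).hom =
      seqMap (seqRightUnit A).hom (𝟙 B)

/-- A compact closed category (symmetric, and every object `A` has a dual `ᘁA` with unit
`η_ (ᘁA) A : J ⟶ ᘁA ⊗ A` and counit `ε_ (ᘁA) A : A ⊗ ᘁA ⟶ J`) is strict if its monoidal structure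
is strict and the canonical isomorphisms from `ᘁA ⊗ ᘁB` to `ᘁ(A ⊗ B)` and from `A` to `ᘁᘁA` are
identities.  These two isomorphisms are characterized by their compatibility with the counits. -/
class StrictCompactClosed (D : Type u₂) [Category.{v₂} D] [MonoidalCategory D]
    [SymmetricCategory D] [LeftRigidCategory D] : Prop where
  tensor_assoc (A B E : D) : (A ⊗ B) ⊗ E = A ⊗ (B ⊗ E)
  unit_tensor (A : D) : 𝟙_ D ⊗ A = A
  tensor_unit (A : D) : A ⊗ 𝟙_ D = A
  associator_eq (A B E : D) : (α_ A B E).hom = eqToHom (tensor_assoc A B E)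
  leftUnitor_eq (A : D) : (λ_ A).hom = eqToHom (unit_tensor A)
  rightUnitor_eq (A : D) : (ρ_ A).hom = eqToHom (tensor_unit A)
  dual_tensor (A B : D) : (ᘁ(A ⊗ B) : D) = (ᘁA) ⊗ (ᘁB)
  dual_dual (A : D) : (ᘁ(ᘁA) : D) = A
  deMorgan_eq (A B : D) :
    (A ⊗ B) ◁ eqToHom (dual_tensor A B).symm ≫ ε_ (ᘁ(A ⊗ B)) (A ⊗ B) =
      tensorμ A B (ᘁA) (ᘁB) ≫ (ε_ (ᘁA) A ⊗ₘ ε_ (ᘁB) B) ≫ (λ_ (𝟙_ D)).hom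
  doubleDual_eq (A : D) :
    (ᘁA) ◁ eqToHom (dual_dual A).symm ≫ ε_ (ᘁ(ᘁA)) (ᘁA) = (β_ (ᘁA) A).hom ≫ ε_ (ᘁA) A

open StarAutonomous

/-- A faithful strict `*`-autonomous functor into a strict compact closed category: a faithful
functor that preserves the symmetric monoidal structure, duals and evaluations up to equality. -/
structure StrictStarFunctor (C : Type u₁) [Category.{v₁} C] [MonoidalCategory C]
    [SymmetricCategory C] [StarAutonomous C] (D : Type u₂) [Category.{v₂} D]
    [MonoidalCategory D] [SymmetricCategory D] [LeftRigidCategory D]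
    extends C ⥤ D where
  faithful : toFunctor.Faithful
  obj_unit : obj (𝟙_ C) = 𝟙_ D
  obj_tensor (A B : C) : obj (A ⊗ B) = obj A ⊗ obj B
  map_tensor {A A' B B' : C} (f : A ⟶ A') (g : B ⟶ B') :
    map (f ⊗ₘ g) = eqToHom (obj_tensor A B) ≫ (map f ⊗ₘ map g) ≫
      eqToHom (obj_tensor A' B').symm
  map_associator (A B E : C) :
    map (α_ A B E).hom =
      eqToHom (by rw [obj_tensor, obj_tensor]) ≫ (α_ (obj A) (obj B) (obj E)).hom ≫
        eqToHom (by rw [obj_tensor, obj_tensor])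
  map_leftUnitor (A : C) :
    map (λ_ A).hom = eqToHom (by rw [obj_tensor, obj_unit]) ≫ (λ_ (obj A)).hom
  map_rightUnitor (A : C) :
    map (ρ_ A).hom = eqToHom (by rw [obj_tensor, obj_unit]) ≫ (ρ_ (obj A)).hom
  map_braiding (A B : C) :
    map (β_ A B).hom = eqToHom (obj_tensor A B) ≫ (β_ (obj A) (obj B)).hom ≫
      eqToHom (obj_tensor B A).symm
  obj_dual (A : C) : obj (dual A) = ᘁ(obj A)
  map_ev (A : C) :
    map (ev A) = eqToHom (by rw [obj_tensor, obj_dual]) ≫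
      (β_ (ᘁ(obj A)) (obj A)).hom ≫ ε_ (ᘁ(obj A)) (obj A) ≫ eqToHom obj_unit.symm

theorem StrictStarFunctor.obj_par {C : Type u₁} [Category.{v₁} C] [MonoidalCategory C]
    [SymmetricCategory C] [StarAutonomous C] {D : Type u₂} [Category.{v₂} D]
    [MonoidalCategory D] [SymmetricCategory D] [LeftRigidCategory D] [StrictCompactClosed D]
    (U : StrictStarFunctor C D) (A B : C) : U.obj (par A B) = U.obj A ⊗ U.obj B := by
  rw [par, U.obj_dual, U.obj_tensor, U.obj_dual, U.obj_dual, StrictCompactClosed.dual_tensor,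
    StrictCompactClosed.dual_dual, StrictCompactClosed.dual_dual]

/-- The structure of a strong BV-category on the isomix `*`-autonomous category `C`, with
coherence functor `U` into the strict compact closed category `D`. -/
structure StrongBVCategory (C : Type u₁) [Category.{v₁} C] [MonoidalCategory C]
    [SymmetricCategory C] [StarAutonomous C] (D : Type u₂) [Category.{v₂} D]
    [MonoidalCategory D] [SymmetricCategory D] [LeftRigidCategory D] [StrictCompactClosed D]
    extends SeqMonoidal C where
  /-- self-duality of `◃` -/
  κ (A B : C) : seq (dual A) (dual B) ≅ dual (seq A B)
  κ_natural {A A' B B' : C} (f : A ⟶ A') (g : B ⟶ B') :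
    seqMap (dualMap f) (dualMap g) ≫ (κ A B).hom = (κ A' B').hom ≫ dualMap (seqMap f g)
  /-- interchange of `◃` and par -/
  q (A B E F : C) : seq (par A B) (par E F) ⟶ par (seq A E) (seq B F)
  q_natural {A A' B B' E E' F F' : C} (f : A ⟶ A') (g : B ⟶ B') (h : E ⟶ E') (k : F ⟶ F') :
    seqMap (parMap f g) (parMap h k) ≫ q A' B' E' F' =
      q A B E F ≫ parMap (seqMap f h) (seqMap g k)
  /-- the coherence functor -/
  U : StrictStarFunctor C D
  obj_seq (A B : C) : U.obj (seq A B) = U.obj A ⊗ U.obj B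
  map_seq {A A' B B' : C} (f : A ⟶ A') (g : B ⟶ B') :
    U.map (seqMap f g) = eqToHom (obj_seq A B) ≫ (U.map f ⊗ₘ U.map g) ≫
      eqToHom (obj_seq A' B').symm
  map_seqAssoc (A B E : C) :
    U.map (seqAssoc A B E).hom =
      eqToHom (by rw [obj_seq, obj_seq]) ≫ (α_ (U.obj A) (U.obj B) (U.obj E)).hom ≫
        eqToHom (by rw [obj_seq, obj_seq])
  map_seqLeftUnit (A : C) :
    U.map (seqLeftUnit A).hom = eqToHom (by rw [obj_seq, U.obj_unit]) ≫ (λ_ (U.obj A)).hom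
  map_seqRightUnit (A : C) :
    U.map (seqRightUnit A).hom = eqToHom (by rw [obj_seq, U.obj_unit]) ≫ (ρ_ (U.obj A)).hom
  map_κ (A B : C) :
    U.map (κ A B).hom = eqToHom (by
      rw [obj_seq, U.obj_dual, U.obj_dual, U.obj_dual, obj_seq, StrictCompactClosed.dual_tensor])
  map_q (A B E F : C) :
    U.map (q A B E F) =
      eqToHom (by rw [obj_seq, U.obj_par, U.obj_par]) ≫
      tensorμ (U.obj A) (U.obj B) (U.obj E) (U.obj F) ≫
      eqToHom (by rw [U.obj_par, obj_seq, obj_seq])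

namespace StrongBVCategory

section

variable {C : Type u₁} [Category.{v₁} C] [MonoidalCategory C] [SymmetricCategory C]
  [StarAutonomous C] {D : Type u₂} [Category.{v₂} D] [MonoidalCategory D] [SymmetricCategory D]
  [LeftRigidCategory D] [StrictCompactClosed D] (S : StrongBVCategory C D)

/-- The isomorphism from `A ◃ B` to the dual of `A⊥ ◃ B⊥`. -/
def seqToDual (A B : C) : S.seq A B ⟶ dual (S.seq (dual A) (dual B)) :=
  doubleDual (S.seq A B) ≫ dualMap (S.κ A B).hom

/-- The isomorphism from the dual of `A⊥ ⅋ B⊥` to `A ⊗ B`. -/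
noncomputable def dualParToTensor (A B : C) : dual (par (dual A) (dual B)) ⟶ A ⊗ B :=
  (doubleDualInv (dual (dual A) ⊗ dual (dual B))) ≫ ((doubleDualInv A) ⊗ₘ (doubleDualInv B))

/-- The interchange of tensor and `◃`, dual to `q`. -/
noncomputable def q' (A B E F : C) : S.seq A B ⊗ S.seq E F ⟶ S.seq (A ⊗ E) (B ⊗ F) :=
  (S.seqToDual A B ⊗ₘ S.seqToDual E F) ≫
  doubleDual (dual (S.seq (dual A) (dual B)) ⊗ dual (S.seq (dual E) (dual F))) ≫
  dualMap (S.q (dual A) (dual E) (dual B) (dual F)) ≫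
  (S.κ (par (dual A) (dual E)) (par (dual B) (dual F))).inv ≫
  S.seqMap (dualParToTensor A E) (dualParToTensor B F)

/-- The binary operation on objects that interprets a connective. -/
def conn : Conn → C → C → C
  | .par => par
  | .seq => S.seq
  | .tens => fun A B => A ⊗ B

/-- The binary operation on morphisms that interprets a connective. -/
def connMap : (o : Conn) → {A A' B B' : C} → (A ⟶ A') → (B ⟶ B') →
    (S.conn o A B ⟶ S.conn o A' B')
  | .par, _, _, _, _, f, g => parMap f g
  | .seq, _, _, _, _, f, g => S.seqMap f g
  | .tens, _, _, _, _, f, g => f ⊗ₘ g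

/-- The interpretation of a formula, the atom `a` being interpreted by the object `c a`. -/
def obj (c : 𝒜 → C) : Fm 𝒜 → C
  | .unit => 𝟙_ C
  | .atom a => c a
  | .natom a => dual (c a)
  | .bin o A B => S.conn o (obj c A) (obj c B)

/-- The interpretation of a generating equation. -/
noncomputable def eqn (c : 𝒜 → C) : {A B : Fm 𝒜} → Eqn A B → (S.obj c A ⟶ S.obj c B)
  | _, _, .tensAssoc A B E => (α_ (S.obj c A) (S.obj c B) (S.obj c E)).hom
  | _, _, .tensComm A B => (β_ (S.obj c A) (S.obj c B)).hom
  | _, _, .tensUnit A => (ρ_ (S.obj c A)).hom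
  | _, _, .parAssoc A B E => parAssoc (S.obj c A) (S.obj c B) (S.obj c E)
  | _, _, .parComm A B => parComm (S.obj c A) (S.obj c B)
  | _, _, .parUnit A => parUnit (S.obj c A)
  | _, _, .seqAssoc A B E => (S.seqAssoc (S.obj c A) (S.obj c B) (S.obj c E)).hom
  | _, _, .seqUnitRight A => (S.seqRightUnit (S.obj c A)).hom
  | _, _, .seqUnitLeft A => (S.seqLeftUnit (S.obj c A)).hom

/-- The interpretation of a generating equation used from right to left. -/
noncomputable def eqnSymm (c : 𝒜 → C) : {A B : Fm 𝒜} → Eqn A B → (S.obj c B ⟶ S.obj c A)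
  | _, _, .tensAssoc A B E => (α_ (S.obj c A) (S.obj c B) (S.obj c E)).inv
  | _, _, .tensComm A B => (β_ (S.obj c B) (S.obj c A)).hom
  | _, _, .tensUnit A => (ρ_ (S.obj c A)).inv
  | _, _, .parAssoc A B E => parAssocInv (S.obj c A) (S.obj c B) (S.obj c E)
  | _, _, .parComm A B => parComm (S.obj c B) (S.obj c A)
  | _, _, .parUnit A => parUnitInv (S.obj c A)
  | _, _, .seqAssoc A B E => (S.seqAssoc (S.obj c A) (S.obj c B) (S.obj c E)).inv
  | _, _, .seqUnitRight A => (S.seqRightUnit (S.obj c A)).inv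
  | _, _, .seqUnitLeft A => (S.seqLeftUnit (S.obj c A)).inv

/-- The interpretation of a rule instance. -/
noncomputable def rule (c : 𝒜 → C) : {A B : Fm 𝒜} → Rule A B → (S.obj c A ⟶ S.obj c B)
  | _, _, .eqv e => S.eqn c e
  | _, _, .eqvSymm e => S.eqnSymm c e
  | _, _, .aiDown a =>
      curry (A := dual (c a) ⊗ dual (dual (c a)))
        ((λ_ (dual (c a) ⊗ dual (dual (c a)))).hom ≫
          (β_ (dual (c a)) (dual (dual (c a)))).hom ≫ ev (dual (c a)))
  | _, _, .aiUp a => (β_ (c a) (dual (c a))).hom ≫ ev (c a)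
  | _, _, .switch A B E => switch (S.obj c A) (S.obj c B) (S.obj c E)
  | _, _, .qDown A B E F => S.q (S.obj c A) (S.obj c B) (S.obj c E) (S.obj c F)
  | _, _, .qUp A B E F => S.q' (S.obj c A) (S.obj c B) (S.obj c E) (S.obj c F)

/-- The interpretation of a derivation. -/
noncomputable def sem (c : 𝒜 → C) : {A B : Fm 𝒜} → Der A B → (S.obj c A ⟶ S.obj c B)
  | _, _, .id A => 𝟙 (S.obj c A)
  | _, _, .hor o Φ Ψ => S.connMap o (sem c Φ) (sem c Ψ)
  | _, _, .step Φ r Ψ => sem c Φ ≫ S.rule c r ≫ sem c Ψ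

end

end StrongBVCategory

end BV

/-! The functor `U` is faithful, so it is enough to compare the two proofs in `D`. There all three
connectives become the tensor product, and every rule other than `ai↓` and `ai↑` becomes a
structural morphism of a symmetric monoidal category: `s` is an inverse associator, `q↓` and `q↑`
are the exchange `tensorμ` of the two middle factors (`map_rule`, `map_sem`). Up to coherence
isomorphisms the image of a derivation is therefore an interpretation of its atomic flow
(`flow_der`).

The equations between flows hold for arbitrary caps and cups on the positive literals
(`flow_congr`). A splitting has the flow of the proof that it splits, hence the same interpretation
in `D` (`der_eq_of_flowEq`). For context reduction two facts are needed: the derivations `Θ` are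
natural in the formula that fills the hole (`ctxReduction_natural`), and a proof factors through its
reduct and `Θ` (`ctxReduction_der`). Together they move an up-rule from the hole of the context to
the root (`ctxReductionOf_der`). There, the reduct of `q↑` is the same four proofs under another
description of the same permutation (`qUp_reduction`). The reduct of `ai↑` pulls a zigzag of two
caps and a cup straight. Straightening is not an equation of flows, and this is the one point where
a triangle identity in `D` is used (`aiUp_reduction`).

It remains to see that `U` really sends the derived operations (par with its structure, the switch,
`q'`, the axiom link) to the expected morphisms, although they are built from duals, double duals
and currying. In `D` the evaluations are nondegenerate pairings, so a morphism is determined by an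
adjoint (`Adj.unique`). A morphism and its dual have adjoint images, the double dual is adjoint to
an identity, and strictness of `D` makes the evaluation on a par, or on a seq, the product of the
evaluations (`adj_par`, `adj_seq`). Comparing adjoints then gives `map_parAssoc`, `map_parUnit` and
`map_q'`; testing against the same pairings gives `map_switch` and `snake`.

The many identities between structural morphisms follow from coherence (`Coherent.eq`): a structural
morphism commutes with sorting the labelled factors, and sorting is invertible. -/

namespace BV

/-! ### Coherence for symmetric monoidal categories

Any two parallel morphisms built from the structural isomorphisms are equal as soon as the
objects involved carry pairwise distinct labels. -/

section Coherence

set_option linter.unusedSectionVars false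

variable {D : Type u₂} [Category.{v₂} D] [MonoidalCategory D] [SymmetricCategory D]

/-- Bracketed words of labelled objects. -/
inductive Word (D : Type u₂) : Type u₂
  | leaf (i : ℕ) (A : D) : Word D
  | unit : Word D
  | tensor (v w : Word D) : Word D

/-- The tensor product of a word. -/
@[reducible]
def Word.obj : Word D → D
  | .leaf _ A => A
  | .unit => 𝟙_ D
  | .tensor v w => v.obj ⊗ w.obj

/-- The labels of a word. -/
def Word.labels : Word D → List ℕ
  | .leaf i _ => [i]
  | .unit => []
  | .tensor v w => v.labels ++ w.labels

/-- Exchange of the first two of three factors. -/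
def exch (X Y Z : D) : X ⊗ (Y ⊗ Z) ⟶ Y ⊗ (X ⊗ Z) :=
  (α_ X Y Z).inv ≫ (β_ X Y).hom ▷ Z ≫ (α_ Y X Z).hom

theorem exch_exch (X Y Z : D) : exch X Y Z ≫ exch Y X Z = 𝟙 _ := by
  simp [exch, ← comp_whiskerRight_assoc]

theorem exch_natural (X Y : D) {Z Z' : D} (f : Z ⟶ Z') :
    exch X Y Z ≫ Y ◁ X ◁ f = X ◁ Y ◁ f ≫ exch X Y Z' := by
  simp only [exch, Category.assoc]
  rw [← associator_naturality_right, ← whisker_exchange_assoc,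
    associator_inv_naturality_right_assoc]

theorem exch_natural_assoc (X Y : D) {Z Z' W : D} (f : Z ⟶ Z') (g : Y ⊗ (X ⊗ Z') ⟶ W) :
    exch X Y Z ≫ Y ◁ X ◁ f ≫ g = X ◁ Y ◁ f ≫ exch X Y Z' ≫ g := by
  rw [← Category.assoc, exch_natural, Category.assoc]

theorem exch_natural_middle (X : D) {Y Y' : D} (f : Y ⟶ Y') (Z : D) :
    exch X Y Z ≫ f ▷ (X ⊗ Z) = X ◁ (f ▷ Z) ≫ exch X Y' Z := by
  simp only [exch, Category.assoc]
  rw [← associator_naturality_left, ← comp_whiskerRight_assoc,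
    ← BraidedCategory.braiding_naturality_right]
  monoidal

theorem exch_tensor_left (X X' Y Z : D) :
    exch (X ⊗ X') Y Z ≫ Y ◁ (α_ X X' Z).hom =
      (α_ X X' (Y ⊗ Z)).hom ≫ X ◁ exch X' Y Z ≫ exch X Y (X' ⊗ Z) := by
  simp only [exch, BraidedCategory.braiding_tensor_left_hom]
  monoidal

theorem exch_tensor_middle (X Y Y' Z : D) :
    exch X (Y ⊗ Y') Z ≫ (α_ Y Y' (X ⊗ Z)).hom =
      X ◁ (α_ Y Y' Z).hom ≫ exch X Y (Y' ⊗ Z) ≫ Y ◁ exch X Y' Z := by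
  simp only [exch, BraidedCategory.braiding_tensor_right_hom]
  monoidal

theorem exch_unit_left (Y Z : D) :
    exch (𝟙_ D) Y Z ≫ Y ◁ (λ_ Z).hom = (λ_ (Y ⊗ Z)).hom := by
  simp only [exch, braiding_tensorUnit_left]
  monoidal

/-- Moving `X` past the single factor `Y ⊗ K` is natural in that factor, hence compatible with the
braiding of `Y` and `K`; the hexagon splits the long exchange into two short ones. -/
theorem exch_yang_baxter (X Y K Z : D) :
    X ◁ exch Y K Z ≫ exch X K (Y ⊗ Z) ≫ K ◁ exch X Y Z =
      exch X Y (K ⊗ Z) ≫ Y ◁ exch X K Z ≫ exch Y K (X ⊗ Z) := by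
  have h₁ := exch_natural_middle X (β_ Y K).hom Z
  have h₂ := exch_tensor_middle X Y K Z
  have h₃ := exch_tensor_middle X K Y Z
  have e : X ◁ exch Y K Z = X ◁ (α_ Y K Z).inv ≫ X ◁ ((β_ Y K).hom ▷ Z) ≫
      X ◁ (α_ K Y Z).hom := by simp [exch]
  rw [e, Category.assoc, Category.assoc, ← h₃, ← reassoc_of% h₁]
  have h₄ : exch X Y (K ⊗ Z) ≫ Y ◁ exch X K Z =
      X ◁ (α_ Y K Z).inv ≫ exch X (Y ⊗ K) Z ≫ (α_ Y K (X ⊗ Z)).hom := by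
    rw [h₂]; simp
  rw [reassoc_of% h₄]
  simp [exch]

theorem exch_exch_assoc (X Y Z : D) {W : D} (f : X ⊗ (Y ⊗ Z) ⟶ W) :
    exch X Y Z ≫ exch Y X Z ≫ f = f := by
  rw [← Category.assoc, exch_exch, Category.id_comp]

theorem exch_push {X K Y T' T'' Z : D} (e : Z ⟶ K ⊗ Y) (m : Y ⟶ T') (m' : X ⊗ T' ⟶ T'') :
    X ◁ (e ≫ K ◁ m) ≫ exch X K T' ≫ K ◁ m' = (X ◁ e ≫ exch X K Y) ≫ K ◁ (X ◁ m ≫ m') := by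
  simp only [MonoidalCategory.whiskerLeft_comp, Category.assoc, exch_natural_assoc]

/-- By Yang–Baxter, moving `X` and `Y` behind `K` in either order can be made to start with the same
two exchanges as in `exch_push`. What differs happens behind `K`, where an induction hypothesis
applies. -/
theorem exch_push_exch {X K Y T T' T'' : D} (m : X ⊗ T ⟶ T') (m' : Y ⊗ T' ⟶ T'') :
    exch X Y (K ⊗ T) ≫ Y ◁ (exch X K T ≫ K ◁ m) ≫ exch Y K T' ≫ K ◁ m' =
      (X ◁ exch Y K T ≫ exch X K (Y ⊗ T)) ≫ K ◁ (exch X Y T ≫ Y ◁ m ≫ m') := by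
  rw [exch_push (exch X K T) m m']
  simp only [MonoidalCategory.whiskerLeft_comp, Category.assoc]
  rw [reassoc_of% exch_yang_baxter]

/-- Strings of labelled objects, as iterated tensor products. -/
@[reducible]
def stringObj : List (ℕ × D) → D
  | [] => 𝟙_ D
  | x :: l => x.2 ⊗ stringObj l

/-- Ways of inserting the object `X` into strings. -/
abbrev Inserter (X : D) : Type _ :=
  (l : List (ℕ × D)) → Σ l' : List (ℕ × D), (X ⊗ stringObj l ⟶ stringObj l')

/-- Insertion of `Y` followed by insertion of `X`. -/
def Inserter.pair {X Y : D} (f : Inserter X) (g : Inserter Y) (l : List (ℕ × D)) :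
    Σ l' : List (ℕ × D), (X ⊗ (Y ⊗ stringObj l) ⟶ stringObj l') :=
  ⟨(f (g l).1).1, X ◁ (g l).2 ≫ (f (g l).1).2⟩

/-- Precomposition for strings paired with a morphism into them. -/
def sigmaPre {X Y : D} (f : X ⟶ Y) (s : Σ l : List (ℕ × D), (Y ⟶ stringObj l)) :
    Σ l : List (ℕ × D), (X ⟶ stringObj l) := ⟨s.1, f ≫ s.2⟩

theorem sigmaPre_comp {X Y Z : D} (f : X ⟶ Y) (g : Y ⟶ Z)
    (s : Σ l : List (ℕ × D), (Z ⟶ stringObj l)) :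
    sigmaPre (f ≫ g) s = sigmaPre f (sigmaPre g s) := by simp [sigmaPre]

theorem sigmaPre_id {X : D} (s : Σ l : List (ℕ × D), (X ⟶ stringObj l)) :
    sigmaPre (𝟙 X) s = s := by simp [sigmaPre]

/-- The order of insertion is irrelevant. -/
def Inserter.Commute {X Y : D} (f : Inserter X) (g : Inserter Y) : Prop :=
  ∀ l, f.pair g l = sigmaPre (exch X Y (stringObj l)) (g.pair f l)

theorem Inserter.Commute.symm {X Y : D} {f : Inserter X} {g : Inserter Y}
    (h : f.Commute g) : g.Commute f := by
  intro l
  rw [h l, ← sigmaPre_comp, exch_exch, sigmaPre_id]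

/-- Sorted insertion of a labelled object. -/
def insertLeaf (x : ℕ × D) : Inserter x.2
  | [] => ⟨[x], 𝟙 _⟩
  | y :: l =>
      if x.1 < y.1 then ⟨x :: y :: l, 𝟙 _⟩
      else ⟨y :: (insertLeaf x l).1, exch x.2 y.2 (stringObj l) ≫ y.2 ◁ (insertLeaf x l).2⟩

theorem insertLeaf_of_lt {x y : ℕ × D} (h : x.1 < y.1) (l : List (ℕ × D)) :
    insertLeaf x (y :: l) = ⟨x :: y :: l, 𝟙 _⟩ := by rw [insertLeaf, if_pos h]

theorem insertLeaf_of_not_lt {x y : ℕ × D} (h : ¬ x.1 < y.1) (l : List (ℕ × D)) :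
    insertLeaf x (y :: l) =
      ⟨y :: (insertLeaf x l).1, exch x.2 y.2 (stringObj l) ≫ y.2 ◁ (insertLeaf x l).2⟩ := by
  rw [insertLeaf, if_neg h]

theorem Inserter.pair_eq {X Y : D} {f : Inserter X} {g : Inserter Y} {l l' l'' : List (ℕ × D)}
    {m : Y ⊗ stringObj l ⟶ stringObj l'} {m' : X ⊗ stringObj l' ⟶ stringObj l''}
    (hg : g l = ⟨l', m⟩) (hf : f l' = ⟨l'', m'⟩) : f.pair g l = ⟨l'', X ◁ m ≫ m'⟩ := by
  unfold Inserter.pair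
  rw [hg]
  dsimp only
  rw [hf]

/-- Extension of a string by a further object. -/
def sigmaCons {X : D} (k : ℕ × D) (s : Σ l : List (ℕ × D), (X ⟶ stringObj l)) :
    Σ l : List (ℕ × D), (k.2 ⊗ X ⟶ stringObj l) := ⟨k :: s.1, k.2 ◁ s.2⟩

/-- A further insertion. -/
def Inserter.after {X Y : D} (f : Inserter X) (s : Σ l : List (ℕ × D), (Y ⟶ stringObj l)) :
    Σ l : List (ℕ × D), (X ⊗ Y ⟶ stringObj l) := ⟨(f s.1).1, X ◁ s.2 ≫ (f s.1).2⟩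

/-- With equal labels the order of insertion would show in the result. For distinct ones with `x`
the smaller, the head `k` of the string comes after both, between them, or before both; only the
last case is inductive. -/
theorem insertLeaf_commute {x y : ℕ × D} (h : x.1 ≠ y.1) :
    (insertLeaf x).Commute (insertLeaf y) := by
  wlog hlt : x.1 < y.1 generalizing x y
  · exact (this h.symm (lt_of_le_of_ne (not_lt.1 hlt) h.symm)).symm
  intro l
  induction l with
  | nil =>
    rw [Inserter.pair_eq (g := insertLeaf y) rfl (insertLeaf_of_lt hlt []),
      Inserter.pair_eq (g := insertLeaf x) rfl (insertLeaf_of_not_lt hlt.le.not_gt [])]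
    simp [sigmaPre, insertLeaf, stringObj, exch_exch]
  | cons k l ih =>
    by_cases hyk : y.1 < k.1
    · rw [Inserter.pair_eq (insertLeaf_of_lt hyk l) (insertLeaf_of_lt hlt _),
        Inserter.pair_eq (insertLeaf_of_lt (hlt.trans hyk) l)
          (insertLeaf_of_not_lt hlt.le.not_gt _), insertLeaf_of_lt hyk]
      simp only [sigmaPre, stringObj, whiskerLeft_id, Category.id_comp, Category.comp_id]
      exact congrArg (Sigma.mk _) (exch_exch _ _ _).symm
    by_cases hxk : x.1 < k.1
    · rw [Inserter.pair_eq (insertLeaf_of_not_lt hyk l) (insertLeaf_of_lt hxk _),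
        Inserter.pair_eq (insertLeaf_of_lt hxk l)
          (insertLeaf_of_not_lt hlt.le.not_gt _), insertLeaf_of_not_lt hyk]
      simp [sigmaPre, stringObj, exch_exch_assoc]
    · rw [Inserter.pair_eq (insertLeaf_of_not_lt hyk l) (insertLeaf_of_not_lt hxk _),
        Inserter.pair_eq (insertLeaf_of_not_lt hxk l) (insertLeaf_of_not_lt hyk _)]
      -- Both sides begin with the same exchanges past `k`. The resulting strings are known to agree
      -- only by induction, so the hypothesis is used as an equality of pairs, through `sigmaCons`
      -- and `sigmaPre`.
      refine (congrArg (Sigma.mk (k :: (insertLeaf x (insertLeaf y l).1).1))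
        (exch_push _ _ _)).trans ?_
      refine Eq.trans ?_ (congrArg (Sigma.mk (k :: (insertLeaf y (insertLeaf x l).1).1))
        (exch_push_exch _ _).symm)
      exact congrArg (fun s => sigmaPre (x.2 ◁ exch y.2 k.2 (stringObj l) ≫
        exch x.2 k.2 (y.2 ⊗ stringObj l)) (sigmaCons k s)) ih

/-- Insertion of a word into a sorted string. -/
def Word.insert : (w : Word D) → Inserter w.obj
  | .leaf i A => insertLeaf (i, A)
  | .unit => fun l => ⟨l, (λ_ _).hom⟩
  | .tensor v w => fun l => sigmaPre (α_ _ _ _).hom (v.insert.pair w.insert l)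

/-- The insertion `k` is moved past `g` and then past `f`; the hexagon `exch_tensor_left` combines
the two exchanges into one past `X ⊗ Y`. -/
theorem Inserter.Commute.tensor {X Y Z : D} {f : Inserter X} {g : Inserter Y} {k : Inserter Z}
    (hf : f.Commute k) (hg : g.Commute k) :
    Inserter.Commute (fun l => sigmaPre (α_ _ _ _).hom (f.pair g l)) k := by
  intro l
  refine Eq.trans (b := sigmaPre (α_ X Y _).hom (f.after (g.pair k l)))
    (congrArg (Sigma.mk _) ?_) ?_
  · simp only [Inserter.pair, sigmaPre, Inserter.after, MonoidalCategory.whiskerLeft_comp,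
      Category.assoc]
    rw [associator_naturality_right_assoc]
  rw [hg l]
  refine Eq.trans (b := sigmaPre ((α_ X Y _).hom ≫ X ◁ exch Y Z (stringObj l) ≫
    X ◁ Z ◁ (g l).2) (f.pair k (g l).1)) (congrArg (Sigma.mk _) ?_) ?_
  · simp only [Inserter.pair, sigmaPre, Inserter.after, MonoidalCategory.whiskerLeft_comp,
      Category.assoc]
  rw [hf (g l).1]
  refine congrArg (Sigma.mk _) ?_
  simp only [Inserter.pair, sigmaPre, MonoidalCategory.whiskerLeft_comp, Category.assoc]
  rw [← exch_natural_assoc, ← reassoc_of% exch_tensor_left]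

theorem Inserter.commute_unit {X : D} (f : Inserter X) :
    Inserter.Commute (fun l => ⟨l, (λ_ _).hom⟩) f := by
  intro l
  refine congrArg (Sigma.mk _) ?_
  rw [leftUnitor_naturality, ← exch_unit_left, Category.assoc]
  rfl

theorem Word.insert_commute (v w : Word D) (h : ∀ i ∈ v.labels, i ∉ w.labels) :
    v.insert.Commute w.insert := by
  induction v with
  | leaf i A =>
    refine Inserter.Commute.symm ?_
    induction w with
    | leaf j B => exact insertLeaf_commute (by simpa [Word.labels, eq_comm] using h)
    | unit => exact Inserter.commute_unit _
    | tensor v w ihv ihw =>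
      simp only [Word.labels, List.mem_append, not_or] at h
      exact (ihv fun i hi => (h i hi).1).tensor (ihw fun i hi => (h i hi).2)
  | unit => exact Inserter.commute_unit _
  | tensor v v' ihv ihw =>
    simp only [Word.labels, List.mem_append] at h
    exact (ihv fun i hi => h i (.inl hi)).tensor (ihw fun i hi => h i (.inr hi))

/-- Morphisms built from the structural isomorphisms of a symmetric monoidal category. -/
inductive Structural : {v w : Word D} → (v.obj ⟶ w.obj) → Prop
  | comp {u v w : Word D} {f : u.obj ⟶ v.obj} {g : v.obj ⟶ w.obj} :
      Structural f → Structural g → Structural (f ≫ g)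
  | whiskerLeft (u : Word D) {v w : Word D} {f : v.obj ⟶ w.obj} :
      Structural f → Structural (v := u.tensor v) (w := u.tensor w) (u.obj ◁ f)
  | whiskerRight {v w : Word D} {f : v.obj ⟶ w.obj} (u : Word D) :
      Structural f → Structural (v := v.tensor u) (w := w.tensor u) (f ▷ u.obj)
  | tensorHom {v w v' w' : Word D} {f : v.obj ⟶ w.obj} {g : v'.obj ⟶ w'.obj} :
      Structural f → Structural g → Structural (v := v.tensor v') (w := w.tensor w') (f ⊗ₘ g)
  | assoc (u v w : Word D) :
      Structural (v := (u.tensor v).tensor w) (w := u.tensor (v.tensor w)) (α_ _ _ _).hom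
  | assoc_inv (u v w : Word D) :
      Structural (v := u.tensor (v.tensor w)) (w := (u.tensor v).tensor w) (α_ _ _ _).inv
  | leftUnit (w : Word D) : Structural (v := Word.unit.tensor w) (w := w) (λ_ _).hom
  | leftUnit_inv (w : Word D) : Structural (v := w) (w := Word.unit.tensor w) (λ_ _).inv
  | rightUnit (w : Word D) : Structural (v := w.tensor Word.unit) (w := w) (ρ_ _).hom
  | rightUnit_inv (w : Word D) : Structural (v := w) (w := w.tensor Word.unit) (ρ_ _).inv
  | braid (v w : Word D) : Structural (v := v.tensor w) (w := w.tensor v) (β_ _ _).hom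
  | id (w : Word D) : Structural (v := w) (w := w) (𝟙 _)

theorem sigmaPre_whiskerLeft {X Y Z : D} (f : Inserter X) (m : Y ⟶ Z)
    (s : Σ l : List (ℕ × D), (Z ⟶ stringObj l)) :
    f.after (sigmaPre m s) = sigmaPre (X ◁ m) (f.after s) := by
  simp [Inserter.after, sigmaPre]

theorem Word.insert_tensor (v w : Word D) (l : List (ℕ × D)) :
    (v.tensor w).insert l = sigmaPre (α_ _ _ _).hom (v.insert.after (w.insert l)) := rfl

theorem Inserter.after_congr {X Y Z : D} {f : Inserter X} {g : Inserter Y} {m : X ⟶ Y}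
    (h : ∀ l, f l = sigmaPre (m ▷ stringObj l) (g l))
    (s : Σ l : List (ℕ × D), (Z ⟶ stringObj l)) :
    f.after s = sigmaPre (m ▷ Z) (g.after s) := by
  unfold Inserter.after
  rw [h]
  simp only [sigmaPre]
  rw [whisker_exchange_assoc]

theorem insert_of_inverse {v w : Word D} {f : v.obj ⟶ w.obj} {g : w.obj ⟶ v.obj}
    (h : ∀ l, v.insert l = sigmaPre (f ▷ stringObj l) (w.insert l)) (hgf : g ≫ f = 𝟙 _)
    (l : List (ℕ × D)) : w.insert l = sigmaPre (g ▷ stringObj l) (v.insert l) := by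
  rw [h, ← sigmaPre_comp, ← comp_whiskerRight, hgf, id_whiskerRight, sigmaPre_id]

theorem insert_assoc (u v w : Word D) (l : List (ℕ × D)) :
    ((u.tensor v).tensor w).insert l =
      sigmaPre ((α_ u.obj v.obj w.obj).hom ▷ stringObj l) ((u.tensor (v.tensor w)).insert l) := by
  refine congrArg (Sigma.mk _) ?_
  change (α_ _ _ _).hom ≫ _ ◁ (w.insert l).2 ≫ ((α_ _ _ _).hom ≫ _ ◁ (v.insert _).2 ≫
    (u.insert _).2) = (α_ _ _ _).hom ▷ _ ≫ (α_ _ _ _).hom ≫ _ ◁ ((α_ _ _ _).hom ≫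
      _ ◁ (w.insert l).2 ≫ (v.insert _).2) ≫ (u.insert _).2
  simp

theorem insert_leftUnit (w : Word D) (l : List (ℕ × D)) :
    (Word.unit.tensor w).insert l = sigmaPre ((λ_ w.obj).hom ▷ stringObj l) (w.insert l) := by
  refine congrArg (Sigma.mk _) ?_
  change (α_ _ _ _).hom ≫ _ ◁ (w.insert l).2 ≫ (λ_ _).hom = (λ_ _).hom ▷ _ ≫ (w.insert l).2
  simp

theorem insert_rightUnit (w : Word D) (l : List (ℕ × D)) :
    (w.tensor Word.unit).insert l = sigmaPre ((ρ_ w.obj).hom ▷ stringObj l) (w.insert l) := by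
  refine congrArg (Sigma.mk _) ?_
  change (α_ _ _ _).hom ≫ _ ◁ (λ_ _).hom ≫ (w.insert l).2 = (ρ_ _).hom ▷ _ ≫ (w.insert l).2
  simp

theorem insert_braid {v w : Word D} (h : ∀ i ∈ v.labels, i ∉ w.labels) (l : List (ℕ × D)) :
    (v.tensor w).insert l =
      sigmaPre ((β_ v.obj w.obj).hom ▷ stringObj l) ((w.tensor v).insert l) := by
  refine (congrArg (sigmaPre (α_ _ _ _).hom) (Word.insert_commute v w h l)).trans ?_
  refine congrArg (Sigma.mk _) ?_
  change (α_ _ _ _).hom ≫ exch _ _ _ ≫ (w.insert.pair v.insert l).2 =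
    (β_ _ _).hom ▷ _ ≫ (α_ _ _ _).hom ≫ (w.insert.pair v.insert l).2
  simp [exch]

/-- The invariant behind coherence: sorting the source agrees with applying `f` and sorting the
target. Distinctness of labels is consumed only by the braiding; the permutation of labels is
recorded in order to carry distinctness through compositions. -/
theorem Structural.spec {v w : Word D} {f : v.obj ⟶ w.obj} (hf : Structural f)
    (hv : v.labels.Nodup) : w.labels.Perm v.labels ∧
      ∀ l, v.insert l = sigmaPre (f ▷ stringObj l) (w.insert l) := by
  induction hf with
  | comp hf hg ihf ihg =>
    obtain ⟨p, hp⟩ := ihf hv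
    obtain ⟨q, hq⟩ := ihg (p.nodup_iff.2 hv)
    refine ⟨q.trans p, fun l => ?_⟩
    rw [hp, hq, comp_whiskerRight, sigmaPre_comp]
  | @whiskerLeft u v w f hf ih =>
    obtain ⟨p, hp⟩ := ih (List.nodup_append.1 hv).2.1
    refine ⟨p.append_left _, fun l => ?_⟩
    rw [Word.insert_tensor, Word.insert_tensor, hp, sigmaPre_whiskerLeft, ← sigmaPre_comp,
      ← sigmaPre_comp, associator_naturality_middle]
  | @whiskerRight v w f u hf ih =>
    obtain ⟨p, hp⟩ := ih (List.nodup_append.1 hv).1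
    refine ⟨p.append_right _, fun l => ?_⟩
    rw [Word.insert_tensor, Word.insert_tensor, Inserter.after_congr hp, ← sigmaPre_comp,
      ← sigmaPre_comp, associator_naturality_left]
  | @tensorHom v w v' w' f g hf hg ihf ihg =>
    obtain ⟨p, hp⟩ := ihf (List.nodup_append.1 hv).1
    obtain ⟨q, hq⟩ := ihg (List.nodup_append.1 hv).2.1
    refine ⟨p.append q, fun l => ?_⟩
    rw [Word.insert_tensor, Word.insert_tensor, Inserter.after_congr hp, hq,
      sigmaPre_whiskerLeft, ← sigmaPre_comp, ← sigmaPre_comp, ← sigmaPre_comp,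
      MonoidalCategory.tensorHom_def]
    simp
  | assoc u v w => exact ⟨by simp [Word.labels], insert_assoc u v w⟩
  | assoc_inv u v w =>
    exact ⟨by simp [Word.labels], insert_of_inverse (insert_assoc u v w) (by simp)⟩
  | leftUnit w => exact ⟨by simp [Word.labels], insert_leftUnit w⟩
  | leftUnit_inv w =>
    exact ⟨by simp [Word.labels], insert_of_inverse (insert_leftUnit w) (by simp)⟩
  | rightUnit w => exact ⟨by simp [Word.labels], insert_rightUnit w⟩
  | rightUnit_inv w =>
    exact ⟨by simp [Word.labels], insert_of_inverse (insert_rightUnit w) (by simp)⟩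
  | braid v w =>
    exact ⟨List.perm_append_comm, insert_braid fun i hi hi' =>
      (List.nodup_append.1 hv).2.2 i hi i hi' rfl⟩
  | id w => exact ⟨.refl _, fun l => by rw [id_whiskerRight, sigmaPre_id]⟩

instance (X Y Z : D) : IsIso (exch X Y Z) := ⟨_, exch_exch _ _ _, exch_exch _ _ _⟩

theorem isIso_insertLeaf (x : ℕ × D) (l : List (ℕ × D)) : IsIso (insertLeaf x l).2 := by
  induction l with
  | nil => exact inferInstanceAs (IsIso (𝟙 _))
  | cons y l ih =>
    by_cases h : x.1 < y.1
    · rw [insertLeaf_of_lt h]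
      exact inferInstanceAs (IsIso (𝟙 _))
    · rw [insertLeaf_of_not_lt h]
      exact inferInstanceAs (IsIso (exch _ _ _ ≫ _ ◁ _))

instance Word.isIso_insert (w : Word D) (l : List (ℕ × D)) : IsIso (w.insert l).2 := by
  induction w generalizing l with
  | leaf i A => exact isIso_insertLeaf _ _
  | unit => exact inferInstanceAs (IsIso (λ_ _).hom)
  | tensor v w ihv ihw =>
    exact inferInstanceAs (IsIso ((α_ _ _ _).hom ≫ _ ◁ (w.insert l).2 ≫
      (v.insert (w.insert l).1).2))

/-- Sorting into the empty string is an isomorphism, so `Structural.spec` determines `f ▷ 𝟙_ D`, and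
whiskering with the unit is faithful. -/
theorem Structural.eq {v w : Word D} {f g : v.obj ⟶ w.obj} (hv : v.labels.Nodup)
    (hf : Structural f) (hg : Structural g) : f = g := by
  have h := ((hf.spec hv).2 []).symm.trans ((hg.spec hv).2 [])
  have h := eq_of_heq (Sigma.mk.inj h).2
  rw [cancel_mono] at h
  exact (whiskerRight_iff f g).1 h

/-! ### Recognition of structural morphisms by instance search -/

/-- The word `w` denotes the object `A`. -/
class Word.Denotes (w : Word D) (A : D) : Prop where
  eq : A = w.obj

instance (i : ℕ) (A : D) : (Word.leaf i A).Denotes A := ⟨rfl⟩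

instance : (Word.unit : Word D).Denotes (𝟙_ D) := ⟨rfl⟩

instance (v w : Word D) (A B : D) [hv : v.Denotes A] [hw : w.Denotes B] :
    (v.tensor w).Denotes (A ⊗ B) := ⟨by rw [hv.eq, hw.eq]⟩

/-- The morphism `f` is structural, from the object denoted by `v` to the one denoted by `w`. -/
class Coherent (v : Word D) (w : outParam (Word D)) {A B : D} (f : A ⟶ B) : Prop where
  spec : ∃ (hA : A = v.obj) (hB : B = w.obj),
    Structural (eqToHom hA.symm ≫ f ≫ eqToHom hB)

namespace Coherent

variable {u v w u' v' : Word D} {A B A' B' E : D}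

instance id [hv : v.Denotes A] : Coherent v v (𝟙 A) := by
  obtain ⟨rfl⟩ := hv
  exact ⟨rfl, rfl, by simpa using Structural.id v⟩

instance comp {f : A ⟶ B} {g : B ⟶ E} [hf : Coherent u v f] [hg : Coherent v w g] :
    Coherent u w (f ≫ g) := by
  obtain ⟨rfl, rfl, hf⟩ := hf
  obtain ⟨_, rfl, hg⟩ := hg
  exact ⟨rfl, rfl, by simpa using hf.comp hg⟩

instance tensorHom {f : A ⟶ B} {g : A' ⟶ B'} [hf : Coherent u v f] [hg : Coherent u' v' g] :
    Coherent (u.tensor u') (v.tensor v') (f ⊗ₘ g) := by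
  obtain ⟨rfl, rfl, hf⟩ := hf
  obtain ⟨rfl, rfl, hg⟩ := hg
  exact ⟨rfl, rfl, by simpa using hf.tensorHom hg⟩

instance whiskerLeft {f : A ⟶ B} [hw : w.Denotes E] [hf : Coherent u v f] :
    Coherent (w.tensor u) (w.tensor v) (E ◁ f) := by
  obtain ⟨rfl⟩ := hw
  obtain ⟨rfl, rfl, hf⟩ := hf
  exact ⟨rfl, rfl, by simpa using hf.whiskerLeft w⟩

instance whiskerRight {f : A ⟶ B} [hw : w.Denotes E] [hf : Coherent u v f] :
    Coherent (u.tensor w) (v.tensor w) (f ▷ E) := by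
  obtain ⟨rfl⟩ := hw
  obtain ⟨rfl, rfl, hf⟩ := hf
  exact ⟨rfl, rfl, by simpa using hf.whiskerRight w⟩

instance assoc [hu : u.Denotes A] [hv : v.Denotes B] [hw : w.Denotes E] :
    Coherent ((u.tensor v).tensor w) (u.tensor (v.tensor w)) (α_ A B E).hom := by
  obtain ⟨rfl⟩ := hu
  obtain ⟨rfl⟩ := hv
  obtain ⟨rfl⟩ := hw
  exact ⟨rfl, rfl, by simpa using Structural.assoc u v w⟩

instance assoc_inv [hu : u.Denotes A] [hv : v.Denotes B] [hw : w.Denotes E] :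
    Coherent (u.tensor (v.tensor w)) ((u.tensor v).tensor w) (α_ A B E).inv := by
  obtain ⟨rfl⟩ := hu
  obtain ⟨rfl⟩ := hv
  obtain ⟨rfl⟩ := hw
  exact ⟨rfl, rfl, by simpa using Structural.assoc_inv u v w⟩

instance leftUnit [hw : w.Denotes A] : Coherent (Word.unit.tensor w) w (λ_ A).hom := by
  obtain ⟨rfl⟩ := hw
  exact ⟨rfl, rfl, by simpa using Structural.leftUnit w⟩

instance leftUnit_inv [hw : w.Denotes A] : Coherent w (Word.unit.tensor w) (λ_ A).inv := by
  obtain ⟨rfl⟩ := hw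
  exact ⟨rfl, rfl, by simpa using Structural.leftUnit_inv w⟩

instance rightUnit [hw : w.Denotes A] : Coherent (w.tensor Word.unit) w (ρ_ A).hom := by
  obtain ⟨rfl⟩ := hw
  exact ⟨rfl, rfl, by simpa using Structural.rightUnit w⟩

instance rightUnit_inv [hw : w.Denotes A] : Coherent w (w.tensor Word.unit) (ρ_ A).inv := by
  obtain ⟨rfl⟩ := hw
  exact ⟨rfl, rfl, by simpa using Structural.rightUnit_inv w⟩

instance braid [hv : v.Denotes A] [hw : w.Denotes B] :
    Coherent (v.tensor w) (w.tensor v) (β_ A B).hom := by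
  obtain ⟨rfl⟩ := hv
  obtain ⟨rfl⟩ := hw
  exact ⟨rfl, rfl, by simpa using Structural.braid v w⟩

instance tensorμ [u.Denotes A] [v.Denotes B] [u'.Denotes A'] [v'.Denotes B'] :
    Coherent ((u.tensor v).tensor (u'.tensor v')) ((u.tensor u').tensor (v.tensor v'))
      (tensorμ A B A' B') := by
  unfold MonoidalCategory.tensorμ
  infer_instance

instance exch [u.Denotes A] [v.Denotes B] [w.Denotes E] :
    Coherent (u.tensor (v.tensor w)) (v.tensor (u.tensor w)) (exch A B E) := by
  unfold BV.exch
  infer_instance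

/-- Only a labelling of the source has to be supplied. Instance search follows the labels through
each composite and produces the two target words; their equality, usually `rfl`, says that both
composites realize the same permutation. Several occurrences of one object therefore get different
labels. -/
theorem eq (v : Word D) (hv : v.labels.Nodup) {w w' : Word D} {f g : A ⟶ B}
    [hf : Coherent v w f] [hg : Coherent v w' g] (h : w = w') : f = g := by
  subst h
  obtain ⟨rfl, rfl, hf⟩ := hf
  obtain ⟨_, _, hg⟩ := hg
  simpa using hf.eq hv hg

end Coherent

/-- Two descriptions of one permutation of eight factors: the combinatorial content of eliminating
`q↑`. -/
theorem tensorμ_tensorμ (A B C E A' B' C' E' : D) :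
    (tensorμ A A' B B' ⊗ₘ tensorμ C C' E E') ≫ tensorμ (A ⊗ B) (A' ⊗ B') (C ⊗ E) (C' ⊗ E') ≫
        (tensorμ A B C E ▷ _) =
      tensorμ (A ⊗ A') (B ⊗ B') (C ⊗ C') (E ⊗ E') ≫ (tensorμ A A' C C' ⊗ₘ tensorμ B B' E E') ≫
        tensorμ (A ⊗ C) (A' ⊗ C') (B ⊗ E) (B' ⊗ E') ≫ (_ ◁ tensorμ A' C' B' E') :=
  Coherent.eq ((((Word.leaf 0 A).tensor (.leaf 1 A')).tensor
    ((Word.leaf 2 B).tensor (.leaf 3 B'))).tensor (((Word.leaf 4 C).tensor (.leaf 5 C')).tensor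
    ((Word.leaf 6 E).tensor (.leaf 7 E')))) (by simp [Word.labels]) rfl

end Coherence

/-! ### Interpretation of flows and derivations in a symmetric monoidal category

The three connectives are all interpreted by the tensor product. -/

/-- Objects interpreting the literals, with morphisms interpreting `ai↓` and `ai↑` and subject to
one of the triangle identities. -/
structure LitModel (𝒜 : Type u) (D : Type u₂) [Category.{v₂} D] [MonoidalCategory D]
    [SymmetricCategory D] where
  lit : Lit 𝒜 → D
  cap (a : 𝒜) : 𝟙_ D ⟶ lit (.pos a) ⊗ lit (.neg a)
  cup (a : 𝒜) : lit (.pos a) ⊗ lit (.neg a) ⟶ 𝟙_ D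
  snake (a : 𝒜) : (λ_ (lit (.neg a))).inv ≫ cap a ▷ lit (.neg a) ≫
    (α_ (lit (.pos a)) (lit (.neg a)) (lit (.neg a))).hom ≫
      lit (.pos a) ◁ (β_ (lit (.neg a)) (lit (.neg a))).hom ≫
        (α_ (lit (.pos a)) (lit (.neg a)) (lit (.neg a))).inv ≫
          cup a ▷ lit (.neg a) ≫ (λ_ (lit (.neg a))).hom = 𝟙 (lit (.neg a))

namespace LitModel

set_option linter.unusedSectionVars false

variable {𝒜 : Type u} {D : Type u₂} [Category.{v₂} D] [MonoidalCategory D] [SymmetricCategory D]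
  (M : LitModel 𝒜 D)

/-! #### Flows -/

/-- The interpretation of a string of literals. -/
@[reducible]
def str : List (Lit 𝒜) → D
  | [] => 𝟙_ D
  | a :: p => M.lit a ⊗ str p

/-- The tensor product of two strings is their concatenation. -/
def glue : (p q : List (Lit 𝒜)) → (M.str p ⊗ M.str q ≅ M.str (p ++ q))
  | [], q => λ_ (M.str q)
  | a :: p, q => α_ (M.lit a) (M.str p) (M.str q) ≪≫ whiskerLeftIso (M.lit a) (glue p q)

/-- The interpretation of a cap. -/
def litCap : (a : Lit 𝒜) → (𝟙_ D ⟶ M.lit a ⊗ M.lit a.dual)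
  | .pos a => M.cap a
  | .neg a => M.cap a ≫ (β_ _ _).hom

/-- The interpretation of a cup. -/
def litCup : (a : Lit 𝒜) → (M.lit a ⊗ M.lit a.dual ⟶ 𝟙_ D)
  | .pos a => M.cup a
  | .neg a => (β_ _ _).hom ≫ M.cup a

/-- The interpretation of a flow. -/
def flow : {p q : List (Lit 𝒜)} → Flow p q → (M.str p ⟶ M.str q)
  | _, _, .empty => 𝟙 _
  | _, _, .wire _ => 𝟙 _
  | _, _, .cross a b => exch (M.lit a) (M.lit b) (𝟙_ D)
  | _, _, .cap a => M.litCap a ≫ M.lit a ◁ (ρ_ (M.lit a.dual)).inv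
  | _, _, .cup a => M.lit a ◁ (ρ_ (M.lit a.dual)).hom ≫ M.litCup a
  | _, _, .vert φ ψ => flow φ ≫ flow ψ
  | _, _, .horiz φ ψ => (M.glue _ _).inv ≫ (flow φ ⊗ₘ flow ψ) ≫ (M.glue _ _).hom

theorem flow_cast {p q p' q' : List (Lit 𝒜)} (hp : p = p') (hq : q = q') (φ : Flow p q) :
    M.flow (φ.cast hp hq) = eqToHom (by rw [hp]) ≫ M.flow φ ≫ eqToHom (by rw [hq]) := by
  subst hp hq
  simp [Flow.cast]

theorem flow_ident (p : List (Lit 𝒜)) : M.flow (Flow.ident p) = 𝟙 _ := by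
  induction p with
  | nil => rfl
  | cons a p ih =>
    change (M.glue [a] p).inv ≫ (𝟙 _ ⊗ₘ M.flow (Flow.ident p)) ≫ (M.glue [a] p).hom = _
    rw [ih]
    simp

theorem whiskerLeft_eqToHom_str (a : Lit 𝒜) {p q : List (Lit 𝒜)} (h : p = q) :
    M.lit a ◁ eqToHom (congrArg M.str h) = eqToHom (congrArg M.str (congrArg (a :: ·) h)) := by
  subst h
  simp

/-- The inductive step of `glue_assoc` with strings replaced by variable objects, so that the
`eqToHom` between differently bracketed strings is just some morphism `e`. -/
theorem glue_assoc_aux {X P Q R PQ QR S T : D} {g : P ⊗ Q ⟶ PQ} {h : PQ ⊗ R ⟶ T}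
    {k : Q ⊗ R ⟶ QR} {m : P ⊗ QR ⟶ S} {e : S ⟶ T}
    (ih : g ▷ R ≫ h = (α_ P Q R).hom ≫ P ◁ k ≫ m ≫ e) :
    ((α_ X P Q).hom ≫ X ◁ g) ▷ R ≫ (α_ X PQ R).hom ≫ X ◁ h =
      (α_ (X ⊗ P) Q R).hom ≫ (X ⊗ P) ◁ k ≫ ((α_ X P QR).hom ≫ X ◁ m) ≫ X ◁ e := by
  have ih' := congrArg (fun f => X ◁ f) ih
  simp only [MonoidalCategory.whiskerLeft_comp] at ih'
  simp [ih']

theorem glue_assoc (p q r : List (Lit 𝒜)) :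
    (M.glue p q).hom ▷ M.str r ≫ (M.glue (p ++ q) r).hom =
      (α_ _ _ _).hom ≫ M.str p ◁ (M.glue q r).hom ≫ (M.glue p (q ++ r)).hom ≫
        eqToHom (congrArg M.str (List.append_assoc p q r).symm) := by
  induction p with
  | nil => simp [glue]
  | cons a p ih =>
    refine (glue_assoc_aux ih).trans ?_
    rw [M.whiskerLeft_eqToHom_str a (List.append_assoc p q r).symm]
    rfl

theorem glue_nil (p : List (Lit 𝒜)) :
    (M.glue p []).hom = (ρ_ _).hom ≫ eqToHom (congrArg M.str (List.append_nil p).symm) := by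
  induction p with
  | nil => simp [glue, unitors_equal]
  | cons a p ih =>
    change (α_ (M.lit a) (M.str p) (𝟙_ D)).hom ≫ M.lit a ◁ (M.glue p []).hom =
      (ρ_ (M.lit a ⊗ M.str p)).hom ≫ _
    rw [ih, MonoidalCategory.whiskerLeft_comp,
      M.whiskerLeft_eqToHom_str a (List.append_nil p).symm]
    simp only [rightUnitor_tensor_hom, Category.assoc]

theorem flow_horiz_wire (a : Lit 𝒜) {p q : List (Lit 𝒜)} (φ : Flow p q) :
    M.flow (.horiz (p := [a]) (q := [a]) (.wire a) φ) = M.lit a ◁ M.flow φ := by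
  change (M.lit a ◁ (λ_ (M.str p)).inv ≫ (α_ (M.lit a) (𝟙_ D) (M.str p)).inv) ≫
    (𝟙 (M.lit a ⊗ 𝟙_ D) ⊗ₘ M.flow φ) ≫ (α_ (M.lit a) (𝟙_ D) (M.str q)).hom ≫
      M.lit a ◁ (λ_ (M.str q)).hom = _
  simp

theorem cross_horiz_aux (A B Q : D) :
    (A ◁ (B ◁ (λ_ Q).inv ≫ (α_ B (𝟙_ D) Q).inv) ≫ (α_ A (B ⊗ 𝟙_ D) Q).inv) ≫
      (exch A B (𝟙_ D) ⊗ₘ 𝟙 Q) ≫ (α_ B (A ⊗ 𝟙_ D) Q).hom ≫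
        B ◁ ((α_ A (𝟙_ D) Q).hom ≫ A ◁ (λ_ Q).hom) = exch A B Q :=
  Coherent.eq ((Word.leaf 0 A).tensor ((Word.leaf 1 B).tensor (Word.leaf 2 Q)))
    (by simp [Word.labels]) rfl

theorem flow_cross_horiz (a b : Lit 𝒜) {q : List (Lit 𝒜)} {φ : Flow q q} (h : M.flow φ = 𝟙 _) :
    M.flow (.horiz (p := [a, b]) (q := [b, a]) (.cross a b) φ) =
      exch (M.lit a) (M.lit b) (M.str q) := by
  rw [← cross_horiz_aux, ← h]
  rfl

theorem crossWire_aux {A B Q S : D} (g : Q ⊗ (A ⊗ 𝟙_ D) ⟶ S) :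
    exch A B Q ≫ B ◁ ((β_ A Q).hom ≫ Q ◁ (ρ_ A).inv ≫ g) =
      (β_ A (B ⊗ Q)).hom ≫ (B ⊗ Q) ◁ (ρ_ A).inv ≫ (α_ B Q (A ⊗ 𝟙_ D)).hom ≫ B ◁ g := by
  have h : exch A B Q ≫ B ◁ (β_ A Q).hom ≫ B ◁ Q ◁ (ρ_ A).inv =
      (β_ A (B ⊗ Q)).hom ≫ (B ⊗ Q) ◁ (ρ_ A).inv ≫ (α_ B Q (A ⊗ 𝟙_ D)).hom :=
    Coherent.eq ((Word.leaf 0 A).tensor ((Word.leaf 1 B).tensor (Word.leaf 2 Q)))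
      (by simp [Word.labels]) rfl
  rw [← reassoc_of% h]
  simp only [MonoidalCategory.whiskerLeft_comp]

theorem flow_crossWire (a : Lit 𝒜) (q : List (Lit 𝒜)) :
    M.flow (Flow.crossWire a q) =
      (β_ (M.lit a) (M.str q)).hom ≫ M.str q ◁ (ρ_ (M.lit a)).inv ≫ (M.glue q [a]).hom := by
  induction q with
  | nil =>
    change 𝟙 (M.lit a ⊗ 𝟙_ D) = (β_ (M.lit a) (𝟙_ D)).hom ≫ 𝟙_ D ◁ (ρ_ (M.lit a)).inv ≫
      (λ_ (M.lit a ⊗ 𝟙_ D)).hom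
    exact Coherent.eq ((Word.leaf 0 (M.lit a)).tensor .unit) (by simp [Word.labels]) rfl
  | cons b q ih =>
    refine (congrArg₂ (· ≫ ·) (M.flow_cross_horiz a b (M.flow_ident q))
      (M.flow_horiz_wire b (Flow.crossWire a q))).trans ?_
    rw [ih]
    exact crossWire_aux _

/-- The core `h₁` is the hexagon for `A ⊗ P` against `Q`. The hypothesis `hk` will be `glue_assoc`,
and `e'` the cast in the definition of `Flow.crossing`, which cancels the `e` coming from
`glue_assoc`. -/
theorem flow_crossing_aux {A P Q PQ QP QA S T : D} (g : P ⊗ Q ≅ PQ) (h : Q ⊗ P ≅ QP)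
    (h' : Q ⊗ (A ⊗ 𝟙_ D) ⟶ QA) {g' : QA ⊗ P ⟶ S} {k : Q ⊗ (A ⊗ P) ⟶ T} {e : T ⟶ S} {e' : S ⟶ T}
    (he : e ≫ e' = 𝟙 T)
    (hk : h' ▷ P ≫ g' = (α_ Q (A ⊗ 𝟙_ D) P).hom ≫
      Q ◁ ((α_ A (𝟙_ D) P).hom ≫ A ◁ (λ_ P).hom) ≫ k ≫ e) :
    (A ◁ (g.inv ≫ (β_ P Q).hom ≫ h.hom) ≫ (A ◁ h.inv ≫ (α_ A Q P).inv) ≫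
      (((β_ A Q).hom ≫ Q ◁ (ρ_ A).inv ≫ h') ⊗ₘ 𝟙 P) ≫ g') ≫ e' =
      (A ◁ g.inv ≫ (α_ A P Q).inv) ≫ (β_ (A ⊗ P) Q).hom ≫ k := by
  have h₁ : A ◁ (β_ P Q).hom ≫ (α_ A Q P).inv ≫ (β_ A Q).hom ▷ P ≫ (Q ◁ (ρ_ A).inv) ▷ P ≫
      (α_ Q (A ⊗ 𝟙_ D) P).hom ≫ Q ◁ ((α_ A (𝟙_ D) P).hom ≫ A ◁ (λ_ P).hom) =
      (α_ A P Q).inv ≫ (β_ (A ⊗ P) Q).hom :=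
    Coherent.eq ((Word.leaf 0 A).tensor ((Word.leaf 1 P).tensor (Word.leaf 2 Q)))
      (by simp [Word.labels]) rfl
  simp only [tensorHom_id, comp_whiskerRight, Category.assoc, hk, he, Category.comp_id,
    MonoidalCategory.whiskerLeft_comp, ← reassoc_of% h₁]
  simp

theorem flow_crossing (p q : List (Lit 𝒜)) :
    M.flow (Flow.crossing p q) = (M.glue p q).inv ≫ (β_ _ _).hom ≫ (M.glue q p).hom := by
  induction p with
  | nil =>
    rw [Flow.crossing, flow_cast]
    erw [flow_ident]
    simp [glue_nil]
    simp [glue]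
  | cons a p ih =>
    rw [Flow.crossing, flow_cast]
    have h : q ++ [a] ++ p = q ++ (a :: p) := by simp
    refine Eq.trans ?_ (flow_crossing_aux (M.glue p q) (M.glue q p) (M.glue q [a]).hom
      (eqToHom_trans _ (congrArg M.str h)) (M.glue_assoc q [a] p))
    rw [← ih, ← flow_crossWire, ← flow_ident]
    refine (Category.id_comp _).trans ?_
    refine congrArg (· ≫ _) (congrArg₂ (· ≫ ·) (M.flow_horiz_wire a (Flow.crossing p q)) rfl)

theorem flow_wire (a : Lit 𝒜) : M.flow (.wire a) = 𝟙 _ := rfl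

theorem flow_cap_horiz (a b : Lit 𝒜) : M.flow ((Flow.cap a).horiz (Flow.wire b)) =
    (λ_ (M.lit b ⊗ 𝟙_ D)).inv ≫ M.litCap a ▷ (M.lit b ⊗ 𝟙_ D) ≫ (α_ _ _ _).hom := by
  refine Eq.trans (b := (λ_ (M.lit b ⊗ 𝟙_ D)).inv ≫
    ((M.litCap a ≫ M.lit a ◁ (ρ_ (M.lit a.dual)).inv)
    ⊗ₘ 𝟙 (M.lit b ⊗ 𝟙_ D)) ≫ (α_ _ _ _).hom ≫ M.lit a ◁ ((α_ _ _ _).hom ≫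
      M.lit a.dual ◁ (λ_ (M.lit b ⊗ 𝟙_ D)).hom)) rfl ?_
  monoidal

theorem flow_cup_horiz (a b : Lit 𝒜) : M.flow ((Flow.cup a).horiz (Flow.wire b)) =
    (α_ _ _ _).inv ≫ M.litCup a ▷ (M.lit b ⊗ 𝟙_ D) ≫ (λ_ (M.lit b ⊗ 𝟙_ D)).hom := by
  refine Eq.trans (b := (M.lit a ◁ (M.lit a.dual ◁ (λ_ (M.lit b ⊗ 𝟙_ D)).inv ≫ (α_ _ _ _).inv) ≫
    (α_ _ _ _).inv) ≫ ((M.lit a ◁ (ρ_ (M.lit a.dual)).hom ≫ M.litCup a)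
    ⊗ₘ 𝟙 (M.lit b ⊗ 𝟙_ D)) ≫ (λ_ (M.lit b ⊗ 𝟙_ D)).hom) rfl ?_
  monoidal

/-- Naturality of the braiding carries `k` from one side of `B` to the other, at the cost of a
braiding with the unit. Once `k` stands in the same place on both sides, the rest is a permutation.
-/
theorem cap_slide_aux {A A' : D} (B : D) (k : 𝟙_ D ⟶ A ⊗ A') :
    ((λ_ (B ⊗ 𝟙_ D)).inv ≫ k ▷ (B ⊗ 𝟙_ D) ≫ (α_ A A' (B ⊗ 𝟙_ D)).hom) ≫ A ◁ exch A' B (𝟙_ D) =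
      B ◁ (k ≫ A ◁ (ρ_ A').inv) ≫ exch B A (A' ⊗ 𝟙_ D) := by
  have h₁ : B ◁ k = (β_ B (𝟙_ D)).hom ≫ k ▷ B ≫ (β_ (A ⊗ A') B).hom := by
    rw [BraidedCategory.braiding_naturality_left, SymmetricCategory.symmetry_assoc]
  have h₂ : k ▷ (B ⊗ 𝟙_ D) = 𝟙_ D ◁ (ρ_ B).hom ≫ k ▷ B ≫ (A ⊗ A') ◁ (ρ_ B).inv := by simp
  have h₃ : (λ_ (B ⊗ 𝟙_ D)).inv ≫ 𝟙_ D ◁ (ρ_ B).hom = (β_ B (𝟙_ D)).hom :=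
    Coherent.eq ((Word.leaf 0 B).tensor .unit) (by simp [Word.labels]) rfl
  have h₄ : (A ⊗ A') ◁ (ρ_ B).inv ≫ (α_ A A' (B ⊗ 𝟙_ D)).hom ≫ A ◁ exch A' B (𝟙_ D) =
      (β_ (A ⊗ A') B).hom ≫ B ◁ (A ◁ (ρ_ A').inv) ≫ exch B A (A' ⊗ 𝟙_ D) :=
    Coherent.eq (((Word.leaf 0 A).tensor (.leaf 1 A')).tensor (.leaf 2 B))
      (by simp [Word.labels]) rfl
  simp only [h₂, MonoidalCategory.whiskerLeft_comp, h₁, Category.assoc]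
  rw [reassoc_of% h₃, h₄]

theorem cap_cross_aux {A A' : D} (k : 𝟙_ D ⟶ A ⊗ A') :
    (k ≫ A ◁ (ρ_ A').inv) ≫ exch A A' (𝟙_ D) = (k ≫ (β_ A A').hom) ≫ A' ◁ (ρ_ A).inv := by
  simp only [Category.assoc]
  exact congrArg (k ≫ ·) (Coherent.eq ((Word.leaf 0 A).tensor (.leaf 1 A'))
    (by simp [Word.labels]) rfl)

theorem cross_cup_aux {A A' : D} (k : A ⊗ A' ⟶ 𝟙_ D) :
    exch A' A (𝟙_ D) ≫ A ◁ (ρ_ A').hom ≫ k = A' ◁ (ρ_ A).hom ≫ (β_ A' A).hom ≫ k := by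
  have : exch A' A (𝟙_ D) ≫ A ◁ (ρ_ A').hom = A' ◁ (ρ_ A).hom ≫ (β_ A' A).hom :=
    Coherent.eq ((Word.leaf 0 A').tensor ((Word.leaf 1 A).tensor .unit))
      (by simp [Word.labels]) rfl
  rw [reassoc_of% this]

theorem cup_slide_aux {A A' : D} (B : D) (k : A ⊗ A' ⟶ 𝟙_ D) :
    A ◁ exch B A' (𝟙_ D) ≫ (α_ A A' (B ⊗ 𝟙_ D)).inv ≫ k ▷ (B ⊗ 𝟙_ D) ≫ (λ_ (B ⊗ 𝟙_ D)).hom =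
      exch A B (A' ⊗ 𝟙_ D) ≫ B ◁ (A ◁ (ρ_ A').hom ≫ k) := by
  have h₁ : B ◁ k = (β_ B (A ⊗ A')).hom ≫ k ▷ B ≫ (β_ (𝟙_ D) B).hom := by
    rw [BraidedCategory.braiding_naturality_left, SymmetricCategory.symmetry_assoc]
  have h₂ : k ▷ (B ⊗ 𝟙_ D) = (A ⊗ A') ◁ (ρ_ B).hom ≫ k ▷ B ≫ 𝟙_ D ◁ (ρ_ B).inv := by simp
  have h₃ : 𝟙_ D ◁ (ρ_ B).inv ≫ (λ_ (B ⊗ 𝟙_ D)).hom = (β_ (𝟙_ D) B).hom :=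
    Coherent.eq (Word.unit.tensor (.leaf 0 B)) (by simp [Word.labels]) rfl
  have h₄ : A ◁ exch B A' (𝟙_ D) ≫ (α_ A A' (B ⊗ 𝟙_ D)).inv ≫ (A ⊗ A') ◁ (ρ_ B).hom =
      exch A B (A' ⊗ 𝟙_ D) ≫ B ◁ (A ◁ (ρ_ A').hom) ≫ (β_ B (A ⊗ A')).hom :=
    Coherent.eq ((Word.leaf 0 A).tensor ((Word.leaf 2 B).tensor ((Word.leaf 1 A').tensor .unit)))
      (by simp [Word.labels]) rfl
  simp only [h₂, MonoidalCategory.whiskerLeft_comp, h₁, Category.assoc]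
  rw [h₃, reassoc_of% h₄]

theorem flow_horiz_assoc {p q p' q' p'' q'' : List (Lit 𝒜)} (φ : Flow p q) (ψ : Flow p' q')
    (χ : Flow p'' q'') :
    M.flow ((φ.horiz ψ).horiz χ) = M.flow ((φ.horiz (ψ.horiz χ)).cast
      (List.append_assoc p p' p'').symm (List.append_assoc q q' q'').symm) := by
  rw [flow_cast]
  -- Cancelling this isomorphism removes the inverses of `glue` at the source, so that `glue_assoc`
  -- can be applied at both ends.
  refine (cancel_epi ((M.glue p p').hom ▷ M.str p'' ≫ (M.glue (p ++ p') p'').hom)).1 ?_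
  refine Eq.trans (b := ((M.flow φ ⊗ₘ M.flow ψ) ⊗ₘ M.flow χ) ≫
    (M.glue q q').hom ▷ M.str q'' ≫ (M.glue (q ++ q') q'').hom) ?_ ?_
  · simp [flow, MonoidalCategory.tensorHom_def]
    rw [← whisker_exchange_assoc]
    simp
  rw [glue_assoc, glue_assoc]
  have h : (M.flow φ ⊗ₘ (M.flow ψ ⊗ₘ M.flow χ)) ≫ M.str q ◁ (M.glue q' q'').hom =
      M.str p ◁ (M.glue p' p'').hom ≫ (M.flow φ ⊗ₘ M.flow (ψ.horiz χ)) := by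
    simp [flow, ← id_tensorHom, MonoidalCategory.tensorHom_comp_tensorHom]
  simp only [Category.assoc, associator_naturality_assoc, reassoc_of% h]
  simp only [flow, Category.assoc, eqToHom_trans_assoc, eqToHom_refl, Category.id_comp,
    Iso.hom_inv_id_assoc]

theorem glue_nil_inv (p : List (Lit 𝒜)) :
    (M.glue p []).inv = eqToHom (congrArg M.str (List.append_nil p)) ≫ (ρ_ _).inv := by
  rw [← cancel_epi (M.glue p []).hom, Iso.hom_inv_id]
  simp only [glue_nil, Category.assoc, eqToHom_trans_assoc, eqToHom_refl, Category.id_comp,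
    Iso.hom_inv_id]

theorem flow_horiz_empty {p q : List (Lit 𝒜)} (φ : Flow p q) :
    M.flow (φ.horiz Flow.empty) =
      M.flow (φ.cast (List.append_nil p).symm (List.append_nil q).symm) := by
  rw [flow_cast]
  simp only [flow, glue_nil, glue_nil_inv]
  simp

/-- No relation between `cap` and `cup` enters: sliding is naturality of the braiding, and the
symmetry of caps and cups holds because their values at negative literals are defined by a braiding.
-/
theorem flow_congr {p q : List (Lit 𝒜)} {φ ψ : Flow p q} (h : FlowEq φ ψ) :
    M.flow φ = M.flow ψ := by
  induction h with
  | refl => rfl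
  | symm _ ih => exact ih.symm
  | trans _ _ ih ih' => exact ih.trans ih'
  | vert _ _ ih ih' => simp only [flow, ih, ih']
  | horiz _ _ ih ih' => simp only [flow, ih, ih']
  | vert_assoc => simp [flow]
  | ident_vert => simp [flow, flow_ident]
  | vert_ident => simp [flow, flow_ident]
  | horiz_assoc φ ψ χ => exact M.flow_horiz_assoc φ ψ χ
  | empty_horiz φ => simp [flow, glue]
  | horiz_empty φ => exact M.flow_horiz_empty φ
  | interchange => simp [flow]
  | cross_cross a b =>
    rw [flow_ident]
    exact exch_exch _ _ _
  | yang_baxter a b c =>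
    have hw (a : Lit 𝒜) : M.flow (.wire a) = 𝟙 _ := rfl
    have h₁ (a b c : Lit 𝒜) := M.flow_cross_horiz a b (hw c)
    have h₂ (a b c : Lit 𝒜) := M.flow_horiz_wire a (.cross b c)
    refine (congrArg₂ (· ≫ ·) (congrArg₂ (· ≫ ·) (h₁ a b c) (h₂ b a c)) (h₁ b c a)).trans ?_
    refine Eq.trans ?_ (congrArg₂ (· ≫ ·) (congrArg₂ (· ≫ ·) (h₂ a b c) (h₁ a c b))
      (h₂ c a b)).symm
    have := exch_yang_baxter (M.lit a) (M.lit b) (M.lit c) (𝟙_ D)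
    exact (Category.assoc _ _ _).trans (this.symm.trans (Category.assoc _ _ _).symm)
  | cap_cross a =>
    rw [flow_cast]
    refine (cap_cross_aux (M.litCap a)).trans ?_
    refine Eq.trans ?_ (Category.id_comp _).symm
    cases a with
    | pos a => exact (Category.comp_id _).symm
    -- The cap at a negative literal already contains a braiding, and the crossing undoes it.
    | neg a =>
      refine Eq.trans ?_ (Category.comp_id _).symm
      exact congrArg (· ≫ _) (by simp [litCap, Lit.dual])
  | cap_slide a b =>
    refine (congrArg₂ (· ≫ ·) (M.flow_cap_horiz a b)
      (M.flow_horiz_wire a (.cross a.dual b))).trans ?_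
    refine Eq.trans ?_ (congrArg₂ (· ≫ ·) (M.flow_horiz_wire b (.cap a))
      (M.flow_cross_horiz b a (M.flow_wire _))).symm
    exact cap_slide_aux _ _
  | cross_cup a =>
    rw [flow_cast]
    refine (cross_cup_aux (M.litCup a)).trans ?_
    refine Eq.trans ?_ (congrArg (_ ≫ ·) (Category.comp_id _)).symm
    cases a with
    | pos a => exact (Category.id_comp _).symm
    | neg a =>
      refine Eq.trans ?_ (Category.id_comp _).symm
      exact congrArg (_ ≫ ·) (by simp [litCup, Lit.dual])
  | cup_slide a b =>
    refine (congrArg₂ (· ≫ ·) (M.flow_horiz_wire a (.cross b a.dual))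
      (M.flow_cup_horiz a b)).trans ?_
    refine Eq.trans ?_ (congrArg₂ (· ≫ ·) (M.flow_cross_horiz a b (M.flow_wire _))
      (M.flow_horiz_wire b (.cup a))).symm
    exact cup_slide_aux _ _

end LitModel

namespace LitModel

set_option linter.unusedSectionVars false

variable {𝒜 : Type u} {D : Type u₂} [Category.{v₂} D] [MonoidalCategory D] [SymmetricCategory D]
  (M : LitModel 𝒜 D)

/-! #### Derivations -/

/-- The interpretation of a formula. -/
@[reducible]
def fm : Fm 𝒜 → D
  | .unit => 𝟙_ D
  | .atom a => M.lit (.pos a)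
  | .natom a => M.lit (.neg a)
  | .bin _ A B => fm A ⊗ fm B

/-- The interpretation of a generating equation. -/
def eqn : {A B : Fm 𝒜} → Eqn A B → (M.fm A ≅ M.fm B)
  | _, _, .tensAssoc A B C => α_ (M.fm A) (M.fm B) (M.fm C)
  | _, _, .tensComm A B => β_ (M.fm A) (M.fm B)
  | _, _, .tensUnit A => ρ_ (M.fm A)
  | _, _, .parAssoc A B C => α_ (M.fm A) (M.fm B) (M.fm C)
  | _, _, .parComm A B => β_ (M.fm A) (M.fm B)
  | _, _, .parUnit A => ρ_ (M.fm A)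
  | _, _, .seqAssoc A B C => α_ (M.fm A) (M.fm B) (M.fm C)
  | _, _, .seqUnitRight A => ρ_ (M.fm A)
  | _, _, .seqUnitLeft A => λ_ (M.fm A)

/-- The interpretation of a rule instance. -/
def rule : {A B : Fm 𝒜} → Rule A B → (M.fm A ⟶ M.fm B)
  | _, _, .eqv e => (M.eqn e).hom
  | _, _, .eqvSymm e => (M.eqn e).inv
  | _, _, .aiDown a => M.cap a
  | _, _, .aiUp a => M.cup a
  | _, _, .switch A B C => (α_ (M.fm A) (M.fm B) (M.fm C)).inv
  | _, _, .qDown A B C E => tensorμ (M.fm A) (M.fm B) (M.fm C) (M.fm E)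
  | _, _, .qUp A B C E => tensorμ (M.fm A) (M.fm B) (M.fm C) (M.fm E)

/-- The interpretation of a derivation. -/
def der : {A B : Fm 𝒜} → Der A B → (M.fm A ⟶ M.fm B)
  | _, _, .id _ => 𝟙 _
  | _, _, .hor _ Φ Ψ => der Φ ⊗ₘ der Ψ
  | _, _, .step Φ r Ψ => der Φ ≫ M.rule r ≫ der Ψ

/-- The interpretation of a formula is that of its string of literals. -/
def fmIso : (A : Fm 𝒜) → (M.fm A ≅ M.str A.str)
  | .unit => Iso.refl _
  | .atom _ => (ρ_ _).symm
  | .natom _ => (ρ_ _).symm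
  | .bin _ A B => tensorIso (fmIso A) (fmIso B) ≪≫ M.glue A.str B.str

theorem flow_ident_cast {p q q' : List (Lit 𝒜)} (h : p = q) (h' : p = q') :
    M.flow ((Flow.ident p).cast h h') = eqToHom (congrArg M.str (h.symm.trans h')) := by
  rw [flow_cast, flow_ident]
  simp

theorem fmIso_assoc_aux {A B C P Q R PQ QR S T : D} {a : A ⟶ P} {b : B ⟶ Q} {c : C ⟶ R}
    {g : P ⊗ Q ⟶ PQ} {h : PQ ⊗ R ⟶ S} {k : Q ⊗ R ⟶ QR} {m : P ⊗ QR ⟶ T} {e : S ⟶ T} {e' : T ⟶ S}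
    (he : e' ≫ e = 𝟙 T) (H : g ▷ R ≫ h = (α_ P Q R).hom ≫ P ◁ k ≫ m ≫ e') :
    ((((a ⊗ₘ b) ≫ g) ⊗ₘ c) ≫ h) ≫ e = (α_ A B C).hom ≫ (a ⊗ₘ ((b ⊗ₘ c) ≫ k)) ≫ m := by
  have h₁ : (((a ⊗ₘ b) ≫ g) ⊗ₘ c) = ((a ⊗ₘ b) ⊗ₘ c) ≫ g ▷ R := by
    rw [← tensorHom_id, MonoidalCategory.tensorHom_comp_tensorHom, Category.comp_id]
  have h₂ : (a ⊗ₘ ((b ⊗ₘ c) ≫ k)) = (a ⊗ₘ (b ⊗ₘ c)) ≫ P ◁ k := by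
    simp [← id_tensorHom, MonoidalCategory.tensorHom_comp_tensorHom]
  simp only [h₁, h₂, Category.assoc, reassoc_of% H, he, Category.comp_id,
    associator_naturality_assoc]

/-- The connectives are independent so that this covers the three associativity equations and also
the switch, which mixes tensor and par. -/
theorem fmIso_assoc (o₁ o₂ o₃ o₄ : Conn) (A B C : Fm 𝒜) :
    (M.fmIso (.bin o₁ (.bin o₂ A B) C)).hom ≫
        eqToHom (congrArg M.str (List.append_assoc A.str B.str C.str)) =
      (α_ (M.fm A) (M.fm B) (M.fm C)).hom ≫ (M.fmIso (.bin o₃ A (.bin o₄ B C))).hom :=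
  fmIso_assoc_aux ((eqToHom_trans _ _).trans (eqToHom_refl _ _)) (M.glue_assoc A.str B.str C.str)

theorem fmIso_comm (o o' : Conn) (A B : Fm 𝒜) :
    (M.fmIso (.bin o A B)).hom ≫ M.flow (Flow.crossing A.str B.str) =
      (β_ (M.fm A) (M.fm B)).hom ≫ (M.fmIso (.bin o' B A)).hom := by
  have h : (((M.fmIso A).hom ⊗ₘ (M.fmIso B).hom) ≫ (M.glue A.str B.str).hom) ≫
      M.flow (Flow.crossing A.str B.str) =
      (β_ (M.fm A) (M.fm B)).hom ≫ ((M.fmIso B).hom ⊗ₘ (M.fmIso A).hom) ≫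
        (M.glue B.str A.str).hom := by
    rw [flow_crossing]
    simp
  exact h

theorem fmIso_rightUnit (o : Conn) (A : Fm 𝒜) :
    (M.fmIso (.bin o A .unit)).hom ≫ eqToHom (congrArg M.str (List.append_nil A.str)) =
      (ρ_ (M.fm A)).hom ≫ (M.fmIso A).hom := by
  have h : (((M.fmIso A).hom ⊗ₘ 𝟙 (𝟙_ D)) ≫ (M.glue A.str []).hom) ≫
      eqToHom (congrArg M.str (List.append_nil A.str)) = (ρ_ (M.fm A)).hom ≫ (M.fmIso A).hom := by
    rw [glue_nil]
    simp
  exact h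

theorem fmIso_leftUnit (o : Conn) (A : Fm 𝒜) :
    (M.fmIso (.bin o .unit A)).hom = (λ_ (M.fm A)).hom ≫ (M.fmIso A).hom := by
  have h : ((𝟙 (𝟙_ D) ⊗ₘ (M.fmIso A).hom) ≫ (λ_ (M.str A.str)).hom) =
      (λ_ (M.fm A)).hom ≫ (M.fmIso A).hom := by simp
  exact h

theorem flow_eqn {A B : Fm 𝒜} (e : Eqn A B) :
    (M.fmIso A).hom ≫ M.flow e.flow = (M.eqn e).hom ≫ (M.fmIso B).hom := by
  cases e with
  | tensAssoc A B C | parAssoc A B C | seqAssoc A B C =>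
    exact (congrArg (_ ≫ ·) (M.flow_ident_cast rfl (List.append_assoc A.str B.str C.str))).trans
      (M.fmIso_assoc _ _ _ _ A B C)
  | tensComm A B | parComm A B => exact M.fmIso_comm _ _ A B
  | tensUnit A | parUnit A | seqUnitRight A =>
    exact (congrArg (_ ≫ ·) (M.flow_ident_cast (List.append_nil B.str).symm rfl)).trans
      (M.fmIso_rightUnit _ B)
  | seqUnitLeft A =>
    exact ((congrArg (_ ≫ ·) (M.flow_ident _)).trans (Category.comp_id _)).trans
      (M.fmIso_leftUnit _ B)

theorem flow_ident_cast_comp {p q q' r : List (Lit 𝒜)} (h : p = q) (h' : p = q')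
    (k : r = q') (k' : r = q) :
    M.flow ((Flow.ident p).cast h h') ≫ M.flow ((Flow.ident r).cast k k') = 𝟙 _ := by
  rw [flow_ident_cast, flow_ident_cast, eqToHom_trans, eqToHom_refl]

theorem flow_crossing_comp (p q : List (Lit 𝒜)) :
    M.flow (Flow.crossing p q) ≫ M.flow (Flow.crossing q p) = 𝟙 _ := by
  simp [flow_crossing]

theorem flow_eqn_comp_flowSymm {A B : Fm 𝒜} (e : Eqn A B) :
    M.flow e.flow ≫ M.flow e.flowSymm = 𝟙 _ := by
  cases e with
  | tensAssoc A B C | parAssoc A B C | seqAssoc A B C =>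
    exact M.flow_ident_cast_comp rfl (List.append_assoc A.str B.str C.str)
      (List.append_assoc A.str B.str C.str) rfl
  | tensComm A B | parComm A B => exact M.flow_crossing_comp _ _
  | tensUnit A | parUnit A | seqUnitRight A =>
    exact M.flow_ident_cast_comp (List.append_nil B.str).symm rfl rfl (List.append_nil B.str).symm
  | seqUnitLeft A =>
    exact (congrArg₂ (· ≫ ·) (M.flow_ident _) (M.flow_ident _)).trans (Category.id_comp _)

theorem flow_eqnSymm {A B : Fm 𝒜} (e : Eqn A B) :
    (M.fmIso B).hom ≫ M.flow e.flowSymm = (M.eqn e).inv ≫ (M.fmIso A).hom := by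
  rw [← cancel_epi (M.eqn e).hom, ← reassoc_of% M.flow_eqn e, flow_eqn_comp_flowSymm]
  simp

theorem whiskerLeft_eqToHom_glue (p : List (Lit 𝒜)) {q q' : List (Lit 𝒜)} (h : q = q') :
    M.str p ◁ eqToHom (congrArg M.str h) ≫ (M.glue p q').hom =
      (M.glue p q).hom ≫ eqToHom (congrArg M.str (congrArg (p ++ ·) h)) := by
  subst h
  simp

/-- Rebracketing so that the two inner strings, which are to be crossed, are concatenated first. -/
theorem glue_middle (p q s t : List (Lit 𝒜)) :
    ((M.glue p q).hom ⊗ₘ (M.glue s t).hom) ≫ (M.glue (p ++ q) (s ++ t)).hom =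
      (α_ _ _ _).hom ≫ M.str p ◁ (α_ _ _ _).inv ≫ M.str p ◁ (M.glue q s).hom ▷ M.str t ≫
        M.str p ◁ (M.glue (q ++ s) t).hom ≫ (M.glue p ((q ++ s) ++ t)).hom ≫
          eqToHom (congrArg M.str (by simp)) := by
  have h : M.str q ◁ (M.glue s t).hom ≫ (M.glue q (s ++ t)).hom = (α_ _ _ _).inv ≫
      (M.glue q s).hom ▷ M.str t ≫ (M.glue (q ++ s) t).hom ≫
        eqToHom (congrArg M.str (List.append_assoc q s t)) := by
    rw [reassoc_of% M.glue_assoc q s t]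
    simp
  have h' := congrArg (M.str p ◁ ·) h
  simp only [MonoidalCategory.whiskerLeft_comp] at h'
  rw [MonoidalCategory.tensorHom_def', Category.assoc, glue_assoc,
    associator_naturality_right_assoc,
    reassoc_of% h', reassoc_of% M.whiskerLeft_eqToHom_glue p (List.append_assoc q s t)]
  simp

theorem flow_middle (p q s t : List (Lit 𝒜)) :
    (((M.glue p q).hom ⊗ₘ (M.glue s t).hom) ≫ (M.glue (p ++ q) (s ++ t)).hom) ≫
        M.flow (Flow.middle p q s t) =
      tensorμ (M.str p) (M.str q) (M.str s) (M.str t) ≫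
        ((M.glue p s).hom ⊗ₘ (M.glue q t).hom) ≫ (M.glue (p ++ s) (q ++ t)).hom := by
  rw [glue_middle, glue_middle, Flow.middle, flow_cast]
  simp only [Category.assoc, eqToHom_trans_assoc, eqToHom_refl, Category.id_comp]
  simp only [flow, flow_crossing, flow_ident, tensorμ, Category.assoc]
  simp

theorem fmIso_middle_aux {A B C E P Q R S PQ RS PR QS T T' : D} {a : A ⟶ P} {b : B ⟶ Q}
    {c : C ⟶ R} {e : E ⟶ S} {g : P ⊗ Q ⟶ PQ} {g' : R ⊗ S ⟶ RS} {k : PQ ⊗ RS ⟶ T}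
    {h : P ⊗ R ⟶ PR} {h' : Q ⊗ S ⟶ QS} {k' : PR ⊗ QS ⟶ T'} {f : T ⟶ T'}
    (H : ((g ⊗ₘ g') ≫ k) ≫ f = tensorμ P Q R S ≫ (h ⊗ₘ h') ≫ k') :
    ((((a ⊗ₘ b) ≫ g) ⊗ₘ ((c ⊗ₘ e) ≫ g')) ≫ k) ≫ f =
      tensorμ A B C E ≫ (((a ⊗ₘ c) ≫ h) ⊗ₘ ((b ⊗ₘ e) ≫ h')) ≫ k' := by
  simp only [← MonoidalCategory.tensorHom_comp_tensorHom, Category.assoc] at H ⊢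
  rw [H, tensorμ_natural_assoc]

theorem fmIso_middle (o o₁ o₂ o' o₁' o₂' : Conn) (A B C E : Fm 𝒜) :
    (M.fmIso (.bin o (.bin o₁ A B) (.bin o₂ C E))).hom ≫
        M.flow (Flow.middle A.str B.str C.str E.str) =
      tensorμ (M.fm A) (M.fm B) (M.fm C) (M.fm E) ≫
        (M.fmIso (.bin o' (.bin o₁' A C) (.bin o₂' B E))).hom :=
  fmIso_middle_aux (M.flow_middle A.str B.str C.str E.str)

theorem flow_rule {A B : Fm 𝒜} (r : Rule A B) :
    (M.fmIso A).hom ≫ M.flow r.flow = M.rule r ≫ (M.fmIso B).hom := by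
  cases r with
  | eqv e => exact M.flow_eqn e
  | eqvSymm e => exact M.flow_eqnSymm e
  | aiDown a =>
    have h : 𝟙 (𝟙_ D) ≫ M.cap a ≫ M.lit (.pos a) ◁ (ρ_ (M.lit (.neg a))).inv =
        M.cap a ≫ ((ρ_ (M.lit (.pos a))).inv ⊗ₘ (ρ_ (M.lit (.neg a))).inv) ≫
          (α_ _ _ _).hom ≫ M.lit (.pos a) ◁ (λ_ _).hom := by
      simp [MonoidalCategory.tensorHom_def]
    exact h
  | aiUp a =>
    have h : (((ρ_ (M.lit (.pos a))).inv ⊗ₘ (ρ_ (M.lit (.neg a))).inv) ≫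
          (α_ _ _ _).hom ≫ M.lit (.pos a) ◁ (λ_ _).hom) ≫
        M.lit (.pos a) ◁ (ρ_ (M.lit (.neg a))).hom ≫ M.cup a = M.cup a ≫ 𝟙 (𝟙_ D) := by
      simp [MonoidalCategory.tensorHom_def]
    exact h
  | switch A B C =>
    rw [rule, Iso.eq_inv_comp]
    refine Eq.trans (congrArg (_ ≫ _ ≫ ·)
      (M.flow_ident_cast rfl (List.append_assoc A.str B.str C.str).symm)) ?_
    refine (Category.assoc _ _ _).symm.trans ((congrArg (· ≫ _)
      (M.fmIso_assoc .par .tens _ _ A B C)).symm.trans ?_)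
    refine (Category.assoc _ _ _).trans ?_
    refine (congrArg (_ ≫ ·) (eqToHom_trans _ _)).trans (Category.comp_id _)
  | qDown A B C E => exact M.fmIso_middle _ _ _ _ _ _ A B C E
  | qUp A B C E => exact M.fmIso_middle _ _ _ _ _ _ A B C E

/-- A flow forgets brackets, units and connectives, and `fmIso` restores them; hence the
interpretation of a derivation depends on its flow alone. -/
theorem flow_der {A B : Fm 𝒜} (Φ : Der A B) :
    (M.fmIso A).hom ≫ M.flow Φ.flow = M.der Φ ≫ (M.fmIso B).hom := by
  induction Φ with
  | id A => simp [Der.flow, flow_ident, der]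
  | @hor o A B A' B' Φ Ψ ihΦ ihΨ =>
    have h : (((M.fmIso A).hom ⊗ₘ (M.fmIso A').hom) ≫ (M.glue A.str A'.str).hom) ≫
        (M.glue A.str A'.str).inv ≫ (M.flow Φ.flow ⊗ₘ M.flow Ψ.flow) ≫
          (M.glue B.str B'.str).hom =
        (M.der Φ ⊗ₘ M.der Ψ) ≫ ((M.fmIso B).hom ⊗ₘ (M.fmIso B').hom) ≫
          (M.glue B.str B'.str).hom := by
      simp only [Category.assoc, Iso.hom_inv_id_assoc,
        MonoidalCategory.tensorHom_comp_tensorHom_assoc, ihΦ, ihΨ]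
    exact h
  | step Φ r Ψ ihΦ ihΨ =>
    simp only [Der.flow, flow, der, Category.assoc, ← ihΨ]
    rw [← reassoc_of% M.flow_rule r, ← reassoc_of% ihΦ]

/-- Derivations with the same flow have the same interpretation. -/
theorem der_eq_of_flowEq {A B : Fm 𝒜} {Φ Ψ : Der A B} (h : FlowEq Φ.flow Ψ.flow) :
    M.der Φ = M.der Ψ := by
  rw [← cancel_mono (M.fmIso B).hom, ← flow_der, ← flow_der, M.flow_congr h]

end LitModel

namespace LitModel

set_option linter.unusedSectionVars false

variable {𝒜 : Type u} {D : Type u₂} [Category.{v₂} D] [MonoidalCategory D] [SymmetricCategory D]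
  (M : LitModel 𝒜 D)

/-! #### Cut elimination -/

theorem der_comp {A B C : Fm 𝒜} (Φ : Der A B) (Ψ : Der B C) :
    M.der (Φ.comp Ψ) = M.der Φ ≫ M.der Ψ := by
  fun_induction Der.comp Φ Ψ with
  | case1 => simp [der]
  | case2 _ _ _ _ _ _ _ _ _ ih => simp [der, ih]
  | case3 => simp [der]
  | case4 _ _ _ _ _ _ _ _ _ _ _ ih₁ ih₂ => simp [der, ih₁, ih₂]
  | case5 => simp_all [der]

theorem der_same {A B : Fm 𝒜} {Φ Ψ : Der A B} (h : Der.Same Φ Ψ) : M.der Φ = M.der Ψ := by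
  induction h with
  | refl => rfl
  | symm _ ih => exact ih.symm
  | trans _ _ ih ih' => exact ih.trans ih'
  | hor o _ _ ih ih' => simp only [der, ih, ih']
  | step r _ _ ih ih' => simp only [der, ih, ih']
  | step_assoc => simp [der]
  | hor_id => simp [der]

theorem der_rule {A B : Fm 𝒜} (r : Rule A B) : M.der (Der.rule r) = M.rule r := by
  simp [Der.rule, der]

theorem der_eqn {A B : Fm 𝒜} (e : Eqn A B) : M.der (Der.eqn e) = (M.eqn e).hom :=
  M.der_rule _

theorem der_eqnSymm {A B : Fm 𝒜} (e : Eqn A B) : M.der (Der.eqnSymm e) = (M.eqn e).inv :=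
  M.der_rule _

theorem der_id (A : Fm 𝒜) : M.der (Der.id A) = 𝟙 _ := rfl

theorem der_hor (o : Conn) {A B A' B' : Fm 𝒜} (Φ : Der A B) (Ψ : Der A' B') :
    M.der (Der.hor o Φ Ψ) = M.der Φ ⊗ₘ M.der Ψ := rfl

/-- Two switches with commutativities exchange the middle factors, exactly as `q↓` does. From here
on, splittings of tensors and of seqs have the same form in `D`. -/
theorem der_switches (A K B L : Fm 𝒜) :
    M.der (Der.switches A K B L) = tensorμ (M.fm A) (M.fm K) (M.fm B) (M.fm L) := by
  simp only [Der.switches, der_comp, der_rule, der_eqn, der_hor, der_id, rule, eqn]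
  exact Coherent.eq (((Word.leaf 0 (M.fm A)).tensor (.leaf 1 (M.fm K))).tensor
    ((Word.leaf 2 (M.fm B)).tensor (.leaf 3 (M.fm L)))) (by simp [Word.labels]) rfl

theorem der_tensProof {A K B L : Fm 𝒜} (Φ : Der Fm.unit (A.bin .par K))
    (Ψ : Der Fm.unit (B.bin .par L)) :
    M.der (Der.tensProof Φ Ψ) = (ρ_ (𝟙_ D)).inv ≫ (M.der Φ ⊗ₘ M.der Ψ) ≫
      tensorμ (M.fm A) (M.fm K) (M.fm B) (M.fm L) := by
  simp only [Der.tensProof, der_comp, der_eqnSymm, der_hor, der_switches, eqn]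

theorem der_seqProof {A K B L : Fm 𝒜} (Φ : Der Fm.unit (A.bin .par K))
    (Ψ : Der Fm.unit (B.bin .par L)) :
    M.der (Der.seqProof Φ Ψ) = (ρ_ (𝟙_ D)).inv ≫ (M.der Φ ⊗ₘ M.der Ψ) ≫
      tensorμ (M.fm A) (M.fm K) (M.fm B) (M.fm L) := by
  simp only [Der.seqProof, der_comp, der_eqnSymm, der_hor, der_rule, rule, eqn]

/-- The interpretation of `C[f]`. -/
def plug : (X : Ctx 𝒜) → {A B : Fm 𝒜} → (M.fm A ⟶ M.fm B) → (M.fm (X.fill A) ⟶ M.fm (X.fill B))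
  | .hole, _, _, f => f
  | .left _ X B, _, _, f => plug X f ▷ M.fm B
  | .right _ B X, _, _, f => M.fm B ◁ plug X f

theorem der_plug (X : Ctx 𝒜) {A B : Fm 𝒜} (Φ : Der A B) :
    M.der (X.plug Φ) = M.plug X (M.der Φ) := by
  induction X with
  | hole => rfl
  | left o X E ih =>
    exact (congrArg (· ⊗ₘ 𝟙 _) ih).trans (tensorHom_id _ _)
  | right o E X ih =>
    exact (congrArg (𝟙 _ ⊗ₘ ·) ih).trans (id_tensorHom _ _)

theorem der_tensLeft {F B K L P : Fm 𝒜} (Ψ : Der Fm.unit (B.bin .par L))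
    (Ω : Der (K.bin .par L) P) :
    M.der ((Der.eqnSymm (.tensUnit (F.bin .par K))).comp <|
      (Der.hor .tens (Der.id (F.bin .par K)) Ψ).comp <|
        (Der.switches F K B L).comp <| Der.hor .par (Der.id (F.bin .tens B)) Ω) =
      (ρ_ _).inv ≫ _ ◁ M.der Ψ ≫ tensorμ (M.fm F) (M.fm K) (M.fm B) (M.fm L) ≫ _ ◁ M.der Ω := by
  simp only [der_comp, der_eqnSymm, der_hor, der_id, der_switches, eqn, id_tensorHom]

theorem der_tensRight {F B K L P : Fm 𝒜} (Ψ : Der Fm.unit (B.bin .par K))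
    (Ω : Der (K.bin .par L) P) :
    M.der ((Der.eqnSymm (.tensUnit (F.bin .par L))).comp <|
      (Der.eqn (.tensComm (F.bin .par L) Fm.unit)).comp <|
        (Der.hor .tens Ψ (Der.id (F.bin .par L))).comp <|
          (Der.switches B K F L).comp <| Der.hor .par (Der.id (B.bin .tens F)) Ω) =
      (λ_ _).inv ≫ M.der Ψ ▷ _ ≫ tensorμ (M.fm B) (M.fm K) (M.fm F) (M.fm L) ≫ _ ◁ M.der Ω := by
  simp only [der_comp, der_eqnSymm, der_eqn, der_hor, der_id, der_switches, eqn, id_tensorHom,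
    tensorHom_id]
  rw [braiding_tensorUnit_right, Category.assoc, Iso.inv_hom_id_assoc]

theorem der_seqLeft {F B K L P : Fm 𝒜} (Ψ : Der Fm.unit (B.bin .par L))
    (Ω : Der (K.bin .seq L) P) :
    M.der ((Der.eqnSymm (.seqUnitRight (F.bin .par K))).comp <|
      (Der.hor .seq (Der.id (F.bin .par K)) Ψ).comp <|
        (Der.rule (.qDown F K B L)).comp <| Der.hor .par (Der.id (F.bin .seq B)) Ω) =
      (ρ_ _).inv ≫ _ ◁ M.der Ψ ≫ tensorμ (M.fm F) (M.fm K) (M.fm B) (M.fm L) ≫ _ ◁ M.der Ω := by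
  simp only [der_comp, der_eqnSymm, der_hor, der_id, der_rule, rule, eqn, id_tensorHom]

theorem der_seqRight {F B K L P : Fm 𝒜} (Ψ : Der Fm.unit (B.bin .par K))
    (Ω : Der (K.bin .seq L) P) :
    M.der ((Der.eqnSymm (.seqUnitLeft (F.bin .par L))).comp <|
      (Der.hor .seq Ψ (Der.id (F.bin .par L))).comp <|
        (Der.rule (.qDown B K F L)).comp <| Der.hor .par (Der.id (B.bin .seq F)) Ω) =
      (λ_ _).inv ≫ M.der Ψ ▷ _ ≫ tensorμ (M.fm B) (M.fm K) (M.fm F) (M.fm L) ≫ _ ◁ M.der Ω := by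
  simp only [der_comp, der_eqnSymm, der_hor, der_id, der_rule, rule, eqn, id_tensorHom,
    tensorHom_id]

theorem der_parLeft (F B P : Fm 𝒜) :
    M.der (Der.eqnSymm (.parAssoc F B P)) = (α_ (M.fm F) (M.fm B) (M.fm P)).inv :=
  M.der_eqnSymm _

theorem der_parRight (F B P : Fm 𝒜) :
    M.der ((Der.eqnSymm (.parAssoc F B P)).comp <|
      Der.hor .par (Der.eqn (.parComm F B)) (Der.id P)) =
      (α_ (M.fm F) (M.fm B) (M.fm P)).inv ≫ (β_ (M.fm F) (M.fm B)).hom ▷ M.fm P := by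
  simp only [der_comp, der_eqnSymm, der_eqn, der_hor, der_id, eqn, tensorHom_id]

/-- One level of the recursion on contexts: `θ` comes from the inner context, and `u` is the piece
appended to it. -/
theorem naturality_step {Q Q' R R' T T' : D} {θ : Q ⟶ R} {θ' : Q' ⟶ R'} {u : R ⟶ T}
    {u' : R' ⟶ T'} {f : Q ⟶ Q'} {g : R ⟶ R'} {h : T ⟶ T'} {s : Q ⟶ T} {s' : Q' ⟶ T'}
    (hs : s = θ ≫ u) (hs' : s' = θ' ≫ u') (ih : θ ≫ g = f ≫ θ') (hu : u ≫ h = g ≫ u') :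
    s ≫ h = f ≫ s' := by
  rw [hs, hs', Category.assoc, hu, reassoc_of% ih]

theorem whiskerRight_left_comp {F F' B K L P : D} (g : F ⟶ F') (b : 𝟙_ D ⟶ B ⊗ L) (k : K ⊗ L ⟶ P) :
    ((ρ_ _).inv ≫ _ ◁ b ≫ tensorμ F K B L ≫ _ ◁ k) ≫ (g ▷ B) ▷ P =
      g ▷ K ≫ (ρ_ _).inv ≫ _ ◁ b ≫ tensorμ F' K B L ≫ _ ◁ k := by
  have h := tensorμ_natural g (𝟙 K) (𝟙 B) (𝟙 L)
  simp only [tensorHom_id, id_whiskerRight] at h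
  simp only [Category.assoc, whisker_exchange]
  rw [← reassoc_of% h, whisker_exchange_assoc, ← rightUnitor_inv_naturality_assoc]

theorem whiskerRight_right_comp {F F' B K L P : D} (g : F ⟶ F') (b : 𝟙_ D ⟶ B ⊗ K)
    (k : K ⊗ L ⟶ P) :
    ((λ_ _).inv ≫ b ▷ _ ≫ tensorμ B K F L ≫ _ ◁ k) ≫ (B ◁ g) ▷ P =
      g ▷ L ≫ (λ_ _).inv ≫ b ▷ _ ≫ tensorμ B K F' L ≫ _ ◁ k := by
  have h := tensorμ_natural (𝟙 B) (𝟙 K) g (𝟙 L)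
  simp only [tensorHom_id, id_tensorHom, id_whiskerRight] at h
  simp only [Category.assoc, whisker_exchange]
  rw [← reassoc_of% h, ← whisker_exchange_assoc, ← leftUnitor_inv_naturality_assoc]

theorem whiskerRight_comm_comp {F F' : D} (B P : D) (g : F ⟶ F') :
    ((α_ F B P).inv ≫ (β_ F B).hom ▷ P) ≫ (B ◁ g) ▷ P =
      g ▷ (B ⊗ P) ≫ (α_ F' B P).inv ≫ (β_ F' B).hom ▷ P := by
  rw [Category.assoc, ← comp_whiskerRight, ← BraidedCategory.braiding_naturality_left,
    comp_whiskerRight, associator_inv_naturality_left_assoc]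

/-- The pieces appended at each level use fixed splitting data and touch the hole only through
structural morphisms, which are natural. Here `f` may be any morphism of `D`. -/
theorem ctxReduction_natural {A : Fm 𝒜} {X : Ctx 𝒜} {P K : Fm 𝒜}
    {Φ : Der Fm.unit ((X.fill A).bin .par P)} {Φ₀ : Der Fm.unit (A.bin .par K)}
    {Θ : ∀ Y : Fm 𝒜, Der (Y.bin .par K) ((X.fill Y).bin .par P)}
    (h : CtxReduction X Φ K Φ₀ Θ) {Y Z : Fm 𝒜} (f : M.fm Y ⟶ M.fm Z) :
    M.der (Θ Y) ≫ M.plug X f ▷ M.fm P = f ▷ M.fm K ≫ M.der (Θ Z) := by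
  induction h with
  | hole => exact (Category.id_comp _).trans (Category.comp_id _).symm
  | parLeft =>
    refine naturality_step ((M.der_comp _ _).trans (congrArg (_ ≫ ·) (M.der_parLeft _ _ _)))
      ((M.der_comp _ _).trans (congrArg (_ ≫ ·) (M.der_parLeft _ _ _))) (by assumption) ?_
    exact (associator_inv_naturality_left _ _ _).symm
  | parRight =>
    refine naturality_step ((M.der_comp _ _).trans (congrArg (_ ≫ ·) (M.der_parRight _ _ _)))
      ((M.der_comp _ _).trans (congrArg (_ ≫ ·) (M.der_parRight _ _ _))) (by assumption) ?_
    exact whiskerRight_comm_comp _ _ _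
  | tensLeft =>
    refine naturality_step ((M.der_comp _ _).trans (congrArg (_ ≫ ·) (M.der_tensLeft _ _)))
      ((M.der_comp _ _).trans (congrArg (_ ≫ ·) (M.der_tensLeft _ _))) (by assumption) ?_
    exact whiskerRight_left_comp _ _ _
  | tensRight =>
    refine naturality_step ((M.der_comp _ _).trans (congrArg (_ ≫ ·) (M.der_tensRight _ _)))
      ((M.der_comp _ _).trans (congrArg (_ ≫ ·) (M.der_tensRight _ _))) (by assumption) ?_
    exact whiskerRight_right_comp _ _ _
  | seqLeft =>
    refine naturality_step ((M.der_comp _ _).trans (congrArg (_ ≫ ·) (M.der_seqLeft _ _)))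
      ((M.der_comp _ _).trans (congrArg (_ ≫ ·) (M.der_seqLeft _ _))) (by assumption) ?_
    exact whiskerRight_left_comp _ _ _
  | seqRight =>
    refine naturality_step ((M.der_comp _ _).trans (congrArg (_ ≫ ·) (M.der_seqRight _ _)))
      ((M.der_comp _ _).trans (congrArg (_ ≫ ·) (M.der_seqRight _ _))) (by assumption) ?_
    exact whiskerRight_right_comp _ _ _

theorem reduction_step {I Q R T : D} {φ₀ : I ⟶ Q} {θ : Q ⟶ R} {u : R ⟶ T} {s : Q ⟶ T}
    {φ : I ⟶ T} {φ₁ : I ⟶ R} (hs : s = θ ≫ u) (ih : φ₁ = φ₀ ≫ θ) (h : φ = φ₁ ≫ u) :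
    φ = φ₀ ≫ s := by
  rw [h, ih, hs, Category.assoc]

/-- Two proofs side by side are put in sequence, first `a` and then `b` next to its result, by
naturality of the unitor. The remainder is what context reduction appends to `Θ`. -/
theorem split_left {F B K L P : D} (a : 𝟙_ D ⟶ F ⊗ K) (b : 𝟙_ D ⟶ B ⊗ L) (k : K ⊗ L ⟶ P) :
    ((ρ_ (𝟙_ D)).inv ≫ (a ⊗ₘ b) ≫ tensorμ F K B L) ≫ (𝟙 (F ⊗ B) ⊗ₘ k) =
      a ≫ (ρ_ _).inv ≫ _ ◁ b ≫ tensorμ F K B L ≫ _ ◁ k := by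
  simp only [MonoidalCategory.tensorHom_def, Category.assoc, id_whiskerRight, Category.id_comp]
  rw [rightUnitor_inv_naturality_assoc]

theorem split_right {F B K L P : D} (b : 𝟙_ D ⟶ B ⊗ K) (a : 𝟙_ D ⟶ F ⊗ L) (k : K ⊗ L ⟶ P) :
    ((ρ_ (𝟙_ D)).inv ≫ (b ⊗ₘ a) ≫ tensorμ B K F L) ≫ (𝟙 (B ⊗ F) ⊗ₘ k) =
      a ≫ (λ_ _).inv ≫ b ▷ _ ≫ tensorμ B K F L ≫ _ ◁ k := by
  simp only [MonoidalCategory.tensorHom_def' b, Category.assoc, id_tensorHom]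
  rw [leftUnitor_inv_naturality_assoc, unitors_inv_equal]

theorem comm_whiskerRight_cancel {F B P Q : D} (f : Q ⟶ (B ⊗ F) ⊗ P) :
    (f ≫ ((β_ B F).hom ⊗ₘ 𝟙 P) ≫ (α_ F B P).hom) ≫ (α_ F B P).inv ≫ (β_ F B).hom ▷ P = f := by
  simp only [Category.assoc, Iso.hom_inv_id_assoc, tensorHom_id, ← comp_whiskerRight,
    SymmetricCategory.symmetry, id_whiskerRight, Category.comp_id]

theorem der_tensSplitting {A B K : Fm 𝒜} {Φ : Der Fm.unit ((A.bin .tens B).bin .par K)}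
    (S : TensSplitting Φ) :
    M.der Φ = ((ρ_ (𝟙_ D)).inv ≫ (M.der S.ofA ⊗ₘ M.der S.ofB) ≫
      tensorμ (M.fm A) (M.fm S.KA) (M.fm B) (M.fm S.KB)) ≫
        (𝟙 (M.fm A ⊗ M.fm B) ⊗ₘ M.der S.ofK) := by
  rw [← M.der_eq_of_flowEq S.flow_eq]
  simp only [der_comp, der_hor, der_id, der_tensProof]

theorem der_seqSplitting {A B K : Fm 𝒜} {Φ : Der Fm.unit ((A.bin .seq B).bin .par K)}
    (S : SeqSplitting Φ) :
    M.der Φ = ((ρ_ (𝟙_ D)).inv ≫ (M.der S.ofA ⊗ₘ M.der S.ofB) ≫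
      tensorμ (M.fm A) (M.fm S.KA) (M.fm B) (M.fm S.KB)) ≫
        (𝟙 (M.fm A ⊗ M.fm B) ⊗ₘ M.der S.ofK) := by
  rw [← M.der_eq_of_flowEq S.flow_eq]
  simp only [der_comp, der_hor, der_id, der_seqProof]

/-- Each splitting interprets as the proof that it splits, so putting the original formula back into
the hole recovers the original proof. This is where the condition on flows in splittings is needed.
-/
theorem ctxReduction_der {A : Fm 𝒜} {X : Ctx 𝒜} {P K : Fm 𝒜}
    {Φ : Der Fm.unit ((X.fill A).bin .par P)} {Φ₀ : Der Fm.unit (A.bin .par K)}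
    {Θ : ∀ Y : Fm 𝒜, Der (Y.bin .par K) ((X.fill Y).bin .par P)}
    (h : CtxReduction X Φ K Φ₀ Θ) : M.der Φ = M.der Φ₀ ≫ M.der (Θ A) := by
  induction h with
  | hole => exact (Category.comp_id _).symm
  | parLeft Φ =>
    refine reduction_step ((M.der_comp _ _).trans (congrArg (_ ≫ ·) (M.der_parLeft _ _ _)))
      (by assumption) ?_
    exact (Iso.comp_inv_eq _ |>.2 ((M.der_comp _ _).trans
      (congrArg (_ ≫ ·) (M.der_eqn (.parAssoc _ _ _))))).symm
  | parRight Φ =>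
    refine reduction_step ((M.der_comp _ _).trans (congrArg (_ ≫ ·) (M.der_parRight _ _ _)))
      (by assumption) ?_
    refine Eq.trans ?_ (congrArg (· ≫ _) (M.der_comp Φ _)).symm
    simp only [der_comp, der_eqn, eqn, der_hor, der_id]
    exact (comm_whiskerRight_cancel _).symm
  | tensLeft Φ S =>
    exact reduction_step ((M.der_comp _ _).trans (congrArg (_ ≫ ·) (M.der_tensLeft _ _)))
      (by assumption) ((M.der_tensSplitting S).trans (split_left _ _ _))
  | tensRight Φ S =>
    exact reduction_step ((M.der_comp _ _).trans (congrArg (_ ≫ ·) (M.der_tensRight _ _)))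
      (by assumption) ((M.der_tensSplitting S).trans (split_right _ _ _))
  | seqLeft Φ S =>
    exact reduction_step ((M.der_comp _ _).trans (congrArg (_ ≫ ·) (M.der_seqLeft _ _)))
      (by assumption) ((M.der_seqSplitting S).trans (split_left _ _ _))
  | seqRight Φ S =>
    exact reduction_step ((M.der_comp _ _).trans (congrArg (_ ≫ ·) (M.der_seqRight _ _)))
      (by assumption) ((M.der_seqSplitting S).trans (split_right _ _ _))

/-- Context reduction turns a morphism in a context into a morphism at the root. -/
theorem ctxReductionOf_der {A : Fm 𝒜} {X : Ctx 𝒜} {Φ : Der Fm.unit (X.fill A)} {K : Fm 𝒜}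
    {Φ₀ : Der Fm.unit (A.bin .par K)} {Θ : ∀ Y : Fm 𝒜, Der (Y.bin .par K) (X.fill Y)}
    (h : CtxReductionOf X Φ K Φ₀ Θ) {B : Fm 𝒜} (f : M.fm A ⟶ M.fm B) :
    M.der Φ ≫ M.plug X f = M.der Φ₀ ≫ f ▷ M.fm K ≫ M.der (Θ B) := by
  obtain ⟨h⟩ := h
  have h₁ := M.ctxReduction_der h
  have h₂ := M.ctxReduction_natural h f
  simp only [der_comp, der_eqn, der_eqnSymm, eqn] at h₁ ⊢
  rw [← reassoc_of% h₂, ← reassoc_of% h₁]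
  simp

/-- Naturality of `tensorμ` brings each side to the form: the four proofs, a permutation of eight
factors, then `l`, `r` and `k` on the primed half. The two permutations agree by `tensorμ_tensorμ`.
-/
theorem qUp_reduction {A B C E A' B' C' E' K L K' : D} (a : 𝟙_ D ⟶ A ⊗ A') (b : 𝟙_ D ⟶ B ⊗ B')
    (c : 𝟙_ D ⟶ C ⊗ C') (e : 𝟙_ D ⟶ E ⊗ E') (l : A' ⊗ B' ⟶ K) (r : C' ⊗ E' ⟶ L)
    (k : K ⊗ L ⟶ K') :
    (((ρ_ (𝟙_ D)).inv ≫ ((((ρ_ (𝟙_ D)).inv ≫ (a ⊗ₘ b) ≫ tensorμ A A' B B') ≫ (𝟙 (A ⊗ B) ⊗ₘ l)) ⊗ₘ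
        (((ρ_ (𝟙_ D)).inv ≫ (c ⊗ₘ e) ≫ tensorμ C C' E E') ≫ (𝟙 (C ⊗ E) ⊗ₘ r))) ≫
        tensorμ (A ⊗ B) K (C ⊗ E) L) ≫ (𝟙 ((A ⊗ B) ⊗ (C ⊗ E)) ⊗ₘ k)) ≫ tensorμ A B C E ▷ K' =
      ((ρ_ (𝟙_ D)).inv ≫ (((ρ_ (𝟙_ D)).inv ≫ (a ⊗ₘ c) ≫ tensorμ A A' C C') ⊗ₘ
        ((ρ_ (𝟙_ D)).inv ≫ (b ⊗ₘ e) ≫ tensorμ B B' E E')) ≫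
        tensorμ (A ⊗ C) (A' ⊗ C') (B ⊗ E) (B' ⊗ E')) ≫
          (𝟙 ((A ⊗ C) ⊗ (B ⊗ E)) ⊗ₘ (tensorμ A' C' B' E' ≫ (l ⊗ₘ r) ≫ k)) := by
  -- The two sides list the four proofs in different orders; as their premises are units, reordering
  -- them costs nothing.
  have h₁ : ((ρ_ (𝟙_ D)).inv ⊗ₘ (ρ_ (𝟙_ D)).inv) ≫ tensorμ (𝟙_ D) (𝟙_ D) (𝟙_ D) (𝟙_ D) =
      ((ρ_ (𝟙_ D)).inv ⊗ₘ (ρ_ (𝟙_ D)).inv) :=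
    Coherent.eq (Word.unit.tensor Word.unit) (by simp [Word.labels]) rfl
  have h₂ := tensorμ_natural a b c e
  have h₃ := tensorμ_natural (𝟙 (A ⊗ B)) l (𝟙 (C ⊗ E)) r
  have h₄ := tensorμ_tensorμ A B C E A' B' C' E'
  simp only [← tensorHom_id, ← id_tensorHom] at h₄
  have h₅ : (𝟙 ((A ⊗ B) ⊗ (C ⊗ E)) ⊗ₘ k) ≫ (tensorμ A B C E ⊗ₘ 𝟙 K') =
      (tensorμ A B C E ⊗ₘ 𝟙 (K ⊗ L)) ≫ (𝟙 _ ⊗ₘ k) := by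
    simp only [MonoidalCategory.tensorHom_comp_tensorHom, Category.id_comp, Category.comp_id]
  have h₆ : ((𝟙 (A ⊗ B) ⊗ₘ 𝟙 (C ⊗ E)) ⊗ₘ (l ⊗ₘ r)) ≫ (tensorμ A B C E ⊗ₘ 𝟙 (K ⊗ L)) =
      (tensorμ A B C E ⊗ₘ 𝟙 _) ≫ (𝟙 _ ⊗ₘ (l ⊗ₘ r)) := by
    simp only [MonoidalCategory.tensorHom_comp_tensorHom, Category.id_comp, Category.comp_id,
      MonoidalCategory.id_tensorHom_id]
  have h₇ (P Q R : D) (x : 𝟙_ D ⊗ 𝟙_ D ⟶ P) (y : P ⟶ Q) (z : Q ⟶ R) (P' Q' R' : D)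
      (x' : 𝟙_ D ⊗ 𝟙_ D ⟶ P') (y' : P' ⟶ Q') (z' : Q' ⟶ R') :
      (((ρ_ (𝟙_ D)).inv ≫ x ≫ y) ≫ z ⊗ₘ ((ρ_ (𝟙_ D)).inv ≫ x' ≫ y') ≫ z') =
        ((ρ_ (𝟙_ D)).inv ⊗ₘ (ρ_ (𝟙_ D)).inv) ≫ (x ⊗ₘ x') ≫ (y ⊗ₘ y') ≫ (z ⊗ₘ z') := by
    simp only [MonoidalCategory.tensorHom_comp_tensorHom, Category.assoc]
  have h₈ (P Q : D) (x : 𝟙_ D ⊗ 𝟙_ D ⟶ P) (y : P ⟶ Q) (P' Q' : D)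
      (x' : 𝟙_ D ⊗ 𝟙_ D ⟶ P') (y' : P' ⟶ Q') :
      ((ρ_ (𝟙_ D)).inv ≫ x ≫ y ⊗ₘ (ρ_ (𝟙_ D)).inv ≫ x' ≫ y') =
        ((ρ_ (𝟙_ D)).inv ⊗ₘ (ρ_ (𝟙_ D)).inv) ≫ (x ⊗ₘ x') ≫ (y ⊗ₘ y') := by
    simp only [MonoidalCategory.tensorHom_comp_tensorHom]
  rw [h₇, h₈]
  simp only [← tensorHom_id, Category.assoc, h₅, reassoc_of% h₃, reassoc_of% h₆]
  rw [reassoc_of% h₄, reassoc_of% h₂, reassoc_of% h₁]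
  simp only [MonoidalCategory.tensorHom_comp_tensorHom, Category.id_comp]

theorem der_qUpReduct {A B C E K : Fm 𝒜}
    {Φ₀ : Der Fm.unit (((A.bin .seq B).bin .tens (C.bin .seq E)).bin .par K)}
    (S : TensSplitting Φ₀) (L : SeqSplitting S.ofA) (R : SeqSplitting S.ofB) :
    M.der Φ₀ ≫ tensorμ (M.fm A) (M.fm B) (M.fm C) (M.fm E) ▷ M.fm K =
      M.der (qUpReduct S L R) := by
  rw [M.der_tensSplitting S, M.der_seqSplitting L, M.der_seqSplitting R]
  simp only [qUpReduct, der_comp, der_rule, der_hor, der_id, der_tensProof, der_seqProof, rule]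
  exact qUp_reduction _ _ _ _ _ _ _

/-- The cup joins the `X` of the first cap to the `Y` of the second. What is left, the `Y` of the
first cap and the `X` of the second, lies on one zigzag wire; `snake` straightens it into a single
cap, under which `l` and `r` are placed. -/
theorem aiUp_reduction {X Y K L P : D} (cap : 𝟙_ D ⟶ X ⊗ Y) (cup : X ⊗ Y ⟶ 𝟙_ D)
    (snake : (λ_ Y).inv ≫ cap ▷ Y ≫ (α_ X Y Y).hom ≫ X ◁ (β_ Y Y).hom ≫ (α_ X Y Y).inv ≫
      cup ▷ Y ≫ (λ_ Y).hom = 𝟙 Y) (l : Y ⟶ K) (r : X ⟶ L) (k : K ⊗ L ⟶ P) :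
    (((ρ_ (𝟙_ D)).inv ≫ ((cap ≫ (𝟙 X ⊗ₘ l)) ⊗ₘ ((cap ≫ (β_ X Y).hom) ≫ (𝟙 Y ⊗ₘ r))) ≫
        tensorμ X K Y L) ≫ (𝟙 (X ⊗ Y) ⊗ₘ k)) ≫ cup ▷ P =
      (cap ≫ (β_ X Y).hom) ≫ (l ⊗ₘ r) ≫ k ≫ (ρ_ P).inv ≫ (β_ P (𝟙_ D)).hom := by
  have h₃ := tensorμ_natural (𝟙 X) l (𝟙 Y) r
  have h₅ : (𝟙 (X ⊗ Y) ⊗ₘ k) ≫ (cup ⊗ₘ 𝟙 P) = (cup ⊗ₘ 𝟙 (K ⊗ L)) ≫ (𝟙 _ ⊗ₘ k) := by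
    simp only [MonoidalCategory.tensorHom_comp_tensorHom, Category.id_comp, Category.comp_id]
  have h₆ : ((𝟙 X ⊗ₘ 𝟙 Y) ⊗ₘ (l ⊗ₘ r)) ≫ (cup ⊗ₘ 𝟙 (K ⊗ L)) =
      (cup ⊗ₘ 𝟙 _) ≫ (𝟙 _ ⊗ₘ (l ⊗ₘ r)) := by
    simp only [MonoidalCategory.tensorHom_comp_tensorHom, Category.id_comp, Category.comp_id,
      MonoidalCategory.id_tensorHom_id]
  have h : (ρ_ (𝟙_ D)).inv ≫ (cap ⊗ₘ (cap ≫ (β_ X Y).hom)) ≫ tensorμ X Y Y X ≫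
      (cup ⊗ₘ 𝟙 (Y ⊗ X)) = cap ≫ (β_ X Y).hom ≫ (λ_ (Y ⊗ X)).inv := by
    -- The two copies of `Y` are exchanged, so they carry different labels.
    have e₁ : tensorμ X Y Y X = (α_ (X ⊗ Y) Y X).inv ≫ ((α_ X Y Y).hom ≫ X ◁ (β_ Y Y).hom ≫
        (α_ X Y Y).inv) ▷ X ≫ (α_ (X ⊗ Y) Y X).hom :=
      Coherent.eq (((Word.leaf 0 X).tensor (.leaf 1 Y)).tensor ((Word.leaf 2 Y).tensor
        (.leaf 3 X))) (by simp [Word.labels]) rfl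
    have e₂ : (ρ_ (𝟙_ D)).inv ≫ (cap ⊗ₘ (cap ≫ (β_ X Y).hom)) = (cap ≫ (β_ X Y).hom) ≫
        (λ_ (Y ⊗ X)).inv ≫ cap ▷ (Y ⊗ X) := by
      rw [MonoidalCategory.tensorHom_def', leftUnitor_inv_naturality_assoc, unitors_inv_equal]
    -- With the second cap drawn on top by `e₂`, the rest is the triangle composite on its `Y`, with
    -- its `X` as a spectator.
    have e₃ : (λ_ (Y ⊗ X)).inv ≫ cap ▷ (Y ⊗ X) ≫ (α_ (X ⊗ Y) Y X).inv ≫ ((α_ X Y Y).hom ≫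
        X ◁ (β_ Y Y).hom ≫ (α_ X Y Y).inv) ▷ X ≫ (α_ (X ⊗ Y) Y X).hom ≫ cup ▷ (Y ⊗ X) =
        ((λ_ Y).inv ≫ cap ▷ Y ≫ (α_ X Y Y).hom ≫ X ◁ (β_ Y Y).hom ≫ (α_ X Y Y).inv ≫
      cup ▷ Y ≫ (λ_ Y).hom) ▷ X ≫ (λ_ (Y ⊗ X)).inv := by
      monoidal
    rw [reassoc_of% e₂, e₁, tensorHom_id]
    simp only [Category.assoc] at e₃ ⊢
    rw [e₃, snake]
    simp
  rw [← MonoidalCategory.tensorHom_comp_tensorHom]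
  simp only [← tensorHom_id, Category.assoc, h₅, reassoc_of% h₃, reassoc_of% h₆]
  rw [reassoc_of% h, braiding_tensorUnit_right, Iso.inv_hom_id_assoc]
  rw [id_tensorHom, id_tensorHom, leftUnitor_inv_naturality k,
    leftUnitor_inv_naturality_assoc (l ⊗ₘ r)]

theorem der_litSplitting_pos {a : 𝒜} {K : Fm 𝒜} {Φ : Der Fm.unit ((Fm.atom a).bin .par K)}
    (S : LitSplitting (l := Lit.pos a) Φ) :
    M.der Φ = M.cap a ≫ (𝟙 (M.lit (.pos a)) ⊗ₘ M.der S.ofK) :=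
  (M.der_eq_of_flowEq S.flow_eq).symm.trans ((M.der_comp _ _).trans
    (congrArg (· ≫ _) (M.der_rule (.aiDown a))))

theorem der_litSplitting_neg {a : 𝒜} {K : Fm 𝒜} {Φ : Der Fm.unit ((Fm.natom a).bin .par K)}
    (S : LitSplitting (l := Lit.neg a) Φ) :
    M.der Φ = (M.cap a ≫ (β_ (M.lit (.pos a)) (M.lit (.neg a))).hom) ≫
      (𝟙 (M.lit (.neg a)) ⊗ₘ M.der S.ofK) :=
  (M.der_eq_of_flowEq S.flow_eq).symm.trans ((M.der_comp _ _).trans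
    (congrArg (· ≫ _) ((M.der_comp _ _).trans (congrArg₂ (· ≫ ·) (M.der_rule (.aiDown a))
      (M.der_eqn (.parComm _ _))))))

theorem der_aiUpReduct {a : 𝒜} {K : Fm 𝒜}
    {Φ₀ : Der Fm.unit (((Fm.atom a).bin .tens (Fm.natom a)).bin .par K)}
    (S : TensSplitting Φ₀) (L : LitSplitting (l := Lit.pos a) S.ofA)
    (R : LitSplitting (l := Lit.neg a) S.ofB) :
    M.der Φ₀ ≫ M.cup a ▷ M.fm K = M.der (aiUpReduct S L R) := by
  rw [M.der_tensSplitting S, M.der_litSplitting_pos L, M.der_litSplitting_neg R]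
  refine (aiUp_reduction (M.cap a) (M.cup a) (M.snake a) (M.der L.ofK) (M.der R.ofK)
    (M.der S.ofK)).trans ?_
  refine Eq.trans ?_ (M.der_comp (Der.axiomProof (Lit.neg a)) ((Der.hor .par L.ofK R.ofK).comp <|
    S.ofK.comp <| (Der.eqnSymm (.parUnit K)).comp <| Der.eqn (.parComm K Fm.unit))).symm
  refine congrArg₂ (· ≫ ·) ?_ ?_
  · exact ((M.der_comp _ _).trans (congrArg₂ (· ≫ ·) (M.der_rule (.aiDown a))
      (M.der_eqn (.parComm _ _)))).symm
  · have h : M.der (S.ofK.comp <| (Der.eqnSymm (.parUnit K)).comp <|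
        Der.eqn (.parComm K Fm.unit)) =
        M.der S.ofK ≫ (ρ_ (M.fm K)).inv ≫ (β_ (M.fm K) (𝟙_ D)).hom := by
      simp only [der_comp, der_eqn, der_eqnSymm, eqn]
    rw [← h]
    exact (M.der_comp (Der.hor .par L.ofK R.ofK) _).symm

/-- `ctxReductionOf_der` transfers the up-rule from the hole to the root, where it is absorbed into
the reduct. -/
theorem der_ceStep {F : Fm 𝒜} {Φ Φ₁ : Der Fm.unit F} (h : CEStep Φ Φ₁) : M.der Φ = M.der Φ₁ := by
  cases h with
  | qUp X Φ' Ψ S L R hΦ' hX h h₁ =>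
    rw [M.der_same h, M.der_same h₁]
    simp only [der_comp, der_plug, der_rule, ← der_qUpReduct, Category.assoc]
    rw [reassoc_of% M.ctxReductionOf_der hX]
    rfl
  | aiUp X Φ' Ψ S L R hΦ' hX h h₁ =>
    rw [M.der_same h, M.der_same h₁]
    simp only [der_comp, der_plug, der_rule, ← der_aiUpReduct, Category.assoc]
    rw [reassoc_of% M.ctxReductionOf_der hX]
    rfl

/-- Cut elimination preserves the interpretation. -/
theorem der_ce {F : Fm 𝒜} {Φ Φ' : Der Fm.unit F} (h : CE Φ Φ') : M.der Φ = M.der Φ' := by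
  obtain ⟨h, -⟩ := h
  induction h with
  | refl => rfl
  | tail _ h ih => exact ih.trans (M.der_ceStep h)

end LitModel

/-! ### Pairings and adjoint morphisms -/

section Pairings

set_option linter.unusedSectionVars false

variable {D : Type u₂} [Category.{v₂} D] [MonoidalCategory D] [SymmetricCategory D]

/-- Nondegenerate pairings. -/
structure Nondegenerate {Y X : D} (E : Y ⊗ X ⟶ 𝟙_ D) : Prop where
  left {Z : D} {f g : Z ⟶ Y} : f ▷ X ≫ E = g ▷ X ≫ E → f = g
  right {Z : D} {f g : Z ⟶ X} : Y ◁ f ≫ E = Y ◁ g ≫ E → f = g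

/-- The product of two pairings. -/
def prodPairing {Y X Y' X' : D} (E : Y ⊗ X ⟶ 𝟙_ D) (E' : Y' ⊗ X' ⟶ 𝟙_ D) :
    (Y ⊗ Y') ⊗ (X ⊗ X') ⟶ 𝟙_ D :=
  tensorμ Y Y' X X' ≫ (E ⊗ₘ E') ≫ (λ_ (𝟙_ D)).hom

/-- The morphisms `f` and `f'` are adjoint with respect to two pairings. -/
def Adj {Y X Y' X' : D} (E : Y ⊗ X ⟶ 𝟙_ D) (E' : Y' ⊗ X' ⟶ 𝟙_ D) (f : X ⟶ X') (f' : Y' ⟶ Y) :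
    Prop :=
  Y' ◁ f ≫ E' = f' ▷ X ≫ E

variable {Y X Y' X' Y'' X'' : D} {E : Y ⊗ X ⟶ 𝟙_ D} {E' : Y' ⊗ X' ⟶ 𝟙_ D}
  {E'' : Y'' ⊗ X'' ⟶ 𝟙_ D}

theorem Nondegenerate.flip (h : Nondegenerate E) : Nondegenerate ((β_ X Y).hom ≫ E) where
  left e := h.right (by simpa using (cancel_epi (β_ _ _).inv).2 e)
  right e := h.left (by simpa using (cancel_epi (β_ _ _).inv).2 e)

theorem Adj.id (E : Y ⊗ X ⟶ 𝟙_ D) : Adj E E (𝟙 X) (𝟙 Y) := by simp [Adj]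

theorem Adj.comp {f : X ⟶ X'} {f' : Y' ⟶ Y} {g : X' ⟶ X''} {g' : Y'' ⟶ Y'} (h : Adj E E' f f')
    (h' : Adj E' E'' g g') : Adj E E'' (f ≫ g) (g' ≫ f') := by
  unfold Adj at *
  rw [MonoidalCategory.whiskerLeft_comp, Category.assoc, h', whisker_exchange_assoc, h,
    comp_whiskerRight, Category.assoc]

theorem Adj.symm {f : X ≅ X'} {f' : Y' ≅ Y} (h : Adj E E' f.hom f'.hom) :
    Adj E' E f.inv f'.inv := by
  unfold Adj at *
  rw [← cancel_epi (f'.hom ▷ X'), ← whisker_exchange_assoc, ← h]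
  simp

theorem Adj.congr {f g : X ⟶ X'} {f' g' : Y' ⟶ Y} (h : Adj E E' f f') (e : f = g)
    (e' : f' = g') : Adj E E' g g' := e ▸ e' ▸ h

theorem Adj.flip {f : X ⟶ X'} {f' : Y' ⟶ Y} (h : Adj E E' f f') :
    Adj ((β_ X' Y').hom ≫ E') ((β_ X Y).hom ≫ E) f' f := by
  unfold Adj at *
  simp [h]

/-- The principle by which images under `U` are identified: it suffices to exhibit the same adjoint
for the expected morphism. -/
theorem Adj.unique {f g : X ⟶ X'} {f' : Y' ⟶ Y} (hE : Nondegenerate E') (h : Adj E E' f f')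
    (h' : Adj E E' g f') : f = g :=
  hE.right (Eq.trans h (Eq.symm h'))

theorem Adj.tensor {Z W Z' W' : D} {F : Z ⊗ W ⟶ 𝟙_ D} {F' : Z' ⊗ W' ⟶ 𝟙_ D} {f : X ⟶ X'}
    {f' : Y' ⟶ Y} {g : W ⟶ W'} {g' : Z' ⟶ Z} (h : Adj E E' f f') (h' : Adj F F' g g') :
    Adj (prodPairing E F) (prodPairing E' F') (f ⊗ₘ g) (f' ⊗ₘ g') := by
  unfold Adj prodPairing at *
  have h₁ := tensorμ_natural (𝟙 Y') (𝟙 Z') f g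
  have h₂ := tensorμ_natural f' g' (𝟙 X) (𝟙 W)
  simp only [tensorHom_id, id_tensorHom, id_whiskerRight] at h₁ h₂
  rw [reassoc_of% h₁, reassoc_of% h₂, MonoidalCategory.tensorHom_comp_tensorHom_assoc,
    MonoidalCategory.tensorHom_comp_tensorHom_assoc, h, h']

/-- For product pairings, adjoints of structural morphisms are again structural: once the pairings
are moved to the end by naturality, only permutations and unit coherence remain. The same argument
gives the associator, the unitor and the middle exchange below. -/
theorem adj_braiding (E : Y ⊗ X ⟶ 𝟙_ D) (E' : Y' ⊗ X' ⟶ 𝟙_ D) :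
    Adj (prodPairing E E') (prodPairing E' E) (β_ X X').hom (β_ Y' Y).hom := by
  unfold Adj prodPairing
  have h : (Y' ⊗ Y) ◁ (β_ X X').hom ≫ tensorμ Y' Y X' X =
      (β_ Y' Y).hom ▷ (X ⊗ X') ≫ tensorμ Y Y' X X' ≫ (β_ (Y ⊗ X) (Y' ⊗ X')).hom :=
    Coherent.eq (((Word.leaf 0 Y').tensor (.leaf 1 Y)).tensor
      ((Word.leaf 2 X).tensor (.leaf 3 X'))) (by simp [Word.labels]) rfl
  have h' : (β_ (𝟙_ D) (𝟙_ D)).hom ≫ (λ_ (𝟙_ D)).hom = (λ_ (𝟙_ D)).hom :=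
    Coherent.eq (Word.unit.tensor .unit) (by simp [Word.labels]) rfl
  rw [reassoc_of% h, ← BraidedCategory.braiding_naturality_assoc, h']

theorem adj_associator (E : Y ⊗ X ⟶ 𝟙_ D) (E' : Y' ⊗ X' ⟶ 𝟙_ D) (E'' : Y'' ⊗ X'' ⟶ 𝟙_ D) :
    Adj (prodPairing (prodPairing E E') E'') (prodPairing E (prodPairing E' E''))
      (α_ X X' X'').hom (α_ Y Y' Y'').inv := by
  unfold Adj prodPairing
  have h : (Y ⊗ (Y' ⊗ Y'')) ◁ (α_ X X' X'').hom ≫ tensorμ Y (Y' ⊗ Y'') X (X' ⊗ X'') ≫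
      _ ◁ tensorμ Y' Y'' X' X'' = (α_ Y Y' Y'').inv ▷ ((X ⊗ X') ⊗ X'') ≫
        tensorμ (Y ⊗ Y') Y'' (X ⊗ X') X'' ≫ tensorμ Y Y' X X' ▷ _ ≫
          (α_ (Y ⊗ X) (Y' ⊗ X') (Y'' ⊗ X'')).hom :=
    Coherent.eq (((Word.leaf 0 Y).tensor ((Word.leaf 1 Y').tensor (.leaf 2 Y''))).tensor
      (((Word.leaf 3 X).tensor (.leaf 4 X')).tensor (.leaf 5 X''))) (by simp [Word.labels]) rfl
  have h' : (α_ (𝟙_ D) (𝟙_ D) (𝟙_ D)).hom ≫ _ ◁ (λ_ (𝟙_ D)).hom = (λ_ (𝟙_ D)).hom ▷ _ :=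
    Coherent.eq ((Word.unit.tensor .unit).tensor .unit) (by simp [Word.labels]) rfl
  have h₁ : (E ⊗ₘ (tensorμ Y' Y'' X' X'' ≫ (E' ⊗ₘ E'') ≫ (λ_ (𝟙_ D)).hom)) =
      _ ◁ tensorμ Y' Y'' X' X'' ≫ (E ⊗ₘ (E' ⊗ₘ E'')) ≫ _ ◁ (λ_ (𝟙_ D)).hom := by
    simp only [← id_tensorHom, MonoidalCategory.tensorHom_comp_tensorHom, Category.id_comp,
      Category.comp_id]
  have h₂ : ((tensorμ Y Y' X X' ≫ (E ⊗ₘ E') ≫ (λ_ (𝟙_ D)).hom) ⊗ₘ E'') =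
      tensorμ Y Y' X X' ▷ _ ≫ ((E ⊗ₘ E') ⊗ₘ E'') ≫ (λ_ (𝟙_ D)).hom ▷ _ := by
    simp only [← tensorHom_id, MonoidalCategory.tensorHom_comp_tensorHom, Category.id_comp,
      Category.comp_id]
  rw [h₁, h₂]
  simp only [Category.assoc]
  rw [reassoc_of% h, ← associator_naturality_assoc, reassoc_of% h']

theorem adj_rightUnitor (E : Y ⊗ X ⟶ 𝟙_ D) :
    Adj (prodPairing E (λ_ (𝟙_ D)).hom) E (ρ_ X).hom (ρ_ Y).inv := by
  unfold Adj prodPairing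
  have h : Y ◁ (ρ_ X).hom = (ρ_ Y).inv ▷ (X ⊗ 𝟙_ D) ≫ tensorμ Y (𝟙_ D) X (𝟙_ D) ≫
      _ ◁ (λ_ (𝟙_ D)).hom ≫ (ρ_ (Y ⊗ X)).hom :=
    Coherent.eq ((Word.leaf 0 Y).tensor ((Word.leaf 1 X).tensor .unit)) (by simp [Word.labels]) rfl
  rw [h, MonoidalCategory.tensorHom_def', unitors_equal]
  simp

/-- Middle exchanges are adjoint to middle exchanges, which is why `q` and its dual `q'` have the
same image up to transports. -/
theorem adj_tensorμ {Z W Z' W' : D} (E : Y ⊗ X ⟶ 𝟙_ D) (E' : Y' ⊗ X' ⟶ 𝟙_ D)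
    (F : Z ⊗ W ⟶ 𝟙_ D) (F' : Z' ⊗ W' ⟶ 𝟙_ D) :
    Adj (prodPairing (prodPairing E E') (prodPairing F F'))
      (prodPairing (prodPairing E F) (prodPairing E' F'))
      (tensorμ X X' W W') (tensorμ Y Z Y' Z') := by
  unfold Adj prodPairing
  have h : ((Y ⊗ Z) ⊗ (Y' ⊗ Z')) ◁ tensorμ X X' W W' ≫
      tensorμ (Y ⊗ Z) (Y' ⊗ Z') (X ⊗ W) (X' ⊗ W') ≫ (tensorμ Y Z X W ⊗ₘ tensorμ Y' Z' X' W') =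
      tensorμ Y Z Y' Z' ▷ ((X ⊗ X') ⊗ (W ⊗ W')) ≫
        tensorμ (Y ⊗ Y') (Z ⊗ Z') (X ⊗ X') (W ⊗ W') ≫
          (tensorμ Y Y' X X' ⊗ₘ tensorμ Z Z' W W') ≫
            tensorμ (Y ⊗ X) (Y' ⊗ X') (Z ⊗ W) (Z' ⊗ W') :=
    Coherent.eq ((((Word.leaf 0 Y).tensor (.leaf 1 Z)).tensor
      ((Word.leaf 2 Y').tensor (.leaf 3 Z'))).tensor (((Word.leaf 4 X).tensor (.leaf 5 X')).tensor
      ((Word.leaf 6 W).tensor (.leaf 7 W')))) (by simp [Word.labels]) rfl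
  have h' : tensorμ (𝟙_ D) (𝟙_ D) (𝟙_ D) (𝟙_ D) ≫ ((λ_ (𝟙_ D)).hom ⊗ₘ (λ_ (𝟙_ D)).hom) =
      ((λ_ (𝟙_ D)).hom ⊗ₘ (λ_ (𝟙_ D)).hom) :=
    Coherent.eq ((Word.unit.tensor .unit).tensor (Word.unit.tensor .unit))
      (by simp [Word.labels]) rfl
  have h₁ := tensorμ_natural E E' F F'
  simp only [← MonoidalCategory.tensorHom_comp_tensorHom, Category.assoc]
  rw [reassoc_of% h, ← reassoc_of% h₁, reassoc_of% h']

end Pairings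

/-! ### The pairing of an object of a strict compact closed category with its dual -/

section Duals

set_option linter.unusedSectionVars false

variable {D : Type u₂} [Category.{v₂} D] [MonoidalCategory D] [SymmetricCategory D]
  [LeftRigidCategory D]

/-- The evaluation, for an object equal to the dual. -/
def dualPairing {X X' : D} (h : X' = ᘁX) : X' ⊗ X ⟶ 𝟙_ D :=
  eqToHom h ▷ X ≫ (β_ (ᘁX) X).hom ≫ ε_ (ᘁX) X

/-- Up to a braiding the pairing is the counit of a duality, and composing with the counit is one
direction of the tensor-hom bijection, in either argument. -/
theorem dualPairing_nondegenerate {X X' : D} (h : X' = ᘁX) : Nondegenerate (dualPairing h) := by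
  subst h
  constructor
  · intro Z f g e
    simp only [dualPairing, eqToHom_refl, id_whiskerRight, Category.id_comp,
      BraidedCategory.braiding_naturality_left_assoc, cancel_epi] at e
    rw [← cancel_mono (ρ_ (ᘁX)).inv, ← tensorLeftHomEquiv_whiskerLeft_comp_evaluation,
      ← tensorLeftHomEquiv_whiskerLeft_comp_evaluation, e]
  · intro Z f g e
    simp only [dualPairing, eqToHom_refl, id_whiskerRight, Category.id_comp,
      BraidedCategory.braiding_naturality_right_assoc, cancel_epi] at e
    have h (k : Z ⟶ X) := tensorRightHomEquiv_whiskerRight_comp_evaluation (X := (ᘁX : D)) k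
    have h' := (h f).symm.trans ((congrArg _ e).trans (h g))
    exact (cancel_mono (λ_ X).inv).1 h'

variable [StrictCompactClosed D]

theorem dualPairing_dual {X X' X'' : D} (h : X' = ᘁX) (h' : X'' = ᘁX') (k : X = X'') :
    X' ◁ eqToHom k ≫ (β_ X' X'').hom ≫ dualPairing h' = dualPairing h := by
  subst h h'
  simpa [dualPairing] using StrictCompactClosed.doubleDual_eq X

/-- Strictness of the De Morgan isomorphism enters here: `deMorgan_eq` determines the counit of a
tensor product by those of its factors. -/
theorem dualPairing_tensor {X X' Y Y' Z Z' : D} (h : X' = ᘁX) (h' : Y' = ᘁY) (k : Z' = ᘁZ)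
    (l : X ⊗ Y = Z) (l' : X' ⊗ Y' = Z') :
    (eqToHom l' ⊗ₘ eqToHom l) ≫ dualPairing k =
      prodPairing (dualPairing h) (dualPairing h') := by
  subst h h' k l
  have h := StrictCompactClosed.deMorgan_eq X Y
  have h' : tensorμ (ᘁX) (ᘁY) X Y ≫ ((β_ (ᘁX) X).hom ⊗ₘ (β_ (ᘁY) Y).hom) =
      (β_ _ _).hom ≫ tensorμ X Y (ᘁX) (ᘁY) :=
    Coherent.eq (((Word.leaf 0 (ᘁX : D)).tensor (.leaf 1 (ᘁY : D))).tensor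
      ((Word.leaf 2 X).tensor (.leaf 3 Y))) (by simp [Word.labels]) rfl
  simp only [dualPairing, prodPairing, eqToHom_refl, id_whiskerRight, Category.id_comp,
    tensorHom_id, BraidedCategory.braiding_naturality_left_assoc, h]
  rw [← MonoidalCategory.tensorHom_comp_tensorHom_assoc, reassoc_of% h']

end Duals

open StarAutonomous

/-! ### Defining equations for evaluations in a `*`-autonomous category -/

section StarAutonomous

set_option linter.unusedSectionVars false

variable {C : Type u₁} [Category.{v₁} C] [MonoidalCategory C] [SymmetricCategory C]
  [StarAutonomous C]

theorem dualMap_ev {A B : C} (f : A ⟶ B) : dualMap f ▷ A ≫ ev A = dual B ◁ f ≫ ev B :=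
  curry_ev _

theorem doubleDual_ev (A : C) :
    doubleDual A ▷ dual A ≫ ev (dual A) = (β_ A (dual A)).hom ≫ ev A :=
  curry_ev _

theorem doubleDualInv_ev (A : C) :
    dual A ◁ doubleDualInv A ≫ ev A = (β_ (dual A) (dual (dual A))).hom ≫ ev (dual A) := by
  rw [← cancel_epi (dual A ◁ doubleDual A), BraidedCategory.braiding_naturality_right_assoc,
    doubleDual_ev, SymmetricCategory.symmetry_assoc, ← MonoidalCategory.whiskerLeft_comp_assoc,
    doubleDualInv, IsIso.hom_inv_id]
  simp

theorem app_ev (A B : C) : app A B ▷ dual B ≫ (β_ B (dual B)).hom ≫ ev B =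
    (α_ (lolly A B) A (dual B)).hom ≫ ev (A ⊗ dual B) := by
  rw [app, comp_whiskerRight, Category.assoc, BraidedCategory.braiding_naturality_left_assoc,
    doubleDualInv_ev, SymmetricCategory.symmetry_assoc, curry_ev]

theorem lam_ev {X A B : C} (f : X ⊗ A ⟶ B) : lam f ▷ (A ⊗ dual B) ≫ ev (A ⊗ dual B) =
    (α_ X A (dual B)).inv ≫ f ▷ dual B ≫ (β_ B (dual B)).hom ≫ ev B :=
  curry_ev _

/-- Partial evaluation of the dual of a tensor product. -/
noncomputable def partialEv (A B : C) : A ⊗ dual (A ⊗ B) ⟶ dual B :=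
  (β_ A (dual (A ⊗ B))).hom ≫ dualMap (A ◁ doubleDualInv B) ▷ A ≫ app A (dual B)

/-- The detour through the double dual of `B` cancels: `x` and `y` stand for `doubleDual B` and its
inverse, with `B₂` the double dual. -/
theorem partialEv_ev_aux {A B B₂ L M N S I : C} {a : L ⊗ A ⟶ N} {d : M ⟶ L} {s : S ⟶ M ⊗ A}
    {x : B ⟶ B₂} {y : B₂ ⟶ B} (hxy : x ≫ y = 𝟙 B) {w : N ⊗ B₂ ⟶ I} {v : L ⊗ (A ⊗ B₂) ⟶ I}
    {v' : M ⊗ (A ⊗ B) ⟶ I} {e : N ⊗ B ⟶ I} (ha : a ▷ B₂ ≫ w = (α_ _ _ _).hom ≫ v)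
    (hd : d ▷ (A ⊗ B₂) ≫ v = M ◁ A ◁ y ≫ v') (he : N ◁ x ≫ w = e) :
    (s ≫ d ▷ A ≫ a) ▷ B ≫ e = s ▷ B ≫ (α_ _ _ _).hom ≫ v' := by
  have h : M ◁ A ◁ x ≫ M ◁ A ◁ y = 𝟙 _ := by
    simp only [← MonoidalCategory.whiskerLeft_comp, hxy, MonoidalCategory.whiskerLeft_id]
  rw [← he]
  simp only [comp_whiskerRight, Category.assoc]
  rw [← whisker_exchange_assoc, ha, ← whisker_exchange_assoc, associator_naturality_left_assoc,
    hd, associator_naturality_right_assoc, reassoc_of% h]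

/-- This removes the internal hom and the double dual from the inner part of the switch, leaving a
plain evaluation. -/
theorem partialEv_ev (A B : C) : partialEv A B ▷ B ≫ ev B =
    (β_ A (dual (A ⊗ B))).hom ▷ B ≫ (α_ (dual (A ⊗ B)) A B).hom ≫ ev (A ⊗ B) := by
  refine partialEv_ev_aux (IsIso.hom_inv_id (doubleDual B)) (app_ev A (dual B))
    (dualMap_ev (A ◁ doubleDualInv B)) ?_
  rw [BraidedCategory.braiding_naturality_right_assoc, doubleDual_ev,
    SymmetricCategory.symmetry_assoc]

theorem switch_ev_aux {P A L M N F Q R S I : C} {x : S ⟶ R} {y : R ⟶ P ⊗ Q} {b : Q ⟶ M ⊗ A}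
    {d : M ⊗ A ⟶ L} {a : L ⟶ N} {a' : P ⊗ N ⟶ F} {E W Z : C} {i : Z ⟶ S ⊗ E} {w : F ⊗ E ⟶ W}
    {w' : W ⟶ I} {v : P ⊗ (N ⊗ E) ⟶ I} (h : a' ▷ E ≫ w ≫ w' = (α_ _ _ _).hom ≫ v) :
    i ≫ (x ≫ y ≫ P ◁ (b ≫ d) ≫ P ◁ a ≫ a') ▷ E ≫ w ≫ w' =
      i ≫ (x ≫ y ≫ P ◁ (b ≫ d ≫ a)) ▷ E ≫ (α_ _ _ _).hom ≫ v := by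
  rw [← h]
  simp only [comp_whiskerRight, Category.assoc, MonoidalCategory.whiskerLeft_comp]

/-- `par (A ⊗ B) E` unfolds to the internal hom from `dual (A ⊗ B)` to `E`, so the computation rule
of `lam` applies to the switch; the outer `app` is then evaluated by `app_ev`. -/
theorem switch_ev (A B E : C) :
    switch A B E ▷ (dual (A ⊗ B) ⊗ dual E) ≫ ev (dual (A ⊗ B) ⊗ dual E) =
      (α_ (A ⊗ par B E) (dual (A ⊗ B)) (dual E)).inv ≫
        ((β_ A (par B E)).hom ▷ dual (A ⊗ B) ≫ (α_ (par B E) A (dual (A ⊗ B))).hom ≫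
          par B E ◁ partialEv A B) ▷ dual E ≫
            (α_ (par B E) (dual B) (dual E)).hom ≫ ev (dual B ⊗ dual E) :=
  (lam_ev _).trans (switch_ev_aux (app_ev (dual B) E))

end StarAutonomous

/-! ### The image under `U` of the tensor structure and of the evaluations -/

namespace StrictStarFunctor

set_option linter.unusedSectionVars false

variable {C : Type u₁} [Category.{v₁} C] [MonoidalCategory C] [SymmetricCategory C]
  [StarAutonomous C] {D : Type u₂} [Category.{v₂} D] [MonoidalCategory D] [SymmetricCategory D]
  [LeftRigidCategory D] (U : StrictStarFunctor C D)

/-- `U` preserves tensor products. -/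
def tensIso (A B : C) : U.obj (A ⊗ B) ≅ U.obj A ⊗ U.obj B := eqToIso (U.obj_tensor A B)

/-- `U` preserves the unit. -/
def unitIso : U.obj (𝟙_ C) ≅ 𝟙_ D := eqToIso U.obj_unit

theorem map_tensorHom {A A' B B' : C} (f : A ⟶ A') (g : B ⟶ B') :
    U.map (f ⊗ₘ g) = (U.tensIso A B).hom ≫ (U.map f ⊗ₘ U.map g) ≫ (U.tensIso A' B').inv :=
  U.map_tensor f g

theorem map_whiskerLeft (A : C) {B B' : C} (g : B ⟶ B') :
    U.map (A ◁ g) = (U.tensIso A B).hom ≫ U.obj A ◁ U.map g ≫ (U.tensIso A B').inv := by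
  rw [← id_tensorHom, map_tensorHom, U.map_id, id_tensorHom]

theorem map_whiskerRight {A A' : C} (f : A ⟶ A') (B : C) :
    U.map (f ▷ B) = (U.tensIso A B).hom ≫ U.map f ▷ U.obj B ≫ (U.tensIso A' B).inv := by
  rw [← tensorHom_id, map_tensorHom, U.map_id, tensorHom_id]

theorem map_β (A B : C) :
    U.map (β_ A B).hom = (U.tensIso A B).hom ≫ (β_ _ _).hom ≫ (U.tensIso B A).inv :=
  U.map_braiding A B

theorem map_α (A B E : C) :
    U.map (α_ A B E).hom = (U.tensIso (A ⊗ B) E).hom ≫ (U.tensIso A B).hom ▷ U.obj E ≫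
      (α_ _ _ _).hom ≫ U.obj A ◁ (U.tensIso B E).inv ≫ (U.tensIso A (B ⊗ E)).inv := by
  simp [map_associator, tensIso, eqToHom_whiskerRight, whiskerLeft_eqToHom]

theorem map_ρ (A : C) :
    U.map (ρ_ A).hom = (U.tensIso A (𝟙_ C)).hom ≫ U.obj A ◁ U.unitIso.hom ≫ (ρ_ _).hom := by
  simp [map_rightUnitor, tensIso, unitIso, whiskerLeft_eqToHom]

theorem map_lam (A : C) :
    U.map (λ_ A).hom = (U.tensIso (𝟙_ C) A).hom ≫ U.unitIso.hom ▷ U.obj A ≫ (λ_ _).hom := by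
  simp [map_leftUnitor, tensIso, unitIso, eqToHom_whiskerRight]

theorem map_iso_inv {A B : C} (i : A ≅ B) {f : U.obj A ≅ U.obj B} (h : U.map i.hom = f.hom) :
    U.map i.inv = f.inv := by
  rw [← cancel_epi f.hom, f.hom_inv_id, ← h, ← U.map_comp, i.hom_inv_id, U.map_id]

theorem map_α_inv (A B E : C) :
    U.map (α_ A B E).inv = (U.tensIso A (B ⊗ E)).hom ≫ U.obj A ◁ (U.tensIso B E).hom ≫
      (α_ _ _ _).inv ≫ (U.tensIso A B).inv ▷ U.obj E ≫ (U.tensIso (A ⊗ B) E).inv := by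
  refine (U.map_iso_inv (α_ A B E) (f := U.tensIso (A ⊗ B) E ≪≫
    whiskerRightIso (U.tensIso A B) (U.obj E) ≪≫ α_ _ _ _ ≪≫
    whiskerLeftIso (U.obj A) (U.tensIso B E).symm ≪≫ (U.tensIso A (B ⊗ E)).symm)
    ((U.map_α A B E).trans (by simp))).trans (by simp)

theorem map_ρ_inv (A : C) :
    U.map (ρ_ A).inv = (ρ_ _).inv ≫ U.obj A ◁ U.unitIso.inv ≫ (U.tensIso A (𝟙_ C)).inv := by
  refine (U.map_iso_inv (ρ_ A) (f := U.tensIso A (𝟙_ C) ≪≫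
    whiskerLeftIso (U.obj A) U.unitIso ≪≫ ρ_ _) ((U.map_ρ A).trans (by simp))).trans (by simp)

/-- The image of a bilinear form. -/
def form {A B : C} (f : A ⊗ B ⟶ 𝟙_ C) : U.obj A ⊗ U.obj B ⟶ 𝟙_ D :=
  (U.tensIso A B).inv ≫ U.map f ≫ U.unitIso.hom

theorem form_whiskerRight {A A' B : C} (f : A ⟶ A') (e : A' ⊗ B ⟶ 𝟙_ C) :
    U.form (f ▷ B ≫ e) = U.map f ▷ U.obj B ≫ U.form e := by
  simp [form, map_whiskerRight]

theorem form_whiskerLeft {A B B' : C} (f : B ⟶ B') (e : A ⊗ B' ⟶ 𝟙_ C) :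
    U.form (A ◁ f ≫ e) = U.obj A ◁ U.map f ≫ U.form e := by
  simp [form, map_whiskerLeft]

theorem form_braiding {A B : C} (e : B ⊗ A ⟶ 𝟙_ C) :
    U.form ((β_ A B).hom ≫ e) = (β_ _ _).hom ≫ U.form e := by
  simp [form, map_β]

/-- The source of adjunctions in `D`: the equations that characterize curried morphisms in `C` have
this form. -/
theorem adj_form {Y X Y' X' : C} {e : Y ⊗ X ⟶ 𝟙_ C} {e' : Y' ⊗ X' ⟶ 𝟙_ C} {f : X ⟶ X'}
    {f' : Y' ⟶ Y} (h : Y' ◁ f ≫ e' = f' ▷ X ≫ e) :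
    Adj (U.form e) (U.form e') (U.map f) (U.map f') := by
  rw [Adj, ← form_whiskerLeft, ← form_whiskerRight, h]

/-- The image of the evaluation. -/
def pairing (A : C) : U.obj (dual A) ⊗ U.obj A ⟶ 𝟙_ D := U.form (ev A)

theorem pairing_eq (A : C) : U.pairing A = dualPairing (U.obj_dual A) := by
  simp [pairing, form, dualPairing, map_ev, tensIso, unitIso, eqToHom_whiskerRight]

theorem pairing_nondegenerate (A : C) : Nondegenerate (U.pairing A) :=
  U.pairing_eq A ▸ dualPairing_nondegenerate _

/-- The image of the evaluation, with its arguments exchanged. -/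
def pairing' (A : C) : U.obj A ⊗ U.obj (dual A) ⟶ 𝟙_ D := (β_ _ _).hom ≫ U.pairing A

theorem pairing'_nondegenerate (A : C) : Nondegenerate (U.pairing' A) :=
  (U.pairing_nondegenerate A).flip

theorem pairing'_eq_form (A : C) : U.pairing' A = U.form ((β_ A (dual A)).hom ≫ ev A) :=
  (U.form_braiding (ev A)).symm

theorem adj_dualMap {A B : C} (f : A ⟶ B) :
    Adj (U.pairing A) (U.pairing B) (U.map f) (U.map (dualMap f)) :=
  U.adj_form (dualMap_ev f).symm

theorem adj_dualMap' {A B : C} (f : A ⟶ B) :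
    Adj (U.pairing' B) (U.pairing' A) (U.map (dualMap f)) (U.map f) :=
  (U.adj_dualMap f).flip

/-- The double dual is curried from the evaluation with its arguments exchanged; its image is thus
adjoint to an identity and is invisible when adjoints are compared. -/
theorem adj_doubleDual (A : C) :
    Adj (U.pairing A) (U.pairing' (dual A)) (U.map (doubleDual A)) (𝟙 _) := by
  rw [pairing'_eq_form, ← U.map_id]
  refine U.adj_form ?_
  rw [BraidedCategory.braiding_naturality_right_assoc, doubleDual_ev]
  simp

theorem adj_doubleDualInv (A : C) :
    Adj (U.pairing' (dual A)) (U.pairing A) (U.map (doubleDualInv A)) (𝟙 _) := by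
  rw [pairing'_eq_form, ← U.map_id]
  refine U.adj_form ?_
  rw [doubleDualInv_ev]
  simp

theorem adj_id_doubleDual (A : C) :
    Adj (U.pairing (dual A)) (U.pairing' A) (𝟙 _) (U.map (doubleDual A)) := by
  simpa [pairing'] using (U.adj_doubleDual A).flip

theorem adj_id_doubleDualInv (A : C) :
    Adj (U.pairing' A) (U.pairing (dual A)) (𝟙 _) (U.map (doubleDualInv A)) := by
  simpa [pairing'] using (U.adj_doubleDualInv A).flip

theorem adj_unitToDual :
    Adj (U.pairing (𝟙_ C)) (λ_ (𝟙_ D)).hom U.unitIso.hom (U.unitIso.inv ≫ U.map unitToDual) := by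
  have h : unitToDual ▷ 𝟙_ C ≫ ev (𝟙_ C) = (λ_ (𝟙_ C)).hom := curry_ev _
  rw [Adj, comp_whiskerRight, Category.assoc, pairing, ← form_whiskerRight, h, form, map_lam]
  simp

theorem adj_dualToUnit :
    Adj (λ_ (𝟙_ D)).hom (U.pairing (𝟙_ C)) U.unitIso.inv (U.map dualToUnit ≫ U.unitIso.hom) := by
  rw [Adj, dualToUnit, pairing, form, U.map_comp, map_ρ_inv]
  simp [unitors_equal]

/-! ### De Morgan duality under `U` -/

variable [StrictCompactClosed D]

/-- `U` sends par to the tensor product. -/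
def parIso (A B : C) : U.obj (par A B) ≅ U.obj A ⊗ U.obj B := eqToIso (U.obj_par A B)

theorem prodPairing_flip {Y X Y' X' : D} (E : Y ⊗ X ⟶ 𝟙_ D) (E' : Y' ⊗ X' ⟶ 𝟙_ D) :
    (β_ (X ⊗ X') (Y ⊗ Y')).hom ≫ prodPairing E E' =
      prodPairing ((β_ X Y).hom ≫ E) ((β_ X' Y').hom ≫ E') := by
  have h : (β_ (X ⊗ X') (Y ⊗ Y')).hom ≫ tensorμ Y Y' X X' = tensorμ X X' Y Y' ≫
      ((β_ X Y).hom ⊗ₘ (β_ X' Y').hom) :=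
    Coherent.eq (((Word.leaf 0 X).tensor (.leaf 1 X')).tensor
      ((Word.leaf 2 Y).tensor (.leaf 3 Y'))) (by simp [Word.labels]) rfl
  rw [prodPairing, prodPairing, reassoc_of% h, MonoidalCategory.tensorHom_comp_tensorHom_assoc]

theorem braiding_iso_comp {X Y Z W : D} (t : Z ≅ X) (p : Y ⟶ W) (E : W ⊗ Z ⟶ 𝟙_ D) :
    Z ◁ p ≫ (β_ Z W).hom ≫ E = t.hom ▷ Y ≫ (β_ X Y).hom ≫ (p ⊗ₘ t.inv) ≫ E := by
  rw [← BraidedCategory.braiding_naturality_assoc, MonoidalCategory.tensorHom_def]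
  simp

theorem obj_eq_dual (A : C) : U.obj A = ᘁ(U.obj (dual A)) := by
  rw [U.obj_dual, StrictCompactClosed.dual_dual]

/-- Under the equality of `U (A ⅋ B)` with `U A ⊗ U B`, evaluation against `A⊥ ⊗ B⊥` becomes the
product of the two evaluations. Strictness is used twice: in `h` for double duals, in `h'` for De
Morgan. -/
theorem adj_par (A B : C) :
    Adj (prodPairing (U.pairing A) (U.pairing B)) (U.pairing' (dual A ⊗ dual B))
      (U.parIso A B).symm.hom (U.tensIso (dual A) (dual B)).hom := by
  have h (A : C) : (β_ _ _).hom ≫ dualPairing (U.obj_eq_dual A) = U.pairing A := by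
    rw [pairing_eq, ← dualPairing_dual (U.obj_dual A) (U.obj_eq_dual A) rfl]
    simp
  have h' := dualPairing_tensor (U.obj_eq_dual A) (U.obj_eq_dual B)
    (U.obj_dual (dual A ⊗ dual B)) (U.obj_tensor _ _).symm (U.obj_par A B).symm
  rw [← pairing_eq] at h'
  unfold Adj
  rw [pairing', ← h A, ← h B, ← prodPairing_flip, ← h']
  exact braiding_iso_comp (U.tensIso (dual A) (dual B)) (U.parIso A B).inv _

end StrictStarFunctor

/-! ### The structure of par becomes the structure of the tensor product -/

namespace StrictStarFunctor

set_option linter.unusedSectionVars false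

variable {C : Type u₁} [Category.{v₁} C] [MonoidalCategory C] [SymmetricCategory C]
  [StarAutonomous C] {D : Type u₂} [Category.{v₂} D] [MonoidalCategory D] [SymmetricCategory D]
  [LeftRigidCategory D] (U : StrictStarFunctor C D) [StrictCompactClosed D]

theorem adj_par_hom (A B : C) :
    Adj (U.pairing' (dual A ⊗ dual B)) (prodPairing (U.pairing A) (U.pairing B))
      (U.parIso A B).hom (U.tensIso (dual A) (dual B)).inv :=
  Adj.symm (f := (U.parIso A B).symm) (U.adj_par A B)

theorem adj_par_inv (A B : C) :
    Adj (prodPairing (U.pairing A) (U.pairing B)) (U.pairing (par A B)) (U.parIso A B).inv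
      (U.map (doubleDualInv (dual A ⊗ dual B)) ≫ (U.tensIso (dual A) (dual B)).hom) := by
  exact ((U.adj_par A B).comp (U.adj_id_doubleDualInv (dual A ⊗ dual B))).congr
    (Category.comp_id _) rfl

theorem adj_par_hom' (A B : C) :
    Adj (U.pairing (par A B)) (prodPairing (U.pairing A) (U.pairing B)) (U.parIso A B).hom
      ((U.tensIso (dual A) (dual B)).inv ≫ U.map (doubleDual (dual A ⊗ dual B))) := by
  exact ((U.adj_id_doubleDual (dual A ⊗ dual B)).comp (U.adj_par_hom A B)).congr
    (Category.id_comp _) rfl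

/-- A morphism between pars is determined by an adjoint. -/
theorem map_dualMap_eq {A B A' B' : C} {h : dual A' ⊗ dual B' ⟶ dual A ⊗ dual B}
    {f : U.obj A ⊗ U.obj B ⟶ U.obj A' ⊗ U.obj B'}
    {f' : U.obj (dual A') ⊗ U.obj (dual B') ⟶ U.obj (dual A) ⊗ U.obj (dual B)}
    (hf : Adj (prodPairing (U.pairing A) (U.pairing B)) (prodPairing (U.pairing A') (U.pairing B'))
      f f') (hh : U.map h = (U.tensIso _ _).hom ≫ f' ≫ (U.tensIso _ _).inv) :
    U.map (dualMap h) = (U.parIso A B).hom ≫ f ≫ (U.parIso A' B').inv := by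
  refine Adj.unique (U.pairing'_nondegenerate _) (U.adj_dualMap' h) ?_
  exact ((U.adj_par_hom A B).comp (hf.comp (U.adj_par A' B'))).congr rfl
    ((Category.assoc _ _ _).trans hh.symm)

theorem map_parMap {A A' B B' : C} (f : A ⟶ A') (g : B ⟶ B') :
    U.map (parMap f g) = (U.parIso A B).hom ≫ (U.map f ⊗ₘ U.map g) ≫ (U.parIso A' B').inv :=
  U.map_dualMap_eq ((U.adj_dualMap f).tensor (U.adj_dualMap g)) (U.map_tensorHom _ _)

theorem map_parComm (A B : C) :
    U.map (parComm A B) = (U.parIso A B).hom ≫ (β_ _ _).hom ≫ (U.parIso B A).inv :=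
  U.map_dualMap_eq (adj_braiding (U.pairing A) (U.pairing B)) (U.map_β _ _)

theorem map_whiskerLeft_α_inv_whiskerRight {X Y Z P Q : C} (x : Q ⟶ Y ⊗ Z) (y : X ⊗ Y ⟶ P) :
    U.map (X ◁ x ≫ (α_ X Y Z).inv ≫ y ▷ Z) = (U.tensIso X Q).hom ≫
      (((𝟙 _ ⊗ₘ (U.map x ≫ (U.tensIso Y Z).hom)) ≫ (α_ _ _ _).inv) ≫
        (((U.tensIso X Y).inv ≫ U.map y) ⊗ₘ 𝟙 _)) ≫ (U.tensIso P Z).inv := by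
  simp [map_whiskerLeft, map_whiskerRight, map_α_inv]

theorem map_whiskerRight_α_whiskerLeft {X Y Z P Q : C} (x : P ⟶ X ⊗ Y) (y : Y ⊗ Z ⟶ Q) :
    U.map (x ▷ Z ≫ (α_ X Y Z).hom ≫ X ◁ y) = (U.tensIso P Z).hom ≫
      ((((U.map x ≫ (U.tensIso X Y).hom) ⊗ₘ 𝟙 _) ≫ (α_ _ _ _).hom) ≫
        (𝟙 _ ⊗ₘ ((U.tensIso Y Z).inv ≫ U.map y))) ≫ (U.tensIso X Q).inv := by
  simp [map_whiskerLeft, map_whiskerRight, map_α]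

/-- `parAssoc` is dual to an associator flanked by double dual maps. By `adj_par_hom'` and
`adj_par_inv` these maps are, up to `tensIso`, the adjoints of `parIso` and its inverse, so three
adjunctions compose to the claim. -/
theorem map_parAssoc (A B E : C) :
    U.map (parAssoc A B E) = (U.parIso (par A B) E).hom ≫ ((U.parIso A B).hom ▷ U.obj E ≫
      (α_ _ _ _).hom ≫ U.obj A ◁ (U.parIso B E).inv) ≫ (U.parIso A (par B E)).inv := by
  have h := ((U.adj_par_hom' A B).tensor (Adj.id (U.pairing E))).comp
    ((adj_associator (U.pairing A) (U.pairing B) (U.pairing E)).comp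
      ((Adj.id (U.pairing A)).tensor (U.adj_par_inv B E)))
  rw [tensorHom_id, id_tensorHom] at h
  exact U.map_dualMap_eq h (U.map_whiskerLeft_α_inv_whiskerRight _ _)

theorem map_parAssocInv (A B E : C) :
    U.map (parAssocInv A B E) = (U.parIso A (par B E)).hom ≫ (U.obj A ◁ (U.parIso B E).hom ≫
      (α_ _ _ _).inv ≫ (U.parIso A B).inv ▷ U.obj E) ≫ (U.parIso (par A B) E).inv := by
  have h := ((Adj.id (U.pairing A)).tensor (U.adj_par_hom' B E)).comp
    ((Adj.symm (f := α_ _ _ _) (f' := (α_ _ _ _).symm)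
      (adj_associator (U.pairing A) (U.pairing B) (U.pairing E))).comp
        ((U.adj_par_inv A B).tensor (Adj.id (U.pairing E))))
  rw [tensorHom_id, id_tensorHom] at h
  exact U.map_dualMap_eq h (U.map_whiskerRight_α_whiskerLeft _ _)

theorem map_parUnit (A : C) :
    U.map (parUnit A) = (U.parIso A (𝟙_ C)).hom ≫ U.obj A ◁ U.unitIso.hom ≫ (ρ_ _).hom := by
  have h₁ := (U.adj_dualMap' ((ρ_ (dual A)).inv ≫ dual A ◁ unitToDual)).comp
    (U.adj_doubleDualInv A)
  have h₂ := (U.adj_par_hom A (𝟙_ C)).comp (((Adj.id (U.pairing A)).tensor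
    U.adj_unitToDual).comp (adj_rightUnitor (U.pairing A)))
  rw [← U.map_comp] at h₁
  rw [id_tensorHom] at h₂
  refine h₁.unique (U.pairing_nondegenerate A) (h₂.congr rfl ?_)
  simp [map_ρ_inv, map_whiskerLeft]

theorem map_parUnitInv (A : C) :
    U.map (parUnitInv A) = (ρ_ _).inv ≫ U.obj A ◁ U.unitIso.inv ≫ (U.parIso A (𝟙_ C)).inv := by
  have h₁ := (U.adj_doubleDual A).comp (U.adj_dualMap' (dual A ◁ dualToUnit ≫
    (ρ_ (dual A)).hom))
  have h₂ := (Adj.symm (f := ρ_ _) (f' := (ρ_ _).symm) (adj_rightUnitor (U.pairing A))).comp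
    (((Adj.id (U.pairing A)).tensor U.adj_dualToUnit).comp (U.adj_par A (𝟙_ C)))
  rw [← U.map_comp] at h₁
  rw [id_tensorHom] at h₂
  refine h₁.unique (U.pairing'_nondegenerate _) (h₂.congr rfl ?_)
  simp [map_ρ, map_whiskerLeft]

end StrictStarFunctor

/-! ### The switch morphism -/

namespace StrictStarFunctor

set_option linter.unusedSectionVars false

section

variable {D : Type u₂} [Category.{v₂} D] [MonoidalCategory D] [SymmetricCategory D]

/-- This is the right side of `switch_ev` with par replaced by the tensor product. By `hk` the
partial evaluation `k` followed by `F` is the full evaluation `H`; what remains is one permutation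
of five factors. -/
theorem switch_aux {A B E E' B' Y : D} {k : A ⊗ Y ⟶ B'} {F : B ⊗ B' ⟶ 𝟙_ D}
    {G : E ⊗ E' ⟶ 𝟙_ D} {H : (A ⊗ B) ⊗ Y ⟶ 𝟙_ D}
    (hk : B ◁ k ≫ F = exch B A Y ≫ (α_ A B Y).inv ≫ H) :
    (α_ (A ⊗ (B ⊗ E)) Y E').inv ≫ ((β_ A (B ⊗ E)).hom ▷ Y ≫ (α_ (B ⊗ E) A Y).hom ≫
      (B ⊗ E) ◁ k) ▷ E' ≫ (α_ (B ⊗ E) B' E').hom ≫ prodPairing F G =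
      (α_ A B E).inv ▷ (Y ⊗ E') ≫ prodPairing H G := by
  have h₁ := tensorμ_natural (𝟙 B) (𝟙 E) k (𝟙 E')
  simp only [id_tensorHom, tensorHom_id, MonoidalCategory.id_whiskerRight] at h₁
  have h₂ : (α_ (A ⊗ (B ⊗ E)) Y E').inv ≫ ((β_ A (B ⊗ E)).hom ▷ Y ≫ (α_ (B ⊗ E) A Y).hom) ▷ E' ≫
      (α_ (B ⊗ E) (A ⊗ Y) E').hom ≫ tensorμ B E (A ⊗ Y) E' ≫
        (exch B A Y ≫ (α_ A B Y).inv) ▷ (E ⊗ E') =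
      (α_ A B E).inv ▷ (Y ⊗ E') ≫ tensorμ (A ⊗ B) E Y E' :=
    Coherent.eq (((Word.leaf 0 A).tensor ((Word.leaf 1 B).tensor (.leaf 2 E))).tensor
      ((Word.leaf 3 Y).tensor (.leaf 4 E'))) (by simp [Word.labels]) rfl
  simp only [prodPairing, comp_whiskerRight, Category.assoc] at h₂ ⊢
  have hk' := congrArg (· ▷ (E ⊗ E')) hk
  simp only [comp_whiskerRight] at hk'
  rw [associator_naturality_middle_assoc, reassoc_of% h₁, MonoidalCategory.tensorHom_def F,
    Category.assoc, reassoc_of% hk', MonoidalCategory.tensorHom_def H, ← reassoc_of% h₂]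
  simp only [Category.assoc]

theorem switch_aux_iso {A B E E' B' Y P : D} {k : A ⊗ Y ⟶ B'} {F : B ⊗ B' ⟶ 𝟙_ D}
    {G : E ⊗ E' ⟶ 𝟙_ D} {H : (A ⊗ B) ⊗ Y ⟶ 𝟙_ D}
    (hk : B ◁ k ≫ F = exch B A Y ≫ (α_ A B Y).inv ≫ H) (p : P ⟶ B ⊗ E) :
    (α_ (A ⊗ P) Y E').inv ≫ ((β_ A P).hom ▷ Y ≫ (α_ P A Y).hom ≫
      P ◁ k) ▷ E' ≫ (α_ P B' E').hom ≫ p ▷ _ ≫ prodPairing F G =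
      (A ◁ p ≫ (α_ A B E).inv) ▷ (Y ⊗ E') ≫ prodPairing H G := by
  have h : ((β_ A P).hom ▷ Y ≫ (α_ P A Y).hom ≫ P ◁ k) ≫ p ▷ B' =
      (A ◁ p) ▷ Y ≫ (β_ A (B ⊗ E)).hom ▷ Y ≫ (α_ (B ⊗ E) A Y).hom ≫ (B ⊗ E) ◁ k := by
    rw [Category.assoc, Category.assoc, whisker_exchange, ← associator_naturality_left_assoc,
      ← comp_whiskerRight_assoc, ← BraidedCategory.braiding_naturality_right,
      comp_whiskerRight_assoc]
  rw [← associator_naturality_left_assoc, ← comp_whiskerRight_assoc _ (p ▷ B'), h,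
    comp_whiskerRight_assoc, ← associator_inv_naturality_left_assoc, switch_aux hk,
    comp_whiskerRight_assoc]

theorem prodPairing_whiskerRight {A B X E E' : D} (t : A ⟶ B) (F : B ⊗ X ⟶ 𝟙_ D)
    (G : E ⊗ E' ⟶ 𝟙_ D) :
    prodPairing (t ▷ X ≫ F) G = (t ▷ E) ▷ (X ⊗ E') ≫ prodPairing F G := by
  have h := tensorμ_natural t (𝟙 E) (𝟙 X) (𝟙 E')
  simp only [tensorHom_id, MonoidalCategory.id_whiskerRight] at h
  rw [prodPairing, prodPairing, reassoc_of% h, MonoidalCategory.tensorHom_def (t ▷ X ≫ F),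
    MonoidalCategory.tensorHom_def F]
  simp

theorem switch_conj {A B A₂ E E' Y P R₁ R₂ S Y' N N' T : D} {t : S ⟶ A ⊗ P} {p : P ⟶ B ⊗ E}
    {s : A ⊗ B ⟶ A₂} {p' : T ≅ A₂ ⊗ E} {r : Y' ⟶ Y ⊗ E'} {n : N' ≅ N} {F : A₂ ⊗ Y ⟶ 𝟙_ D}
    {G : E ⊗ E' ⟶ 𝟙_ D} {w : (A ⊗ P) ⊗ (Y ⊗ E') ⟶ R₁} {w₁ : R₁ ⟶ R₂} {w₂ : R₂ ⟶ P ⊗ N}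
    {K : (B ⊗ E) ⊗ N ⟶ 𝟙_ D}
    (h : w ≫ w₁ ≫ w₂ ≫ p ▷ N ≫ K = (A ◁ p ≫ (α_ A B E).inv) ▷ (Y ⊗ E') ≫
      prodPairing (s ▷ Y ≫ F) G) :
    t ▷ Y' ≫ _ ◁ r ≫ w ≫ w₁ ≫ w₂ ≫ P ◁ n.inv ≫ p ▷ N' ≫ _ ◁ n.hom ≫ K =
      (t ≫ (A ◁ p ≫ (α_ A B E).inv ≫ s ▷ E) ≫ p'.inv) ▷ Y' ≫ p'.hom ▷ Y' ≫ _ ◁ r ≫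
        prodPairing F G := by
  rw [← whisker_exchange_assoc p n.hom, whiskerLeft_inv_hom_assoc, h, prodPairing_whiskerRight]
  simp only [comp_whiskerRight, Category.assoc, inv_hom_whiskerRight_assoc]
  simp only [← whisker_exchange_assoc]

/-- Tested against `Z` by the nondegenerate `G`, the triangle composite becomes the left side of
`h`: the crossing of the two copies of `Y` is the middle exchange inside `prodPairing`. -/
theorem snake_of_prodPairing {X Y Z : D} {k : 𝟙_ D ⟶ X ⊗ Y} {F : X ⊗ Y ⟶ 𝟙_ D}
    {G : Y ⊗ Z ⟶ 𝟙_ D} (hG : Nondegenerate G)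
    (h : k ▷ (Y ⊗ Z) ≫ prodPairing F G = (λ_ _).hom ≫ G) :
    (λ_ Y).inv ≫ k ▷ Y ≫ (α_ X Y Y).hom ≫ X ◁ (β_ Y Y).hom ≫ (α_ X Y Y).inv ≫ F ▷ Y ≫
      (λ_ Y).hom = 𝟙 Y := by
  apply hG.left
  have h₁ : ((λ_ Y).inv ≫ k ▷ Y ≫ (α_ X Y Y).hom ≫ X ◁ (β_ Y Y).hom ≫ (α_ X Y Y).inv ≫ F ▷ Y ≫
      (λ_ Y).hom) ▷ Z = (λ_ (Y ⊗ Z)).inv ≫ k ▷ (Y ⊗ Z) ≫ ((α_ (X ⊗ Y) Y Z).inv ≫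
        ((α_ X Y Y).hom ≫ X ◁ (β_ Y Y).hom ≫ (α_ X Y Y).inv) ▷ Z ≫ (α_ (X ⊗ Y) Y Z).hom) ≫
          F ▷ (Y ⊗ Z) ≫ (λ_ (Y ⊗ Z)).hom := by
    monoidal
  have h₂ : (α_ (X ⊗ Y) Y Z).inv ≫ ((α_ X Y Y).hom ≫ X ◁ (β_ Y Y).hom ≫ (α_ X Y Y).inv) ▷ Z ≫
      (α_ (X ⊗ Y) Y Z).hom = tensorμ X Y Y Z :=
    Coherent.eq (((Word.leaf 0 X).tensor (.leaf 1 Y)).tensor ((Word.leaf 2 Y).tensor (.leaf 3 Z)))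
      (by simp [Word.labels]) rfl
  rw [prodPairing, MonoidalCategory.tensorHom_def, Category.assoc, leftUnitor_naturality] at h
  rw [h₁, h₂]
  simp only [Category.assoc, h, Iso.inv_hom_id_assoc, id_whiskerRight, Category.id_comp]

theorem pairing_flip {W X Y Z : D} {p : W ⟶ Y} {t : Z ≅ X} {P : W ⊗ Z ⟶ 𝟙_ D} {Q : X ⊗ Y ⟶ 𝟙_ D}
    (h : X ◁ p ≫ Q = t.inv ▷ W ≫ (β_ Z W).hom ≫ P) :
    P = p ▷ Z ≫ Y ◁ t.hom ≫ (β_ Y X).hom ≫ Q := by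
  rw [BraidedCategory.braiding_naturality_right_assoc,
    BraidedCategory.braiding_naturality_left_assoc, whisker_exchange_assoc, h]
  simp

end

variable {C : Type u₁} [Category.{v₁} C] [MonoidalCategory C] [SymmetricCategory C]
  [StarAutonomous C] {D : Type u₂} [Category.{v₂} D] [MonoidalCategory D] [SymmetricCategory D]
  [LeftRigidCategory D] (U : StrictStarFunctor C D) [StrictCompactClosed D]

theorem pairing_par (A B : C) : U.pairing (dual A ⊗ dual B) =
    (U.parIso A B).hom ▷ _ ≫ _ ◁ (U.tensIso (dual A) (dual B)).hom ≫
      prodPairing (U.pairing' A) (U.pairing' B) :=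
  (pairing_flip (U.adj_par_hom A B)).trans (by
    rw [prodPairing_flip, pairing', pairing']
    rfl)

theorem map_partialEv (A B : C) :
    U.obj B ◁ ((U.tensIso A (dual (A ⊗ B))).inv ≫ U.map (partialEv A B)) ≫ U.pairing' B =
      exch _ _ _ ≫ (α_ _ _ _).inv ≫ (U.tensIso A B).inv ▷ _ ≫ U.pairing' (A ⊗ B) := by
  have h := congrArg U.form (partialEv_ev A B)
  rw [form_whiskerRight] at h
  have h' : (U.tensIso A (dual (A ⊗ B))).inv ▷ U.obj B ≫
      U.form ((β_ A (dual (A ⊗ B))).hom ▷ B ≫ (α_ (dual (A ⊗ B)) A B).hom ≫ ev (A ⊗ B)) =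
      (β_ _ _).hom ▷ _ ≫ (α_ _ _ _).hom ≫ _ ◁ (U.tensIso A B).inv ≫ U.pairing (A ⊗ B) := by
    simp [form, pairing, map_whiskerRight, map_β, map_α]
  have h'' : (β_ _ _).hom ≫ (β_ (U.obj A) (U.obj (dual (A ⊗ B)))).hom ▷ U.obj B ≫
      (α_ _ _ _).hom = exch _ _ _ ≫ (α_ _ _ _).inv ≫ (β_ _ _).hom :=
    Coherent.eq ((Word.leaf 0 (U.obj B)).tensor ((Word.leaf 1 (U.obj A)).tensor
      (.leaf 2 (U.obj (dual (A ⊗ B)))))) (by simp [Word.labels]) rfl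
  rw [pairing', pairing', BraidedCategory.braiding_naturality_right_assoc, comp_whiskerRight_assoc]
  change _ ≫ _ ≫ _ ≫ U.form (ev B) = _
  rw [h, h', reassoc_of% h'', BraidedCategory.braiding_naturality_left_assoc]

theorem form_exchange {A P Y E N : C} (g : A ⊗ Y ⟶ N) (v : P ⊗ (N ⊗ E) ⟶ 𝟙_ C) :
    U.form ((α_ (A ⊗ P) Y E).inv ≫ ((β_ A P).hom ▷ Y ≫ (α_ P A Y).hom ≫ P ◁ g) ▷ E ≫
      (α_ P N E).hom ≫ v) = (U.tensIso A P).hom ▷ _ ≫ _ ◁ (U.tensIso Y E).hom ≫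
      (α_ _ _ _).inv ≫ ((β_ _ _).hom ▷ _ ≫ (α_ _ _ _).hom ≫
        _ ◁ ((U.tensIso A Y).inv ≫ U.map g)) ▷ _ ≫ (α_ _ _ _).hom ≫
          _ ◁ (U.tensIso N E).inv ≫ U.form v := by
  simp [form, map_whiskerRight, map_whiskerLeft, map_β, map_α, map_α_inv]
  rw [← associator_inv_naturality_left_assoc, whisker_exchange_assoc]
  simp

/-- Both morphisms are tested by pairing with `dual (A ⊗ B) ⊗ dual E`. On the switch, `switch_ev`
evaluates the test; `pairing_par` splits the pairings into products, and `map_partialEv` supplies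
the hypothesis of `switch_aux_iso`. -/
theorem map_switch (A B E : C) :
    U.map (switch A B E) = (U.tensIso A (par B E)).hom ≫ (U.obj A ◁ (U.parIso B E).hom ≫
      (α_ _ _ _).inv ≫ (U.tensIso A B).inv ▷ U.obj E) ≫ (U.parIso (A ⊗ B) E).inv := by
  refine (U.pairing_nondegenerate (dual (A ⊗ B) ⊗ dual E)).left ?_
  refine (U.form_whiskerRight _ _).symm.trans ((congrArg U.form (switch_ev A B E)).trans ?_)
  refine (U.form_exchange _ _).trans ?_
  change _ ≫ _ ≫ _ ≫ _ ≫ _ ≫ _ ≫ U.pairing (dual B ⊗ dual E) = _ ≫ U.pairing _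
  refine (congrArg (_ ≫ _ ≫ _ ≫ _ ≫ _ ≫ _ ≫ ·) (U.pairing_par B E)).trans ?_
  refine Eq.trans ?_ (congrArg (_ ≫ ·) (U.pairing_par (A ⊗ B) E)).symm
  have h := switch_aux_iso (G := U.pairing' E) (U.map_partialEv A B) (U.parIso B E).hom
  exact switch_conj h

end StrictStarFunctor

/-! ### The axiom link and the triangle identity -/

namespace StrictStarFunctor

set_option linter.unusedSectionVars false

variable {C : Type u₁} [Category.{v₁} C] [MonoidalCategory C] [SymmetricCategory C]
  [StarAutonomous C] {D : Type u₂} [Category.{v₂} D] [MonoidalCategory D] [SymmetricCategory D]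
  [LeftRigidCategory D] (U : StrictStarFunctor C D) [StrictCompactClosed D]

/-- The canonical morphism `I ⟶ A ⅋ A⊥`. -/
def axiomLink (A : C) : 𝟙_ C ⟶ par A (dual A) :=
  curry ((λ_ (dual A ⊗ dual (dual A))).hom ≫ (β_ (dual A) (dual (dual A))).hom ≫ ev (dual A))

/-- The image of `axiomLink`. -/
def cap (A : C) : 𝟙_ D ⟶ U.obj A ⊗ U.obj (dual A) :=
  U.unitIso.inv ≫ U.map (axiomLink A) ≫ (U.parIso A (dual A)).hom

theorem cap_prodPairing_aux {I P X Y R N : D} (u : I ≅ 𝟙_ D) {a : I ⟶ P} {p : P ⟶ X ⊗ Y} (t : N ≅ R)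
    {E : (X ⊗ Y) ⊗ R ⟶ 𝟙_ D} {F : R ⟶ 𝟙_ D}
    (h : a ▷ N ≫ p ▷ N ≫ (X ⊗ Y) ◁ t.hom ≫ E = u.hom ▷ N ≫ 𝟙_ D ◁ t.hom ≫ (λ_ R).hom ≫ F) :
    (u.inv ≫ a ≫ p) ▷ R ≫ E = (λ_ R).hom ≫ F := by
  rw [← cancel_epi (𝟙_ D ◁ t.hom), ← cancel_epi (u.hom ▷ N), ← h, whisker_exchange_assoc]
  simp

/-- `axiomLink` is the currying of the evaluation of `A⊥`, so evaluating it returns that evaluation;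
`pairing_par` rewrites the evaluation on the par as a product pairing. -/
theorem cap_prodPairing (A : C) :
    U.cap A ▷ _ ≫ prodPairing (U.pairing' A) (U.pairing' (dual A)) =
      (λ_ _).hom ≫ U.pairing' (dual A) := by
  have h : axiomLink A ▷ (dual A ⊗ dual (dual A)) ≫ ev (dual A ⊗ dual (dual A)) =
      (λ_ (dual A ⊗ dual (dual A))).hom ≫ (β_ (dual A) (dual (dual A))).hom ≫ ev (dual A) :=
    curry_ev _
  have h₁ := (U.form_whiskerRight (axiomLink A) _).symm.trans (congrArg U.form h)
  have h₂ := (congrArg (fun x => U.map (axiomLink A) ▷ _ ≫ x) (U.pairing_par A (dual A))).symm.trans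
    h₁
  have h₃ : U.form ((λ_ (dual A ⊗ dual (dual A))).hom ≫ (β_ (dual A) (dual (dual A))).hom ≫
      ev (dual A)) = U.unitIso.hom ▷ _ ≫ 𝟙_ D ◁ (U.tensIso (dual A) (dual (dual A))).hom ≫
        (λ_ _).hom ≫ U.pairing' (dual A) := by
    rw [pairing'_eq_form]
    simp [form, map_lam]
  exact cap_prodPairing_aux U.unitIso (U.tensIso (dual A) (dual (dual A))) (h₂.trans h₃)

theorem snake (A : C) : (λ_ _).inv ≫ U.cap A ▷ _ ≫ (α_ _ _ _).hom ≫ U.obj A ◁ (β_ _ _).hom ≫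
    (α_ _ _ _).inv ≫ U.pairing' A ▷ _ ≫ (λ_ _).hom = 𝟙 (U.obj (dual A)) :=
  snake_of_prodPairing (U.pairing'_nondegenerate (dual A)) (U.cap_prodPairing A)

/-- Through `adj_par_inv` the product pairing is carried to the evaluation on a par of two pars,
which is nondegenerate. -/
theorem adj_unique_prodPairing {X Y : D} {E : Y ⊗ X ⟶ 𝟙_ D} {A B A' B' : C}
    {f g : X ⟶ (U.obj A ⊗ U.obj A') ⊗ (U.obj B ⊗ U.obj B')}
    {f' : (U.obj (dual A) ⊗ U.obj (dual A')) ⊗ (U.obj (dual B) ⊗ U.obj (dual B')) ⟶ Y}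
    (h : Adj E (prodPairing (prodPairing (U.pairing A) (U.pairing A'))
      (prodPairing (U.pairing B) (U.pairing B'))) f f')
    (h' : Adj E (prodPairing (prodPairing (U.pairing A) (U.pairing A'))
      (prodPairing (U.pairing B) (U.pairing B'))) g f') : f = g := by
  have k := ((U.adj_par_inv A A').tensor (U.adj_par_inv B B')).comp
    (U.adj_par_inv (par A A') (par B B'))
  have e := (h.comp k).unique (U.pairing_nondegenerate _) (h'.comp k)
  have : IsIso (((U.parIso A A').inv ⊗ₘ (U.parIso B B').inv) ≫
    (U.parIso (par A A') (par B B')).inv) := inferInstance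
  exact (cancel_mono _).1 e

end StrictStarFunctor

/-! ### Seq and the dual interchange under `U` -/

namespace StrongBVCategory

set_option linter.unusedSectionVars false

variable {C : Type u₁} [Category.{v₁} C] [MonoidalCategory C] [SymmetricCategory C]
  [StarAutonomous C] {D : Type u₂} [Category.{v₂} D] [MonoidalCategory D] [SymmetricCategory D]
  [LeftRigidCategory D] [StrictCompactClosed D] (S : StrongBVCategory C D)

/-- `U` sends `◃` to the tensor product. -/
def seqIso (A B : C) : S.U.obj (S.seq A B) ≅ S.U.obj A ⊗ S.U.obj B := eqToIso (S.obj_seq A B)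

theorem map_seqMap {A A' B B' : C} (f : A ⟶ A') (g : B ⟶ B') :
    S.U.map (S.seqMap f g) = (S.seqIso A B).hom ≫ (S.U.map f ⊗ₘ S.U.map g) ≫
      (S.seqIso A' B').inv :=
  S.map_seq f g

theorem map_seqAssoc_hom (A B E : C) :
    S.U.map (S.seqAssoc A B E).hom = (S.seqIso (S.seq A B) E).hom ≫
      (S.seqIso A B).hom ▷ S.U.obj E ≫ (α_ _ _ _).hom ≫ S.U.obj A ◁ (S.seqIso B E).inv ≫
        (S.seqIso A (S.seq B E)).inv := by
  simp [map_seqAssoc, seqIso, eqToHom_whiskerRight, whiskerLeft_eqToHom]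

theorem map_seqLeftUnit_hom (A : C) :
    S.U.map (S.seqLeftUnit A).hom = (S.seqIso (𝟙_ C) A).hom ≫ S.U.unitIso.hom ▷ S.U.obj A ≫
      (λ_ _).hom := by
  simp [map_seqLeftUnit, seqIso, StrictStarFunctor.unitIso, eqToHom_whiskerRight]

theorem map_seqRightUnit_hom (A : C) :
    S.U.map (S.seqRightUnit A).hom = (S.seqIso A (𝟙_ C)).hom ≫ S.U.obj A ◁ S.U.unitIso.hom ≫
      (ρ_ _).hom := by
  simp [map_seqRightUnit, seqIso, StrictStarFunctor.unitIso, whiskerLeft_eqToHom]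

theorem tensorHom_eqToHom {X Y X' Y' : D} (h : X = Y) (h' : X' = Y') :
    (eqToHom h ⊗ₘ eqToHom h') = eqToHom (by rw [h, h']) := by
  subst h h'
  simp

theorem map_q_tensorμ (A B E F : C) :
    S.U.map (S.q A B E F) = (S.seqIso (par A B) (par E F)).hom ≫
      ((S.U.parIso A B).hom ⊗ₘ (S.U.parIso E F).hom) ≫ tensorμ _ _ _ _ ≫
        ((S.seqIso A E).inv ⊗ₘ (S.seqIso B F).inv) ≫ (S.U.parIso (S.seq A E) (S.seq B F)).inv := by
  simp [map_q, seqIso, StrictStarFunctor.parIso, tensorHom_eqToHom]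

/-- Because `U` sends `κ` to an identity, the evaluation on a seq is the product of the evaluations,
the counterpart of `adj_par`. -/
theorem adj_seq (A B : C) :
    Adj (prodPairing (S.U.pairing A) (S.U.pairing B)) (S.U.pairing (S.seq A B)) (S.seqIso A B).inv
      (S.U.map (S.κ A B).inv ≫ (S.seqIso (dual A) (dual B)).hom) := by
  have k : S.U.obj (dual A) ⊗ S.U.obj (dual B) = S.U.obj (dual (S.seq A B)) := by
    rw [S.U.obj_dual (S.seq A B), S.obj_seq, StrictCompactClosed.dual_tensor, S.U.obj_dual,
      S.U.obj_dual]
  have h := dualPairing_tensor (S.U.obj_dual A) (S.U.obj_dual B) (S.U.obj_dual (S.seq A B))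
    (S.obj_seq A B).symm k
  simp only [← StrictStarFunctor.pairing_eq] at h
  have h₁ : S.U.map (S.κ A B).hom = (S.seqIso (dual A) (dual B)).hom ≫ eqToHom k := by
    simp [map_κ, seqIso]
  have h₂ : S.U.map (S.κ A B).inv ≫ (S.seqIso (dual A) (dual B)).hom ≫ eqToHom k = 𝟙 _ := by
    rw [← h₁, ← S.U.map_comp, Iso.inv_hom_id, S.U.map_id]
  have h₃ : eqToHom (S.obj_seq A B).symm = (S.seqIso A B).inv := rfl
  rw [Adj, ← h, h₃, MonoidalCategory.tensorHom_def, Category.assoc, ← comp_whiskerRight_assoc,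
    Category.assoc, h₂, id_whiskerRight, Category.id_comp]

theorem adj_seqToDual (A B : C) :
    Adj (prodPairing (S.U.pairing A) (S.U.pairing B)) (S.U.pairing' (S.seq (dual A) (dual B)))
      ((S.seqIso A B).inv ≫ S.U.map (S.seqToDual A B)) (S.seqIso (dual A) (dual B)).hom := by
  have h := (S.adj_seq A B).comp ((S.U.adj_doubleDual (S.seq A B)).comp
    (S.U.adj_dualMap' (S.κ A B).hom))
  refine h.congr (congrArg (_ ≫ ·) (S.U.map_comp _ _).symm) ?_
  rw [Category.comp_id, ← S.U.map_comp_assoc, Iso.hom_inv_id, S.U.map_id, Category.id_comp]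

theorem map_comp_tensorHom {W A B A' B' : C} (x : W ⟶ A ⊗ B) (f : A ⟶ A') (g : B ⟶ B') :
    S.U.map x ≫ (S.U.tensIso A B).hom ≫ (S.U.map f ⊗ₘ S.U.map g) =
      S.U.map (x ≫ (f ⊗ₘ g)) ≫ (S.U.tensIso A' B').hom := by
  simp [StrictStarFunctor.map_tensorHom]

theorem adj_dualParToTensor (A B : C) :
    Adj (S.U.pairing' (par (dual A) (dual B))) (prodPairing (S.U.pairing A) (S.U.pairing B))
      (S.U.map (dualParToTensor A B) ≫ (S.U.tensIso A B).hom)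
      (S.U.parIso (dual A) (dual B)).inv := by
  have h₁ := S.U.adj_doubleDualInv (dual (dual A) ⊗ dual (dual B))
  have h₂ := (S.U.adj_par (dual A) (dual B)).flip
  rw [StrictStarFunctor.prodPairing_flip, StrictStarFunctor.pairing',
    SymmetricCategory.symmetry_assoc] at h₂
  have h := h₁.comp (h₂.comp ((S.U.adj_doubleDualInv A).tensor (S.U.adj_doubleDualInv B)))
  refine h.congr ?_ ?_
  · exact S.map_comp_tensorHom _ _ _
  · refine (Category.comp_id _).trans ?_
    rw [MonoidalCategory.id_tensorHom_id]
    exact Category.id_comp _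

theorem adj_doubleDual_tensor (A B : C) :
    Adj (prodPairing (S.U.pairing' A) (S.U.pairing' B)) (S.U.pairing' (par A B))
      ((S.U.tensIso (dual A) (dual B)).inv ≫ S.U.map (doubleDual (dual A ⊗ dual B)))
      (S.U.parIso A B).hom := by
  have h := (S.U.adj_par_hom' A B).flip
  rw [StrictStarFunctor.prodPairing_flip] at h
  exact h

theorem adj_κ_inv (A B : C) :
    Adj (S.U.pairing' (S.seq A B)) (prodPairing (S.U.pairing' A) (S.U.pairing' B))
      (S.U.map (S.κ A B).inv ≫ (S.seqIso (dual A) (dual B)).hom) (S.seqIso A B).inv := by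
  have h := (S.adj_seq A B).flip
  rw [StrictStarFunctor.prodPairing_flip] at h
  exact h

theorem map_tensorHom_comp_seqMap {X Y X' Y' Z W P Q P' Q' : C} {x : X ⟶ X'} {y : Y ⟶ Y'}
    {a : X' ⊗ Y' ⟶ Z} {b : Z ⟶ W} {k : W ⟶ S.seq P Q} {f : P ⟶ P'} {g : Q ⟶ Q'} {X₀ Y₀ P₀ Q₀ : D}
    {sX : S.U.obj X ≅ X₀} {sY : S.U.obj Y ≅ Y₀} {tP : S.U.obj P' ≅ P₀} {tQ : S.U.obj Q' ≅ Q₀}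
    {m : X₀ ⊗ Y₀ ⟶ P₀ ⊗ Q₀}
    (h : ((sX.inv ≫ S.U.map x) ⊗ₘ (sY.inv ≫ S.U.map y)) ≫ ((S.U.tensIso X' Y').inv ≫ S.U.map a) ≫
      S.U.map b ≫ (S.U.map k ≫ (S.seqIso P Q).hom) ≫
        ((S.U.map f ≫ tP.hom) ⊗ₘ (S.U.map g ≫ tQ.hom)) = m) :
    S.U.map ((x ⊗ₘ y) ≫ a ≫ b ≫ k ≫ S.seqMap f g) = (S.U.tensIso X Y).hom ≫ (sX.hom ⊗ₘ sY.hom) ≫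
      m ≫ (tP.inv ⊗ₘ tQ.inv) ≫ (S.seqIso P' Q').inv := by
  rw [← h]
  simp [StrictStarFunctor.map_tensorHom, map_seqMap,
    MonoidalCategory.tensorHom_comp_tensorHom_assoc]

/-- Every factor in the definition of `q'` has a known adjoint. The adjoint of the composite is the
image of `q` at the duals with its transports removed, a middle exchange, and that is also the
adjoint of the expected `tensorμ`. -/
theorem map_q' (A B E F : C) :
    S.U.map (S.q' A B E F) = (S.U.tensIso (S.seq A B) (S.seq E F)).hom ≫
      ((S.seqIso A B).hom ⊗ₘ (S.seqIso E F).hom) ≫ tensorμ _ _ _ _ ≫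
        ((S.U.tensIso A E).inv ⊗ₘ (S.U.tensIso B F).inv) ≫ (S.seqIso (A ⊗ E) (B ⊗ F)).inv := by
  have h := ((S.adj_seqToDual A B).tensor (S.adj_seqToDual E F)).comp
    ((S.adj_doubleDual_tensor _ _).comp ((S.U.adj_dualMap' (S.q (dual A) (dual E) (dual B)
      (dual F))).comp ((S.adj_κ_inv _ _).comp
        ((S.adj_dualParToTensor A E).tensor (S.adj_dualParToTensor B F)))))
  have h' := (adj_tensorμ (S.U.pairing A) (S.U.pairing B) (S.U.pairing E) (S.U.pairing F))
  have e := S.U.adj_unique_prodPairing h (h'.congr rfl (by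
    rw [map_q_tensorμ]
    simp))
  exact S.map_tensorHom_comp_seqMap e
end StrongBVCategory

/-! ### Interpretations of formulas and derivations -/

section

set_option linter.unusedSectionVars false

variable {D : Type u₂} [Category.{v₂} D] [MonoidalCategory D]

/-- Here `s`, `t`, `r`, `q` stand for the comparisons of connectives with the tensor product, and
`a`, `b`, `c` for the comparisons of the subformulas. Kept as variables, they make one lemma serve
all three connectives; the lemmas that follow have the same form. -/
theorem associator_transport {W W' PQ QR P Q R P' Q' R' : D} {f : W ⟶ W'} {s : W ≅ PQ ⊗ R}
    {t : PQ ≅ P ⊗ Q} {r : QR ≅ Q ⊗ R} {q : W' ≅ P ⊗ QR} (a : P ≅ P') (b : Q ≅ Q') (c : R ≅ R')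
    (h : f = s.hom ≫ t.hom ▷ R ≫ (α_ P Q R).hom ≫ P ◁ r.inv ≫ q.inv) :
    f ≫ (q ≪≫ tensorIso a (r ≪≫ tensorIso b c)).hom =
      (s ≪≫ tensorIso (t ≪≫ tensorIso a b) c).hom ≫ (α_ P' Q' R').hom := by
  have h₁ : P ◁ r.inv ≫ (a.hom ⊗ₘ (r.hom ≫ (b.hom ⊗ₘ c.hom))) =
      a.hom ⊗ₘ (b.hom ⊗ₘ c.hom) := by
    rw [← id_tensorHom, MonoidalCategory.tensorHom_comp_tensorHom]
    simp
  have h₂ : ((t.hom ≫ (a.hom ⊗ₘ b.hom)) ⊗ₘ c.hom) =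
      t.hom ▷ R ≫ ((a.hom ⊗ₘ b.hom) ⊗ₘ c.hom) := by
    rw [← tensorHom_id, MonoidalCategory.tensorHom_comp_tensorHom]
    simp
  simp only [h, Iso.trans_hom, tensorIso_hom, Category.assoc, Iso.inv_hom_id_assoc, h₁, h₂,
    associator_naturality]

theorem associator_inv_transport {W W' PQ QR P Q R P' Q' R' : D} {f : W' ⟶ W} {s : W ≅ PQ ⊗ R}
    {t : PQ ≅ P ⊗ Q} {r : QR ≅ Q ⊗ R} {q : W' ≅ P ⊗ QR} (a : P ≅ P') (b : Q ≅ Q') (c : R ≅ R')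
    (h : f = q.hom ≫ P ◁ r.hom ≫ (α_ P Q R).inv ≫ t.inv ▷ R ≫ s.inv) :
    f ≫ (s ≪≫ tensorIso (t ≪≫ tensorIso a b) c).hom =
      (q ≪≫ tensorIso a (r ≪≫ tensorIso b c)).hom ≫ (α_ P' Q' R').inv := by
  rw [Iso.eq_comp_inv, Category.assoc,
    ← associator_transport (s := s) (t := t) (r := r) (q := q) a b c rfl, h]
  simp

theorem rightUnitor_transport {W X X' I : D} {f : W ⟶ X} {s : W ≅ X ⊗ I} {i : I ≅ 𝟙_ D}
    (a : X ≅ X') (h : f = s.hom ≫ X ◁ i.hom ≫ (ρ_ X).hom) :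
    f ≫ a.hom = (s ≪≫ tensorIso a i).hom ≫ (ρ_ X').hom := by
  simp [h, MonoidalCategory.tensorHom_def']

theorem leftUnitor_transport {W X X' I : D} {f : W ⟶ X} {s : W ≅ I ⊗ X} {i : I ≅ 𝟙_ D}
    (a : X ≅ X') (h : f = s.hom ≫ i.hom ▷ X ≫ (λ_ X).hom) :
    f ≫ a.hom = (s ≪≫ tensorIso i a).hom ≫ (λ_ X').hom := by
  simp [h, MonoidalCategory.tensorHom_def]

variable [SymmetricCategory D]

theorem braiding_transport {W W' X Y X' Y' : D} {f : W ⟶ W'} {s : W ≅ X ⊗ Y} {t : W' ≅ Y ⊗ X}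
    (a : X ≅ X') (b : Y ≅ Y') (h : f = s.hom ≫ (β_ X Y).hom ≫ t.inv) :
    f ≫ (t ≪≫ tensorIso b a).hom = (s ≪≫ tensorIso a b).hom ≫ (β_ X' Y').hom := by
  simp [h]

theorem tensorμ_transport {W W' X Y Z T P Q R S P' Q' R' S' : D} {f : W ⟶ W'} {s : W ≅ X ⊗ Y}
    {s₁ : X ≅ P ⊗ Q} {s₂ : Y ≅ R ⊗ S} {t : W' ≅ Z ⊗ T} {t₁ : Z ≅ P ⊗ R} {t₂ : T ≅ Q ⊗ S}
    (a : P ≅ P') (b : Q ≅ Q') (c : R ≅ R') (d : S ≅ S')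
    (h : f = s.hom ≫ (s₁.hom ⊗ₘ s₂.hom) ≫ tensorμ P Q R S ≫ (t₁.inv ⊗ₘ t₂.inv) ≫ t.inv) :
    f ≫ (t ≪≫ tensorIso (t₁ ≪≫ tensorIso a c) (t₂ ≪≫ tensorIso b d)).hom =
      (s ≪≫ tensorIso (s₁ ≪≫ tensorIso a b) (s₂ ≪≫ tensorIso c d)).hom ≫
        tensorμ P' Q' R' S' := by
  simp only [h, Iso.trans_hom, tensorIso_hom, Category.assoc, Iso.inv_hom_id_assoc,
    ← MonoidalCategory.tensorHom_comp_tensorHom, MonoidalCategory.tensorHom_comp_tensorHom_assoc,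
    Iso.inv_hom_id, id_tensorHom_id, Category.id_comp, tensorμ_natural]

theorem tensorHom_transport {W W' X Y Z T X' Y' Z' T' : D} {k : W ⟶ W'} {s : W ≅ X ⊗ Y}
    {t : W' ≅ Z ⊗ T} {f : X ⟶ Z} {g : Y ⟶ T} {a : X ≅ X'} {b : Y ≅ Y'} {c : Z ≅ Z'} {d : T ≅ T'}
    {f' : X' ⟶ Z'} {g' : Y' ⟶ T'} (hf : f ≫ c.hom = a.hom ≫ f') (hg : g ≫ d.hom = b.hom ≫ g')
    (h : k = s.hom ≫ (f ⊗ₘ g) ≫ t.inv) :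
    k ≫ (t ≪≫ tensorIso c d).hom = (s ≪≫ tensorIso a b).hom ≫ (f' ⊗ₘ g') := by
  simp [h, MonoidalCategory.tensorHom_comp_tensorHom, hf, hg]

end

/-! ### Comparison of the interpretations in `C` and in `D` -/

namespace StrongBVCategory

set_option linter.unusedSectionVars false

variable {𝒜 : Type u} {C : Type u₁} [Category.{v₁} C] [MonoidalCategory C] [SymmetricCategory C]
  [StarAutonomous C] {D : Type u₂} [Category.{v₂} D] [MonoidalCategory D] [SymmetricCategory D]
  [LeftRigidCategory D] [StrictCompactClosed D] (S : StrongBVCategory C D) (c : 𝒜 → C)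

/-- `U` sends the interpretation of every connective to the tensor product. -/
def connIso : (o : Conn) → (A B : C) → (S.U.obj (S.conn o A B) ≅ S.U.obj A ⊗ S.U.obj B)
  | .par => S.U.parIso
  | .seq => S.seqIso
  | .tens => S.U.tensIso

/-- The interpretation of the literals in the target of `U`. -/
def litModel : LitModel 𝒜 D where
  lit
    | .pos a => S.U.obj (c a)
    | .neg a => S.U.obj (dual (c a))
  cap a := S.U.cap (c a)
  cup a := S.U.pairing' (c a)
  snake a := S.U.snake (c a)

/-- The image under `U` of the interpretation of a formula. -/
def objIso : (A : Fm 𝒜) → (S.U.obj (S.obj c A) ≅ (S.litModel c).fm A)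
  | .unit => S.U.unitIso
  | .atom _ => Iso.refl _
  | .natom _ => Iso.refl _
  | .bin o A B => S.connIso o (S.obj c A) (S.obj c B) ≪≫ tensorIso (objIso A) (objIso B)

theorem map_connMap (o : Conn) {A A' B B' : C} (f : A ⟶ A') (g : B ⟶ B') :
    S.U.map (S.connMap o f g) =
      (S.connIso o A B).hom ≫ (S.U.map f ⊗ₘ S.U.map g) ≫ (S.connIso o A' B').inv := by
  cases o
  · exact S.U.map_parMap f g
  · exact S.map_seqMap f g
  · exact S.U.map_tensorHom f g

theorem map_eqn {A B : Fm 𝒜} (e : Eqn A B) :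
    S.U.map (S.eqn c e) ≫ (S.objIso c B).hom =
      (S.objIso c A).hom ≫ ((S.litModel c).eqn e).hom := by
  cases e with
  | tensAssoc A B E =>
    exact associator_transport (S.objIso c A) (S.objIso c B) (S.objIso c E) (S.U.map_α _ _ _)
  | tensComm A B => exact braiding_transport (S.objIso c A) (S.objIso c B) (S.U.map_β _ _)
  | tensUnit A => exact rightUnitor_transport (S.objIso c B) (S.U.map_ρ _)
  | parAssoc A B E =>
    have h := S.U.map_parAssoc (S.obj c A) (S.obj c B) (S.obj c E)
    simp only [Category.assoc] at h
    exact associator_transport (S.objIso c A) (S.objIso c B) (S.objIso c E) h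
  | parComm A B => exact braiding_transport (S.objIso c A) (S.objIso c B) (S.U.map_parComm _ _)
  | parUnit A => exact rightUnitor_transport (S.objIso c B) (S.U.map_parUnit _)
  | seqAssoc A B E =>
    exact associator_transport (S.objIso c A) (S.objIso c B) (S.objIso c E)
      (S.map_seqAssoc_hom _ _ _)
  | seqUnitRight A => exact rightUnitor_transport (S.objIso c B) (S.map_seqRightUnit_hom _)
  | seqUnitLeft A => exact leftUnitor_transport (S.objIso c B) (S.map_seqLeftUnit_hom _)

theorem map_iso_inv_comp_map_hom {A B : C} (i : A ≅ B) : S.U.map i.inv ≫ S.U.map i.hom = 𝟙 _ := by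
  rw [← S.U.map_comp, i.inv_hom_id, S.U.map_id]

theorem map_parAssocInv_comp (A B E : C) :
    S.U.map (parAssocInv A B E) ≫ S.U.map (parAssoc A B E) = 𝟙 _ := by
  rw [StrictStarFunctor.map_parAssocInv, StrictStarFunctor.map_parAssoc]
  simp

theorem map_parComm_comp (A B : C) :
    S.U.map (parComm A B) ≫ S.U.map (parComm B A) = 𝟙 _ := by
  rw [StrictStarFunctor.map_parComm, StrictStarFunctor.map_parComm]
  simp

theorem map_parUnitInv_comp (A : C) :
    S.U.map (parUnitInv A) ≫ S.U.map (parUnit A) = 𝟙 _ := by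
  rw [StrictStarFunctor.map_parUnitInv, StrictStarFunctor.map_parUnit]
  simp

/-- A one-sided inverse is enough, since by `map_eqn` the image of the equation is already an
isomorphism up to `objIso`. For par the identity is verified on images, where the coherence of `D`
is available. -/
theorem map_eqnSymm_comp {A B : Fm 𝒜} (e : Eqn A B) :
    S.U.map (S.eqnSymm c e) ≫ S.U.map (S.eqn c e) = 𝟙 _ := by
  cases e with
  | tensAssoc A B E => exact S.map_iso_inv_comp_map_hom _
  | tensComm A B =>
    exact (S.U.map_comp _ _).symm.trans
      ((congrArg S.U.map (SymmetricCategory.symmetry _ _)).trans (S.U.map_id _))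
  | tensUnit A => exact S.map_iso_inv_comp_map_hom _
  | parAssoc A B E => exact S.map_parAssocInv_comp _ _ _
  | parComm A B => exact S.map_parComm_comp _ _
  | parUnit A => exact S.map_parUnitInv_comp _
  | seqAssoc A B E => exact S.map_iso_inv_comp_map_hom _
  | seqUnitRight A => exact S.map_iso_inv_comp_map_hom _
  | seqUnitLeft A => exact S.map_iso_inv_comp_map_hom _

theorem map_eqnSymm {A B : Fm 𝒜} (e : Eqn A B) :
    S.U.map (S.eqnSymm c e) ≫ (S.objIso c A).hom =
      (S.objIso c B).hom ≫ ((S.litModel c).eqn e).inv := by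
  rw [Iso.eq_comp_inv, Category.assoc, ← map_eqn, ← Category.assoc, map_eqnSymm_comp,
    Category.id_comp]

theorem map_rule {A B : Fm 𝒜} (r : Rule A B) :
    S.U.map (S.rule c r) ≫ (S.objIso c B).hom =
      (S.objIso c A).hom ≫ (S.litModel c).rule r := by
  cases r with
  | eqv e => exact S.map_eqn c e
  | eqvSymm e => exact S.map_eqnSymm c e
  | aiDown a =>
    have h : S.U.map (StrictStarFunctor.axiomLink (c a)) ≫ (S.U.parIso (c a) (dual (c a)) ≪≫
        tensorIso (Iso.refl _) (Iso.refl _)).hom = S.U.unitIso.hom ≫ S.U.cap (c a) := by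
      simp [StrictStarFunctor.cap]
    exact h
  | aiUp a =>
    have h : S.U.map ((β_ (c a) (dual (c a))).hom ≫ ev (c a)) ≫ S.U.unitIso.hom =
        (S.U.tensIso (c a) (dual (c a)) ≪≫ tensorIso (Iso.refl _) (Iso.refl _)).hom ≫
          S.U.pairing' (c a) := by
      rw [StrictStarFunctor.pairing'_eq_form, StrictStarFunctor.form]
      simp
    exact h
  | switch A B E =>
    have h := S.U.map_switch (S.obj c A) (S.obj c B) (S.obj c E)
    simp only [Category.assoc] at h
    exact associator_inv_transport (S.objIso c A) (S.objIso c B) (S.objIso c E) h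
  | qDown A B E F =>
    exact tensorμ_transport (S.objIso c A) (S.objIso c B) (S.objIso c E) (S.objIso c F)
      (S.map_q_tensorμ _ _ _ _)
  | qUp A B E F =>
    exact tensorμ_transport (S.objIso c A) (S.objIso c B) (S.objIso c E) (S.objIso c F)
      (S.map_q' _ _ _ _)

/-- The image under `U` of the interpretation of a derivation. -/
theorem map_sem {A B : Fm 𝒜} (Φ : Der A B) :
    S.U.map (S.sem c Φ) ≫ (S.objIso c B).hom = (S.objIso c A).hom ≫ (S.litModel c).der Φ := by
  induction Φ with
  | id A =>
    exact (congrArg (· ≫ _) (S.U.map_id _)).trans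
      ((Category.id_comp _).trans (Category.comp_id _).symm)
  | hor o Φ Ψ ihΦ ihΨ => exact tensorHom_transport ihΦ ihΨ (S.map_connMap o _ _)
  | step Φ r Ψ ihΦ ihΨ =>
    rw [sem, S.U.map_comp, S.U.map_comp, Category.assoc, Category.assoc, ihΨ, LitModel.der,
      ← Category.assoc (S.U.map (S.rule c r)), map_rule, Category.assoc,
      ← Category.assoc (S.U.map _), ihΦ, Category.assoc]

end StrongBVCategory
end BV

theorem mainTheorem3 {𝒜 : Type u}
    {C : Type u₁} [Category.{v₁} C] [MonoidalCategory C] [SymmetricCategory C]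
    [BV.StarAutonomous C]
    {D : Type u₂} [Category.{v₂} D] [MonoidalCategory D] [SymmetricCategory D]
    [LeftRigidCategory D] [BV.StrictCompactClosed D]
    (S : BV.StrongBVCategory C D) (c : 𝒜 → C)
    {F : BV.Fm 𝒜} {Φ Φ' : BV.Der BV.Fm.unit F} (h : BV.CE Φ Φ') :
    S.sem c Φ = S.sem c Φ' := by
  refine S.U.faithful.map_injective ?_
  rw [← cancel_mono (S.objIso c F).hom, S.map_sem, S.map_sem, (S.litModel c).der_ce h]
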